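/- Let $n\ge 1$, let $n>d_1>d_2>\dots>d_\ell>0$ with $\ell\ge 1$, and put $m=d_1$. A flag of shape $d$ is a chain $V_\ell\subset\dots\subset V_1\subset\mathbb R^n$ of subspaces with $\dim V_i=d_i$; the set $\mathscr D_d$ of these flags carries its $O(n)$-invariant probability measure. To a flag $\Delta$ attach an $n\times m$ matrix $X_\Delta$ with orthonormal columns whose first $d_i$ columns span $V_i$ for every $i$; it is unique up to right multiplication by $O(\underline m)=O(d_\ell)\times O(d_{\ell-1}-d_\ell)\times\dots\times O(d_1-d_2)\subset O(m)$, embedded block-diagonally. A polynomial $f$ in the entries of an $n\times m$ matrix $X$ of unknowns which is $O(\underline m)$-invariant, i.e. $f(Xh)=f(X)$ for all $h\in O(\underline m)$, defines a function $f(\Delta)=f(X_\Delta)$ on $\mathscr D_d$; if $f$ has degree $\le t$, we call this a polynomial function of degree $\le t$. A non-empty finite set $\mathcal D\subset\mathscr D_d$ is a vexillar $t$-design if $\int_{\mathscr D_d}f(\Delta)\,d\Delta=\frac1{|\mathcal D|}\sum_{\Delta\in\mathcal D}f(\Delta)$ for every polynomial function $f$ of degree $\le t$. For a partition $\mu$,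 with $k$ parts and conjugate $\breve\mu$, and $p\ge 0$, realise the Schur module $\mathbb S^\mu(\mathbb R^p)$ inside the polynomials in the entries of a $p\times k$ matrix $Z=(z_1,\dots,z_k)$ of unknowns: the diagram of $\mu$ inscribed with vectors $v_{a,j}\in\mathbb R^p$ ($a$ the row, $j$ the column) stands for $\prod_j\det(\langle v_{a,j},z_b\rangle)_{1\le a,b\le\breve\mu_j}$, and $\mathbb S^\mu(\mathbb R^p)$ is spanned by the flag vectors $e_A(Z)=\prod_j\delta_{\breve\mu_j}(A^{T}Z)$, $A\in M_{p,k}(\mathbb R)$, where $\delta_r$ is the leading principal minor of size $r$ (all entries of row $a$ of the diagram are the $a$-th column of $A$). A matrix $g$ acts by $(g\cdot V)(Z)=V(g^TZ)$. Let $N^\mu=\mathbb S^\mu(\mathbb R^m)^{O(\underline m)}$. Let $\langle\cdot,\cdot\rangle$ be the scalar product on polynomials for which distinct monomials are orthogonal and $\langle x^\alpha,x^\alpha\rangle=\alpha!/|\alpha|!$. Let $\mathbb S^{[\mu]}=\mathbb S^{[\mu]}(\mathbb R^n)$ be the orthogonal complement in $\mathbb S^\mu(\mathbb R^n)$ of the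 span of all sums $\sum_{i_1<\dots<i_r}V_{i_1,\dots,i_r}$, where $r\ge1$ and $V_{i_1,\dots,i_r}$ arises from a diagram inscribed with vectors by writing, in order, the standard basis vectors $e_{i_1},\dots,e_{i_r}$ into $r$ chosen boxes of each of two distinct columns. Let $\phi$ be the bilinear map from $\mathbb S^\mu(\mathbb R^n)\times\mathbb S^\mu(\mathbb R^m)$ to the polynomials in $X$ with $\phi(e_A\otimes e_B)(X)=\prod_j\delta_{\breve\mu_j}(A^TXB)$. For $\Xi,\Xi'\in N^\mu$ and an orthonormal basis $h_1,\dots,h_N$ of $\mathbb S^{[\mu]}$, put $Z_{\Xi,\Xi'}(\Delta,\Delta')=\frac1N\sum_{i=1}^N\phi(h_i\otimes\Xi)(\Delta)\,\phi(h_i\otimes\Xi')(\Delta')$ (and $0$ if $N=0$); this does not depend on the basis. Theorem. For every integer $t\ge0$ and every non-empty finite set $\mathcal D\subset\mathscr D_d$, the following conditions are equivalent: 1. $\mathcal D$ is a vexillar $t$-design. 2. For every homogeneous $O(\underline m)$-invariant polynomial $f$ of degree at most $t$ and every $\tau\in O(n)$, $\sum_{\Delta\in\mathcal D}f(\Delta)=\sum_{\Delta\in\mathcal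 D}f(\tau\cdot\Delta)$. 3. For every partition $\mu$ with $0<|\mu|\le t$, every $\Xi\in N^\mu$ and every $f\in\phi(\mathbb S^{[\mu]}\otimes\Xi)$, $\sum_{\Delta\in\mathcal D}f(\Delta)=0$. 4. For every partition $\mu$ with $0<|\mu|\le t$, all $\Xi,\Xi'\in N^\mu$ and every $\Delta'\in\mathscr D_d$, $\sum_{\Delta\in\mathcal D}Z_{\Xi,\Xi'}(\Delta,\Delta')=0$. -/

import Mathlib

noncomputable section

namespace Vexillar

open Matrix MvPolynomial

/-! ### Shapes and flags -/

/-- A shape `d = (d₁ > d₂ > ⋯ > d_ℓ)` of flags of `ℝⁿ`, with `ℓ = len + 1 ≥ 1` and `0 < dᵢ < n`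
(so `d.dim 0` is `d₁ = m`). -/
structure FlagShape (n : ℕ) where
  len : ℕ
  dim : Fin (len + 1) → ℕ
  strictAnti : StrictAnti dim
  pos : ∀ i, 0 < dim i
  lt : ∀ i, dim i < n

/-- `m = d₁`, the largest dimension of the shape. -/
abbrev FlagShape.m {n : ℕ} (d : FlagShape n) : ℕ := d.dim 0

lemma FlagShape.dim_le {n : ℕ} (d : FlagShape n) (i : Fin (d.len + 1)) : d.dim i ≤ d.m :=
  d.strictAnti.antitone (Fin.zero_le i)

/-- Flags `V_ℓ ⊂ ⋯ ⊂ V₁` of `ℝⁿ` of shape `d`. -/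
@[ext] structure Flag {n : ℕ} (d : FlagShape n) where
  V : Fin (d.len + 1) → Submodule ℝ (Fin n → ℝ)
  antitone : Antitone V
  finrank_eq : ∀ i, Module.finrank ℝ (V i) = d.dim i

/-- The natural action of the orthogonal group on flags. -/
def Flag.act {n : ℕ} {d : FlagShape n} (τ : orthogonalGroup (Fin n) ℝ) (Δ : Flag d) : Flag d where
  V i := (Δ.V i).map (UnitaryGroup.toLinearEquiv τ).toLinearMap
  antitone _ _ h := Submodule.map_mono (Δ.antitone h)
  finrank_eq i := (LinearEquiv.finrank_map_eq _ _).trans (Δ.finrank_eq i)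

/-- `X` represents the flag `Δ`: its columns are orthonormal and the first `dᵢ` of them
span `Vᵢ`, for every `i`. -/
def Represents {n : ℕ} {d : FlagShape n} (X : Matrix (Fin n) (Fin d.m) ℝ) (Δ : Flag d) : Prop :=
  Xᵀ * X = 1 ∧
    ∀ i, Submodule.span ℝ {v | ∃ j : Fin d.m, (j : ℕ) < d.dim i ∧ v = X.col j} = Δ.V i

/-- An auxiliary step: orthonormal vectors adapted to a flag, one more at a time. -/
lemma exists_adapted {n : ℕ} {d : FlagShape n} (Δ : Flag d) (k : ℕ) (hk : k ≤ d.m) :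
    ∃ v : Fin k → EuclideanSpace ℝ (Fin n), Orthonormal ℝ v ∧
      ∀ i (j : Fin k), (j : ℕ) < d.dim i →
        v j ∈ (Δ.V i).map (WithLp.linearEquiv 2 ℝ (Fin n → ℝ)).symm.toLinearMap := by
  induction k with
  | zero => exact ⟨Fin.elim0, ⟨fun i => i.elim0, fun i => i.elim0⟩, fun _ j => j.elim0⟩
  | succ k ih =>
    obtain ⟨v, hv, hmem⟩ := ih (Nat.le_of_succ_le hk)
    let e : (Fin n → ℝ) →ₗ[ℝ] EuclideanSpace ℝ (Fin n) :=
      (WithLp.linearEquiv 2 ℝ (Fin n → ℝ)).symm.toLinearMap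
    obtain ⟨i₀, hi₀, hmax⟩ : ∃ i₀, k < d.dim i₀ ∧ ∀ i, k < d.dim i → i ≤ i₀ := by
      have hne : (Finset.univ.filter fun i => k < d.dim i).Nonempty :=
        ⟨0, by simpa using hk⟩
      refine ⟨_, (Finset.mem_filter.1 (Finset.max'_mem _ hne)).2, fun i hi => ?_⟩
      exact Finset.le_max' _ _ (by simpa using hi)
    have hdim : Module.finrank ℝ ((Δ.V i₀).map e) = d.dim i₀ :=
      (LinearEquiv.finrank_map_eq (WithLp.linearEquiv 2 ℝ (Fin n → ℝ)).symm _).trans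
        (Δ.finrank_eq i₀)
    have hspan : Module.finrank ℝ (Submodule.span ℝ (Set.range v)) = k := by
      simpa using finrank_span_eq_card hv.linearIndependent
    obtain ⟨u, hu, hu0, huv⟩ : ∃ u : EuclideanSpace ℝ (Fin n),
        u ∈ (Δ.V i₀).map e ∧ u ≠ 0 ∧ ∀ j, inner ℝ (v j) u = 0 := by
      have hlt : 0 < Module.finrank ℝ
          (((Δ.V i₀).map e ⊓ (Submodule.span ℝ (Set.range v))ᗮ : Submodule ℝ _)) := by
        have h1 := Submodule.finrank_sup_add_finrank_inf_eq ((Δ.V i₀).map e)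
          (Submodule.span ℝ (Set.range v))ᗮ
        have h2 := Submodule.finrank_add_finrank_orthogonal (Submodule.span ℝ (Set.range v))
        have h3 := Submodule.finrank_le ((Δ.V i₀).map e ⊔ (Submodule.span ℝ (Set.range v))ᗮ)
        rw [hdim] at h1
        rw [hspan] at h2
        omega
      have := Module.finrank_pos_iff.1 hlt
      obtain ⟨⟨u, hu1, hu2⟩, hu0⟩ := exists_ne
        (0 : ((Δ.V i₀).map e ⊓ (Submodule.span ℝ (Set.range v))ᗮ : Submodule ℝ _))
      refine ⟨u, hu1, fun h => hu0 (Subtype.ext h), fun j => ?_⟩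
      exact (Submodule.mem_orthogonal _ _).1 hu2 _ (Submodule.subset_span ⟨j, rfl⟩)
    refine ⟨Fin.snoc v ((‖u‖⁻¹ : ℝ) • u), ⟨fun j => ?_, fun j j' hjj => ?_⟩, fun i j hj => ?_⟩
    · refine Fin.lastCases ?_ (fun j => ?_) j
      · simp [norm_smul, hu0]
      · simpa using hv.1 j
    · revert hjj
      refine Fin.lastCases (Fin.lastCases (fun h => absurd rfl h) (fun j' _ => ?_) j')
        (fun j => Fin.lastCases (fun _ => ?_) (fun j' h => ?_) j') j
      · simp [inner_smul_left, (real_inner_comm _ _).trans (huv j')]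
      · simp [inner_smul_right, huv j]
      · simpa using hv.2 (fun h' => h (by rw [h']))
    · revert hj
      refine Fin.lastCases (fun hj => ?_) (fun j hj => ?_) j
      · rw [Fin.snoc_last]
        exact Submodule.smul_mem _ _ (Submodule.map_mono (Δ.antitone (hmax i (by simpa using hj))) hu)
      · rw [Fin.snoc_castSucc]
        exact hmem i j (by simpa using hj)

lemma exists_represents {n : ℕ} {d : FlagShape n} (Δ : Flag d) :
    ∃ X : Matrix (Fin n) (Fin d.m) ℝ, Represents X Δ := by
  obtain ⟨v, hv, hmem⟩ := exists_adapted Δ d.m le_rfl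
  refine ⟨Matrix.of fun i j => v j i, ?_, fun i => ?_⟩
  · ext a b
    have := orthonormal_iff_ite.1 hv a b
    rw [Matrix.one_apply, ← this]
    simp [Matrix.mul_apply, PiLp.inner_apply, mul_comm]
  · have hli : LinearIndependent ℝ fun j : Fin d.m => (WithLp.linearEquiv 2 ℝ (Fin n → ℝ)) (v j) :=
      hv.linearIndependent.map' (WithLp.linearEquiv 2 ℝ (Fin n → ℝ)).toLinearMap
        (LinearEquiv.ker _)
    have hli' : LinearIndependent ℝ fun j : {j : Fin d.m // (j : ℕ) < d.dim i} =>
        (WithLp.linearEquiv 2 ℝ (Fin n → ℝ)) (v j.1) := hli.comp _ Subtype.val_injective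
    have hset : {w | ∃ j : Fin d.m, (j : ℕ) < d.dim i ∧
          w = (Matrix.of fun i j => v j i : Matrix (Fin n) (Fin d.m) ℝ).col j} =
        Set.range fun j : {j : Fin d.m // (j : ℕ) < d.dim i} =>
          (WithLp.linearEquiv 2 ℝ (Fin n → ℝ)) (v j.1) := by
      ext w
      constructor
      · rintro ⟨j, hj, rfl⟩
        exact ⟨⟨j, hj⟩, rfl⟩
      · rintro ⟨⟨j, hj⟩, rfl⟩
        exact ⟨j, hj, rfl⟩
    rw [hset]
    refine Submodule.eq_of_le_of_finrank_eq (Submodule.span_le.2 ?_) ?_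
    · rintro _ ⟨⟨j, hj⟩, rfl⟩
      obtain ⟨w, hw, hwe⟩ := hmem i j hj
      have : (WithLp.linearEquiv 2 ℝ (Fin n → ℝ)) (v j) = w := by
        rw [← hwe]; rfl
      simpa only [this, SetLike.mem_coe] using hw
    · rw [finrank_span_eq_card hli', Fintype.card_subtype, Fin.card_filter_val_lt,
        min_eq_right (d.dim_le i), Δ.finrank_eq]

/-- A matrix `X_Δ` representing the flag `Δ`. -/
def Flag.matrix {n : ℕ} {d : FlagShape n} (Δ : Flag d) : Matrix (Fin n) (Fin d.m) ℝ :=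
  (exists_represents Δ).choose

/-- The flag whose `i`-th space is spanned by the first `dᵢ` columns of `g ∈ O(n)`, that is, the
image under `g` of the standard flag. -/
def flagOf {n : ℕ} (d : FlagShape n) (g : orthogonalGroup (Fin n) ℝ) : Flag d where
  V i := Submodule.span ℝ {v | ∃ j : Fin n, (j : ℕ) < d.dim i ∧ v = g.1.col j}
  antitone i i' h := Submodule.span_mono fun v ⟨j, hj, hv⟩ =>
    ⟨j, lt_of_lt_of_le hj (d.strictAnti.antitone h), hv⟩
  finrank_eq i := by
    have hli : LinearIndependent ℝ g.1.col :=
      Matrix.linearIndependent_cols_of_isUnit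
        ((Matrix.isUnit_iff_isUnit_det _).2 (UnitaryGroup.det_isUnit g))
    have hli' : LinearIndependent ℝ fun j : {j : Fin n // (j : ℕ) < d.dim i} => g.1.col j.1 :=
      hli.comp _ Subtype.val_injective
    have hset : {v | ∃ j : Fin n, (j : ℕ) < d.dim i ∧ v = g.1.col j} =
        Set.range fun j : {j : Fin n // (j : ℕ) < d.dim i} => g.1.col j.1 := by
      ext v
      constructor
      · rintro ⟨j, hj, rfl⟩
        exact ⟨⟨j, hj⟩, rfl⟩
      · rintro ⟨⟨j, hj⟩, rfl⟩
        exact ⟨j, hj, rfl⟩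
    rw [hset, finrank_span_eq_card hli', Fintype.card_subtype,
      Fin.card_filter_val_lt, min_eq_right (d.lt i).le]

/-! ### The invariant probability measure on the flag manifold -/

instance (n : ℕ) : MeasurableSpace (orthogonalGroup (Fin n) ℝ) := borel _

instance (n : ℕ) : BorelSpace (orthogonalGroup (Fin n) ℝ) := ⟨rfl⟩

instance (n : ℕ) : CompactSpace (orthogonalGroup (Fin n) ℝ) := by
  refine isCompact_iff_compactSpace.1 ?_
  have hK : IsCompact (Set.univ.pi fun _ : Fin n => Set.univ.pi fun _ : Fin n =>
      Set.Icc (-1 : ℝ) 1) :=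
    isCompact_univ_pi fun _ => isCompact_univ_pi fun _ => isCompact_Icc
  have hcl : IsClosed ((orthogonalGroup (Fin n) ℝ : Submonoid (Matrix (Fin n) (Fin n) ℝ)) :
      Set (Matrix (Fin n) (Fin n) ℝ)) := by
    have : ((orthogonalGroup (Fin n) ℝ : Submonoid (Matrix (Fin n) (Fin n) ℝ)) :
        Set (Matrix (Fin n) (Fin n) ℝ)) = {A | A * Aᵀ = 1} := by
      ext A
      exact mem_orthogonalGroup_iff _ _
    rw [this]
    exact isClosed_eq (by fun_prop) continuous_const
  refine IsCompact.of_isClosed_subset hK hcl fun U hU i _ j _ => ?_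
  exact abs_le.1 (entry_norm_bound_of_unitary hU i j)

/-- The flag manifold carries the quotient σ-algebra of `O(n) → O(n) / (O(m₁) × ⋯ × O(m_{ℓ+1}))`. -/
instance {n : ℕ} (d : FlagShape n) : MeasurableSpace (Flag d) :=
  MeasurableSpace.map (flagOf d) inferInstance

/-- The `O(n)`-invariant measure of total mass one on the flag manifold: the image of the
normalised Haar measure of `O(n)`. -/
def flagMeasure {n : ℕ} (d : FlagShape n) : MeasureTheory.Measure (Flag d) :=
  (MeasureTheory.Measure.haarMeasure
    (⊤ : TopologicalSpace.PositiveCompacts (orthogonalGroup (Fin n) ℝ))).map (flagOf d)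

/-! ### Polynomial functions on the flag manifold -/

/-- `Reg(M_{n,m})`: polynomials in the entries of an `n × m` matrix of unknowns. -/
abbrev Reg (n m : ℕ) : Type := MvPolynomial (Fin n × Fin m) ℝ

/-- `V ↦ V(X B)`, where `X` is an `n × m` matrix of unknowns. -/
def rightSub {n m k : ℕ} (B : Matrix (Fin m) (Fin k) ℝ) : Reg n k →ₐ[ℝ] Reg n m :=
  aeval fun p => ∑ j, X (p.1, j) * C (B j p.2)

/-- `Ξ ↦ Ξ(Xᵀ A)`, where `X` is an `n × m` matrix of unknowns. -/
def leftSub {n m k : ℕ} (A : Matrix (Fin n) (Fin k) ℝ) : Reg m k →ₐ[ℝ] Reg n m :=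
  aeval fun p => ∑ i, X (i, p.1) * C (A i p.2)

/-- The block-diagonal orthogonal matrices `O(m₁) × ⋯ × O(m_ℓ) ⊆ O(m)`: two indices belong to the
same block when no `dᵢ` separates them. -/
def IsBlockOrthogonal {n : ℕ} (d : FlagShape n) (h : Matrix (Fin d.m) (Fin d.m) ℝ) : Prop :=
  h ∈ orthogonalGroup (Fin d.m) ℝ ∧
    ∀ a b, h a b ≠ 0 → ∀ i, (a : ℕ) < d.dim i ↔ (b : ℕ) < d.dim i

/-- `f(X h) = f(X)` for all `h ∈ O(m₁) × ⋯ × O(m_ℓ)`, so that `f` defines a function of flags. -/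
def RightInvariant {n : ℕ} (d : FlagShape n) (f : Reg n d.m) : Prop :=
  ∀ h, IsBlockOrthogonal d h → rightSub h f = f

/-- The value `f(Δ) = f(X_Δ)`. -/
def evalFlag {n : ℕ} {d : FlagShape n} (f : Reg n d.m) (Δ : Flag d) : ℝ :=
  eval (fun p => Δ.matrix p.1 p.2) f

open MeasureTheory in
/-- Vexillar `t`-designs: the quadrature formula holds for all polynomial functions of degree at
most `t` on the flag manifold. -/
def IsVexillarDesign {n : ℕ} {d : FlagShape n} (t : ℕ) (D : Finset (Flag d)) : Prop :=
  ∀ f : Reg n d.m, f.totalDegree ≤ t → RightInvariant d f →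
    ∫ Δ, evalFlag f Δ ∂(flagMeasure d) = (D.card : ℝ)⁻¹ * ∑ Δ ∈ D, evalFlag f Δ

/-- The scalar product on polynomials for which distinct monomials are orthogonal and
`⟨x^α, x^α⟩ = α! / |α|!`. -/
def scalar {σ : Type} (f g : MvPolynomial σ ℝ) : ℝ :=
  ∑ α ∈ f.support,
    ((α.prod fun _ k => (k.factorial : ℝ)) / (α.degree.factorial : ℝ)) * (f.coeff α * g.coeff α)

/-! ### Schur modules

Partitions are Young diagrams; the cell `(i, j)` lies in row `i` and column `j`, so that
`μ.colLen 0` is the number of parts. The Schur module `𝕊^μ(ℝᵖ)` is realised inside the polynomials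
in the entries of a matrix `Z` with `p` rows and as many columns as `μ` has parts. -/

/-- Number of parts of `μ`. -/
abbrev depth (μ : YoungDiagram) : ℕ := μ.colLen 0

lemma cell_row_lt {μ : YoungDiagram} (c : μ.cells) : c.1.1 < depth μ :=
  lt_of_lt_of_le (YoungDiagram.mem_iff_lt_colLen.1 ((YoungDiagram.mem_cells _).1 c.2))
    (μ.colLen_anti _ _ (Nat.zero_le _))

/-- The cell in row `a` of column `j`. -/
def cell {μ : YoungDiagram} (j : ℕ) (a : Fin (μ.colLen j)) : μ.cells :=
  ⟨(a, j), (YoungDiagram.mem_cells _).2 (YoungDiagram.mem_iff_lt_colLen.2 a.2)⟩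

/-- The element given by the diagram `μ` inscribed with the vectors `v c` of `ℝᵖ`:
`∏_j det (⟨v_{(a,j)}, z_b⟩)_{a,b}`, where `z_b` are the columns of `Z`. If `v` is inscribed with
basis vectors `e_{T(c)}`, it is the determinantal monomial of `T` and the initial tableau. -/
def tabVec {μ : YoungDiagram} {p : ℕ} (v : μ.cells → Fin p → ℝ) : Reg p (depth μ) :=
  ∏ j : Fin (μ.rowLen 0), Matrix.det (Matrix.of fun a b : Fin (μ.colLen j) =>
    ∑ r, C (v (cell j a) r) * X (r, Fin.castLE (μ.colLen_anti _ _ (Nat.zero_le _)) b))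

/-- The flag vector of a matrix `A`: the diagram with the `i`-th column of `A` in every cell of
row `i`; as a polynomial, `Z ↦ ∏_j (leading minor of size μ.colLen j of Aᵀ Z)`. -/
def flagVec (μ : YoungDiagram) {p : ℕ} (A : Matrix (Fin p) (Fin (depth μ)) ℝ) : Reg p (depth μ) :=
  tabVec fun (c : μ.cells) r => A r ⟨c.1.1, cell_row_lt c⟩

/-- Formal linear combinations of flag vectors, read as polynomials. -/
def combine (p : ℕ) (μ : YoungDiagram) :
    (Matrix (Fin p) (Fin (depth μ)) ℝ →₀ ℝ) →ₗ[ℝ] Reg p (depth μ) :=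
  Finsupp.linearCombination ℝ (flagVec μ)

/-- The Schur module `𝕊^μ(ℝᵖ)`: the irreducible polynomial `GL_p`-module spanned by the flag
vectors, which are the translates of the highest weight vector (the product of the leading minors
of `Z` of sizes `μ.colLen j`). -/
abbrev schur (p : ℕ) (μ : YoungDiagram) : Submodule ℝ (Reg p (depth μ)) :=
  LinearMap.range (combine p μ)

/-- The action `(g · V)(Z) = V(gᵀ Z)`; on inscribed diagrams, `g` is applied to the vectors. -/
def actLeft {p k : ℕ} (g : Matrix (Fin p) (Fin p) ℝ) : Reg p k →ₐ[ℝ] Reg p k :=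
  aeval fun q => ∑ s, C (g s q.1) * X (s, q.2)

/-- `N^μ`, the vectors of `𝕊^μ(ℝᵐ)` fixed by `O(m₁) × ⋯ × O(m_ℓ)`. -/
def invariants {n : ℕ} (d : FlagShape n) (μ : YoungDiagram) : Submodule ℝ (schur d.m μ) where
  carrier := {Ξ | ∀ h, IsBlockOrthogonal d h → actLeft h Ξ.1 = Ξ.1}
  add_mem' ha hb h hh := by simp [ha h hh, hb h hh]
  zero_mem' h _ := by simp
  smul_mem' c x hx h hh := by simp [hx h hh]

/-- The diagram obtained from `v` by writing, in order, the basis vectors `e_{I 0}, e_{I 1}, …` in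
the selected rows `s` of column `j` and also in the selected rows `s'` of column `j'`. -/
def substitute {μ : YoungDiagram} {n r : ℕ} (v : μ.cells → Fin n → ℝ) (j j' : ℕ)
    (s : Fin r ↪o Fin (μ.colLen j)) (s' : Fin r ↪o Fin (μ.colLen j')) (I : Fin r ↪o Fin n) :
    μ.cells → Fin n → ℝ :=
  Function.extend (fun a => cell j (s a)) (fun a => Pi.single (I a) 1)
    (Function.extend (fun a => cell j' (s' a)) (fun a => Pi.single (I a) 1) v)

/-- `J^μ`, spanned by the sums over `I = (i₁ < ⋯ < i_r)`, `r ≥ 1`, of the diagrams in which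
`e_{i₁}, …, e_{i_r}` have been written in `r` boxes of each of two distinct columns. -/
def traceSpan (n : ℕ) (μ : YoungDiagram) : Submodule ℝ (Reg n (depth μ)) :=
  Submodule.span ℝ {f | ∃ (v : μ.cells → Fin n → ℝ) (j j' : ℕ) (r : ℕ)
    (s : Fin r ↪o Fin (μ.colLen j)) (s' : Fin r ↪o Fin (μ.colLen j')),
    j ≠ j' ∧ 0 < r ∧ f = ∑ I : Fin r ↪o Fin n, tabVec (substitute v j j' s s' I)}

lemma scalar_eq_sum {σ : Type} (f g : MvPolynomial σ ℝ) (S : Finset (σ →₀ ℕ))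
    (hS : f.support ⊆ S) : scalar f g = ∑ α ∈ S,
      ((α.prod fun _ k => (k.factorial : ℝ)) / (α.degree.factorial : ℝ)) *
        (f.coeff α * g.coeff α) := by
  refine Finset.sum_subset hS fun _ _ h => ?_
  rw [notMem_support_iff.1 h]; simp

lemma scalar_comm {σ : Type} (f g : MvPolynomial σ ℝ) : scalar f g = scalar g f := by
  classical
  rw [scalar_eq_sum f g (f.support ∪ g.support) Finset.subset_union_left,
    scalar_eq_sum g f (f.support ∪ g.support) Finset.subset_union_right]
  exact Finset.sum_congr rfl fun α _ => by ring

lemma scalar_add_left {σ : Type} (f f' g : MvPolynomial σ ℝ) :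
    scalar (f + f') g = scalar f g + scalar f' g := by
  classical
  rw [scalar_eq_sum f g (f.support ∪ f'.support) Finset.subset_union_left,
    scalar_eq_sum f' g (f.support ∪ f'.support) Finset.subset_union_right,
    scalar_eq_sum (f + f') g (f.support ∪ f'.support) support_add, ← Finset.sum_add_distrib]
  exact Finset.sum_congr rfl fun α _ => by rw [coeff_add]; ring

lemma scalar_smul_left {σ : Type} (c : ℝ) (f g : MvPolynomial σ ℝ) :
    scalar (c • f) g = c * scalar f g := by
  classical
  rw [scalar_eq_sum (c • f) g f.support support_smul, scalar, Finset.mul_sum]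
  exact Finset.sum_congr rfl fun _ _ => by rw [coeff_smul, smul_eq_mul]; ring

lemma scalar_self_nonneg {σ : Type} (f : MvPolynomial σ ℝ) : 0 ≤ scalar f f :=
  Finset.sum_nonneg fun _ _ => mul_nonneg
    (div_nonneg (Finset.prod_nonneg fun _ _ => Nat.cast_nonneg _) (Nat.cast_nonneg _))
    (mul_self_nonneg _)

lemma eq_zero_of_scalar_self {σ : Type} (f : MvPolynomial σ ℝ) (h : scalar f f = 0) : f = 0 := by
  by_contra hf
  obtain ⟨α, hα⟩ := Finset.nonempty_iff_ne_empty.2 (mt support_eq_empty.1 hf)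
  have hpos : ∀ β : σ →₀ ℕ,
      0 < (β.prod fun _ k => (k.factorial : ℝ)) / (β.degree.factorial : ℝ) := fun β =>
    div_pos (Finset.prod_pos fun _ _ => Nat.cast_pos.2 (Nat.factorial_pos _))
      (Nat.cast_pos.2 (Nat.factorial_pos _))
  have := (Finset.sum_eq_zero_iff_of_nonneg fun β _ =>
    mul_nonneg (hpos β).le (mul_self_nonneg _)).1 h α hα
  rcases mul_eq_zero.1 this with h1 | h1
  · exact (hpos α).ne' h1
  · exact mem_support_iff.1 hα (mul_self_eq_zero.1 h1)

/-- `𝕊^{[μ]}(ℝⁿ)`: the orthogonal complement of `J^μ` in `𝕊^μ(ℝⁿ)`. Equivalently (Weyl's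
construction) it is the traceless part of `𝕊^μ(ℝⁿ)`: it is `O(n)`-irreducible when the first two
columns of `μ` have total length at most `n`, and zero otherwise. -/
def harmonic (n : ℕ) (μ : YoungDiagram) : Submodule ℝ (schur n μ) where
  carrier := {V | ∀ f ∈ traceSpan n μ, scalar V.1 f = 0}
  add_mem' ha hb f hf := by
    rw [Submodule.coe_add, scalar_add_left, ha f hf, hb f hf, add_zero]
  zero_mem' f _ := by simp [scalar]
  smul_mem' c V hV f hf := by rw [Submodule.coe_smul, scalar_smul_left, hV f hf, mul_zero]

/-! ### The morphism `φ` -/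

lemma rightSub_flagVec {n m : ℕ} (μ : YoungDiagram) (A : Matrix (Fin n) (Fin (depth μ)) ℝ)
    (B : Matrix (Fin m) (Fin (depth μ)) ℝ) :
    rightSub (n := n) B (flagVec μ A) = leftSub A (flagVec μ B) := by
  simp only [flagVec, tabVec, map_prod]
  refine Finset.prod_congr rfl fun j _ => ?_
  rw [AlgHom.map_det, AlgHom.map_det, ← Matrix.det_transpose]
  congr 1
  ext1 a b
  simp only [AlgHom.mapMatrix_apply, Matrix.transpose_apply, Matrix.map_apply, Matrix.of_apply,
    map_sum, map_mul, rightSub, leftSub, aeval_X, algHom_C, algebraMap_eq, cell]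
  simp only [Finset.mul_sum]
  rw [Finset.sum_comm]
  refine Finset.sum_congr rfl fun i _ => Finset.sum_congr rfl fun l _ => ?_
  simp only [Fin.castLE]
  ring

/-- Auxiliary: `(∑ c_B [B]) ↦ (V ↦ ∑ c_B V(X B))`. -/
def phiAux (n m : ℕ) (μ : YoungDiagram) :
    (Matrix (Fin m) (Fin (depth μ)) ℝ →₀ ℝ) →ₗ[ℝ] schur n μ →ₗ[ℝ] Reg n m :=
  Finsupp.linearCombination ℝ fun B => (rightSub B).toLinearMap ∘ₗ (schur n μ).subtype

lemma phiAux_combine {n m : ℕ} (μ : YoungDiagram) (c : Matrix (Fin m) (Fin (depth μ)) ℝ →₀ ℝ)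
    (A : Matrix (Fin n) (Fin (depth μ)) ℝ) (hA : flagVec μ A ∈ schur n μ) :
    phiAux n m μ c ⟨flagVec μ A, hA⟩ = leftSub A (combine m μ c) := by
  simp [phiAux, combine, Finsupp.linearCombination_apply, Finsupp.sum, rightSub_flagVec]

lemma flagVec_mem (p : ℕ) (μ : YoungDiagram) (A : Matrix (Fin p) (Fin (depth μ)) ℝ) :
    flagVec μ A ∈ schur p μ :=
  ⟨Finsupp.single A 1, by simp [combine]⟩

lemma schur_eq_span (p : ℕ) (μ : YoungDiagram) :
    schur p μ = Submodule.span ℝ (Set.range (flagVec μ)) :=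
  Finsupp.range_linearCombination _

lemma ker_combine_le (n m : ℕ) (μ : YoungDiagram) :
    LinearMap.ker (combine m μ) ≤ LinearMap.ker (phiAux n m μ) := by
  intro c hc
  rw [LinearMap.mem_ker] at hc ⊢
  ext1 V
  obtain ⟨V, hV⟩ := V
  obtain ⟨e, rfl⟩ := id hV
  have : (⟨combine n μ e, hV⟩ : schur n μ)
      = e.sum fun A a => a • (⟨flagVec μ A, flagVec_mem n μ A⟩ : schur n μ) := by
    apply Subtype.ext
    simp [combine, Finsupp.linearCombination_apply, Finsupp.sum]
  rw [this, Finsupp.sum, map_sum]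
  refine Finset.sum_eq_zero fun A _ => ?_
  rw [map_smul, phiAux_combine, hc, map_zero, smul_zero]

/-- The bilinear `GL_n × GL_m`-equivariant map `φ : 𝕊^μ(ℝⁿ) ⊗ 𝕊^μ(ℝᵐ) → Reg(M_{n,m})`. It is
determined by `φ(flagVec A ⊗ flagVec B)(X) = ∏_j (leading minor of size μ.colLen j of Aᵀ X B)`;
in particular it sends the tensor product of the two highest weight vectors to the product of
leading minors of `X`. See `phi_flagVec` and `phi_flagVec_flagVec`. -/
def phi (n m : ℕ) (μ : YoungDiagram) : schur n μ →ₗ[ℝ] schur m μ →ₗ[ℝ] Reg n m :=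
  (((LinearMap.ker (combine m μ)).liftQ (phiAux n m μ) (ker_combine_le n m μ)) ∘ₗ
    (LinearMap.quotKerEquivRange (combine m μ)).symm.toLinearMap).flip

lemma phi_flagVec {n m : ℕ} {μ : YoungDiagram} (V : schur n μ)
    (B : Matrix (Fin m) (Fin (depth μ)) ℝ) :
    phi n m μ V ⟨flagVec μ B, flagVec_mem m μ B⟩ = rightSub B V.1 := by
  have h : (LinearMap.quotKerEquivRange (combine m μ)).symm
      ⟨flagVec μ B, flagVec_mem m μ B⟩
      = (LinearMap.ker (combine m μ)).mkQ (Finsupp.single B 1) := by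
    rw [LinearEquiv.symm_apply_eq]
    apply Subtype.ext
    rw [Submodule.mkQ_apply, LinearMap.quotKerEquivRange_apply_mk]
    simp [combine]
  simp only [phi, LinearMap.flip_apply, LinearMap.comp_apply, LinearEquiv.coe_coe]
  rw [h]
  simp [phiAux]

lemma phi_flagVec_flagVec {n m : ℕ} {μ : YoungDiagram} (A : Matrix (Fin n) (Fin (depth μ)) ℝ)
    (B : Matrix (Fin m) (Fin (depth μ)) ℝ) (x : Matrix (Fin n) (Fin m) ℝ) :
    eval (fun p => x p.1 p.2)
        (phi n m μ ⟨flagVec μ A, flagVec_mem n μ A⟩ ⟨flagVec μ B, flagVec_mem m μ B⟩) =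
      ∏ j : Fin (μ.rowLen 0), Matrix.det ((Aᵀ * x * B).submatrix
        (Fin.castLE (μ.colLen_anti _ _ (Nat.zero_le (j : ℕ))))
        (Fin.castLE (μ.colLen_anti _ _ (Nat.zero_le (j : ℕ))))) := by
  rw [phi_flagVec]
  simp only [flagVec, tabVec, map_prod]
  refine Finset.prod_congr rfl fun j _ => ?_
  rw [AlgHom.map_det, RingHom.map_det]
  congr 1
  ext1 a b
  simp only [AlgHom.mapMatrix_apply, RingHom.mapMatrix_apply, Matrix.map_apply, Matrix.of_apply,
    map_sum, map_mul, rightSub, aeval_X, algHom_C, algebraMap_eq, cell, eval_X, eval_C,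
    Matrix.submatrix_apply, Matrix.mul_apply, Matrix.transpose_apply]
  simp only [Finset.mul_sum, Finset.sum_mul]
  rw [Finset.sum_comm]
  refine Finset.sum_congr rfl fun i _ => Finset.sum_congr rfl fun l _ => ?_
  simp only [Fin.castLE]
  ring

/-! ### Zonal functions -/

/-- `h` is an orthonormal basis of the subspace `W`. -/
def IsOrthonormalBasis {σ : Type} {S : Submodule ℝ (MvPolynomial σ ℝ)} (W : Submodule ℝ S)
    {N : ℕ} (h : Fin N → S) : Prop :=
  (∀ i j, scalar (h i).1 (h j).1 = if i = j then 1 else 0) ∧ Submodule.span ℝ (Set.range h) = W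

instance (p : ℕ) (μ : YoungDiagram) : Module.Finite ℝ (schur p μ) := by
  let N : ℕ := ∑ j : Fin (μ.rowLen 0), μ.colLen j
  have hle : schur p μ ≤ restrictTotalDegree (Fin p × Fin (depth μ)) ℝ N := by
    rw [schur_eq_span, Submodule.span_le]
    rintro _ ⟨A, rfl⟩
    rw [SetLike.mem_coe, mem_restrictTotalDegree]
    refine (totalDegree_finsetProd _ _).trans (Finset.sum_le_sum fun j _ => ?_)
    rw [Matrix.det_apply]
    refine totalDegree_finsetSum_le fun σ _ => ?_
    refine (totalDegree_smul_le _ _).trans ((totalDegree_finsetProd _ _).trans ?_)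
    refine (Finset.sum_le_card_nsmul _ _ 1 fun a _ => ?_).trans (by simp)
    rw [Matrix.of_apply]
    refine totalDegree_finsetSum_le fun r _ => ?_
    exact (totalDegree_mul _ _).trans (by simp)
  exact Submodule.finiteDimensional_of_le hle

lemma exists_orthonormalBasis (n : ℕ) (μ : YoungDiagram) :
    ∃ h : Fin (Module.finrank ℝ (harmonic n μ)) → schur n μ,
      IsOrthonormalBasis (harmonic n μ) h := by
  let core : InnerProductSpace.Core ℝ (harmonic n μ) :=
    { inner := fun x y => scalar x.1.1 y.1.1
      conj_inner_symm := fun x y => scalar_comm _ _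
      re_inner_nonneg := fun x => scalar_self_nonneg _
      add_left := fun x y z => scalar_add_left _ _ _
      smul_left := fun x y r => scalar_smul_left _ _ _
      definite := fun x hx => Subtype.ext (Subtype.ext (eq_zero_of_scalar_self _ hx)) }
  let _ : NormedAddCommGroup (harmonic n μ) := core.toNormedAddCommGroup
  let _ : InnerProductSpace ℝ (harmonic n μ) := InnerProductSpace.ofCore core.toCore
  let b := stdOrthonormalBasis ℝ (harmonic n μ)
  refine ⟨fun i => (b i).1, fun i j => ?_, ?_⟩
  · exact orthonormal_iff_ite.1 b.orthonormal i j
  · have h1 := b.toBasis.span_eq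
    have h2 : Set.range (fun i => (b i).1) =
        (harmonic n μ).subtype '' Set.range b.toBasis := by
      rw [← Set.range_comp]
      congr 1
    rw [h2, Submodule.span_image, h1, Submodule.map_subtype_top]

/-- An orthonormal basis `(hᵢ)` of `𝕊^{[μ]}(ℝⁿ)`. -/
def harmonicBasis (n : ℕ) (μ : YoungDiagram) :
    Fin (Module.finrank ℝ (harmonic n μ)) → schur n μ :=
  (exists_orthonormalBasis n μ).choose

/-- The zonal function `Z_{Ξ,Ξ'}(Δ,Δ') = (1/N) ∑ᵢ φ(hᵢ ⊗ Ξ)(Δ) φ(hᵢ ⊗ Ξ')(Δ')`, where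
`N = dim 𝕊^{[μ]}(ℝⁿ)`; it does not depend on the choice of the orthonormal basis. -/
def zonal {n : ℕ} {d : FlagShape n} {μ : YoungDiagram} (Ξ Ξ' : schur d.m μ) (Δ Δ' : Flag d) : ℝ :=
  (Module.finrank ℝ (harmonic n μ) : ℝ)⁻¹ *
    ∑ i, evalFlag (phi n d.m μ (harmonicBasis n μ i) Ξ) Δ *
      evalFlag (phi n d.m μ (harmonicBasis n μ i) Ξ') Δ'

end Vexillar

end

namespace Vexillar

open Matrix MvPolynomial

/-! ### The scalar product on polynomials -/

section Scalar

variable {σ : Type}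

lemma scalar_add_right (f g g' : MvPolynomial σ ℝ) :
    scalar f (g + g') = scalar f g + scalar f g' := by
  simp only [scalar_comm f, scalar_add_left]

lemma scalar_smul_right (c : ℝ) (f g : MvPolynomial σ ℝ) :
    scalar f (c • g) = c * scalar f g := by
  simp only [scalar_comm f, scalar_smul_left]

/-- The scalar product as a bilinear form. -/
noncomputable def scalarForm (σ : Type) : MvPolynomial σ ℝ →ₗ[ℝ] MvPolynomial σ ℝ →ₗ[ℝ] ℝ :=
  LinearMap.mk₂ ℝ scalar scalar_add_left scalar_smul_left scalar_add_right scalar_smul_right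

@[simp]
lemma scalarForm_apply (f g : MvPolynomial σ ℝ) : scalarForm σ f g = scalar f g := rfl

/-- Orthogonal decomposition with respect to a finite-dimensional subspace. -/
lemma exists_scalar_orthogonal (W : Submodule ℝ (MvPolynomial σ ℝ)) [FiniteDimensional ℝ W]
    (f : MvPolynomial σ ℝ) : ∃ w ∈ W, ∀ g ∈ W, scalar (f - w) g = 0 := by
  let core : InnerProductSpace.Core ℝ (MvPolynomial σ ℝ) :=
    { inner := fun x y => scalar x y
      conj_inner_symm := fun x y => scalar_comm _ _
      re_inner_nonneg := fun x => scalar_self_nonneg _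
      add_left := fun x y z => scalar_add_left _ _ _
      smul_left := fun x y r => scalar_smul_left _ _ _
      definite := fun x hx => eq_zero_of_scalar_self _ hx }
  let _ : NormedAddCommGroup (MvPolynomial σ ℝ) := core.toNormedAddCommGroup
  let _ : InnerProductSpace ℝ (MvPolynomial σ ℝ) := InnerProductSpace.ofCore core.toCore
  obtain ⟨w, hw, z, hz, rfl⟩ := W.exists_add_mem_mem_orthogonal f
  refine ⟨w, hw, fun g hg => ?_⟩
  have := (Submodule.mem_orthogonal' _ _).1 hz g hg
  rw [add_sub_cancel_left]
  exact this

/-- A subspace of a finite-dimensional space of polynomials whose orthogonal complement there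
vanishes is everything. -/
lemma le_of_scalar_orthogonal {U W : Submodule ℝ (MvPolynomial σ ℝ)} [FiniteDimensional ℝ W]
    (hWU : W ≤ U) (h : ∀ f ∈ U, (∀ g ∈ W, scalar f g = 0) → f = 0) : U ≤ W := by
  intro f hf
  obtain ⟨w, hw, ho⟩ := exists_scalar_orthogonal W f
  rw [sub_eq_zero.1 (h _ (U.sub_mem hf (hWU hw)) ho)]
  exact hw

variable [Fintype σ]

instance (N : ℕ) : FiniteDimensional ℝ (homogeneousSubmodule σ ℝ N) :=
  Submodule.finiteDimensional_of_le (S₂ := restrictTotalDegree σ ℝ N) fun f hf => by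
    rw [mem_restrictTotalDegree]
    exact IsHomogeneous.totalDegree_le ((mem_homogeneousSubmodule _ _).1 hf)

/-- The linear form with coefficients `v`. -/
noncomputable def linForm (v : σ → ℝ) : MvPolynomial σ ℝ := ∑ i, v i • X i

lemma eval_linForm (v x : σ → ℝ) : eval x (linForm v) = v ⬝ᵥ x := by
  simp [linForm, dotProduct, smul_eval]

lemma linForm_isHomogeneous (v : σ → ℝ) : (linForm v).IsHomogeneous 1 := by
  refine IsHomogeneous.sum _ _ _ fun i _ => ?_
  rw [smul_eq_C_mul]
  simpa using (isHomogeneous_C σ (v i)).mul (isHomogeneous_X ℝ i)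

lemma scalar_linForm_pow (v : σ → ℝ) {N : ℕ} {g : MvPolynomial σ ℝ} (hg : g.IsHomogeneous N) :
    scalar (linForm v ^ N) g = eval v g := by
  rw [scalar_comm, scalar, eval_eq]
  refine Finset.sum_congr rfl fun α hα => ?_
  have hd : α.degree = N := (DFunLike.congr_fun Finsupp.degree_eq_weight_one α).trans
    (hg (mem_support_iff.1 hα))
  have hc : coeff α (linForm v ^ N) =
      α.multinomial * ∏ r ∈ α.support, v r ^ α r := by
    rw [linForm, coeff_linearCombination_X_pow_of_fintype, if_pos]
    · rfl
    · exact hd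
  have hm : (α.prod fun _ k => (k.factorial : ℝ)) * α.multinomial = N.factorial := by
    have := Nat.multinomial_spec α.support α
    rw [← Finsupp.multinomial_eq] at this
    rw [← hd, Finsupp.degree_apply, ← this]
    simp [Finsupp.prod]
  have hN : (N.factorial : ℝ) ≠ 0 := Nat.cast_ne_zero.2 (Nat.factorial_ne_zero _)
  rw [hc, hd, div_mul_eq_mul_div, div_eq_iff hN, ← hm]
  ring

lemma span_linForm_pow (N : ℕ) :
    homogeneousSubmodule σ ℝ N ≤ Submodule.span ℝ (Set.range fun v : σ → ℝ => linForm v ^ N) := by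
  have hle : Submodule.span ℝ (Set.range fun v : σ → ℝ => linForm v ^ N) ≤
      homogeneousSubmodule σ ℝ N := by
    rw [Submodule.span_le]
    rintro _ ⟨v, rfl⟩
    simpa using (linForm_isHomogeneous v).pow N
  have := Submodule.finiteDimensional_of_le hle
  refine le_of_scalar_orthogonal hle fun f hf h => MvPolynomial.funext fun v => ?_
  rw [map_zero, ← scalar_linForm_pow v hf, scalar_comm]
  exact h _ (Submodule.subset_span ⟨v, rfl⟩)

/-- Adjoint linear substitutions are adjoint for the scalar product. -/
lemma scalar_adjoint {S T : MvPolynomial σ ℝ →ₐ[ℝ] MvPolynomial σ ℝ} {s t : (σ → ℝ) → σ → ℝ}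
    (hS : ∀ x f, eval x (S f) = eval (s x) f) (hT : ∀ x f, eval x (T f) = eval (t x) f)
    (hst : ∀ x y, x ⬝ᵥ s y = t x ⬝ᵥ y) {N : ℕ} {f g : MvPolynomial σ ℝ}
    (hf : f.IsHomogeneous N) (hg : g.IsHomogeneous N) (hTg : (T g).IsHomogeneous N) :
    scalar (S f) g = scalar f (T g) := by
  have key : Submodule.span ℝ (Set.range fun v : σ → ℝ => linForm v ^ N) ≤
      LinearMap.ker ((scalarForm σ).flip g ∘ₗ S.toLinearMap - (scalarForm σ).flip (T g)) := by
    rw [Submodule.span_le]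
    rintro _ ⟨v, rfl⟩
    have h : S (linForm v ^ N) = linForm (t v) ^ N := MvPolynomial.funext fun x => by
      rw [hS, map_pow, map_pow, eval_linForm, eval_linForm, hst]
    simp [h, scalar_linForm_pow _ hg, scalar_linForm_pow _ hTg, hT, -map_pow]
  have := key (span_linForm_pow N hf)
  simpa [sub_eq_zero] using this

end Scalar

end Vexillar

namespace Vexillar

open Matrix MvPolynomial

/-! ### Weights -/

section Weights

/-- A subspace containing all values of a polynomial curve contains its coefficients. -/
lemma coeff_mem_of_forall_sum_pow_smul_mem {V : Type*} [AddCommGroup V] [Module ℝ V]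
    (W : Submodule ℝ V) (B : ℕ) (c : ℕ → V)
    (h : ∀ t : ℝ, ∑ k ∈ Finset.range B, t ^ k • c k ∈ W) {k : ℕ} (hk : k < B) : c k ∈ W := by
  rw [← Submodule.Quotient.mk_eq_zero, ← Module.forall_dual_apply_eq_zero_iff ℝ]
  intro φ
  let p : Polynomial ℝ := ∑ k ∈ Finset.range B, Polynomial.C (φ (Submodule.Quotient.mk (c k))) *
    Polynomial.X ^ k
  have hp : p = 0 := Polynomial.funext fun t => by
    have := congrArg φ ((Submodule.Quotient.mk_eq_zero W).2 (h t))
    rw [map_zero, ← Submodule.mkQ_apply, map_sum, map_sum] at this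
    simp only [p, Polynomial.eval_finsetSum, Polynomial.eval_zero, ← this]
    refine Finset.sum_congr rfl fun k _ => ?_
    rw [map_smul, map_smul, Polynomial.eval_mul, Polynomial.eval_C, Polynomial.eval_pow,
      Polynomial.eval_X, smul_eq_mul, mul_comm]
    rfl
  have := congrArg (fun p => Polynomial.coeff p k) hp
  simpa [p, Polynomial.finsetSum_coeff, Polynomial.coeff_C_mul, Polynomial.coeff_X_pow, hk]
    using this

variable {σ : Type}

/-- The one-parameter group of diagonal substitutions with weights `w`. -/
noncomputable def scaleBy (w : σ → ℕ) (t : ℝ) : MvPolynomial σ ℝ →ₐ[ℝ] MvPolynomial σ ℝ :=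
  aeval fun v => C (t ^ w v) * X v

lemma eval_scaleBy (w : σ → ℕ) (t : ℝ) (x : σ → ℝ) (f : MvPolynomial σ ℝ) :
    eval x (scaleBy w t f) = eval (fun v => t ^ w v * x v) f := by
  rw [scaleBy, ← coe_aeval_eq_eval, ← coe_aeval_eq_eval]
  simp only [RingHom.coe_coe]
  rw [← AlgHom.comp_apply]
  congr 1
  ext v
  simp

lemma scaleBy_of_isWeightedHomogeneous {w : σ → ℕ} {f : MvPolynomial σ ℝ} {h : ℕ}
    (hf : IsWeightedHomogeneous w f h) (t : ℝ) : scaleBy w t f = t ^ h • f := by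
  conv_lhs => rw [f.as_sum]
  conv_rhs => rw [f.as_sum]
  rw [map_sum, Finset.smul_sum]
  refine Finset.sum_congr rfl fun α hα => ?_
  rw [scaleBy, aeval_monomial, ← hf (mem_support_iff.1 hα), monomial_eq]
  simp only [Finsupp.prod, mul_pow, Finset.prod_mul_distrib, ← map_pow, ← map_prod, smul_eq_C_mul,
    algebraMap_eq, Finsupp.weight_apply, Finsupp.sum, smul_eq_mul]
  rw [← mul_assoc, ← mul_assoc, ← map_mul, ← map_mul, mul_comm (coeff α f),
    ← Finset.prod_pow_eq_pow_sum]
  simp only [← pow_mul, mul_comm]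

lemma sum_range_weightedHomogeneousComponent {w : σ → ℕ} {f : MvPolynomial σ ℝ} {B : ℕ}
    (hB : ∀ α ∈ f.support, Finsupp.weight w α < B) :
    ∑ h ∈ Finset.range B, weightedHomogeneousComponent w h f = f := by
  classical
  ext α
  rw [coeff_sum]
  simp only [coeff_weightedHomogeneousComponent]
  rw [Finset.sum_ite_eq]
  split_ifs with h
  · rfl
  · by_contra h0
    exact h (Finset.mem_range.2 (hB α (mem_support_iff.2 (Ne.symm h0))))

lemma scaleBy_eq_sum {w : σ → ℕ} {f : MvPolynomial σ ℝ} {B : ℕ}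
    (hB : ∀ α ∈ f.support, Finsupp.weight w α < B) (t : ℝ) :
    scaleBy w t f = ∑ h ∈ Finset.range B, t ^ h • weightedHomogeneousComponent w h f := by
  conv_lhs => rw [← sum_range_weightedHomogeneousComponent hB]
  rw [map_sum]
  exact Finset.sum_congr rfl fun h _ =>
    scaleBy_of_isWeightedHomogeneous (weightedHomogeneousComponent_isWeightedHomogeneous _ _) t

lemma weightedHomogeneousComponent_eq_zero_of_le {w : σ → ℕ} {f : MvPolynomial σ ℝ} {B h : ℕ}
    (hB : ∀ α ∈ f.support, Finsupp.weight w α < B) (hh : B ≤ h) :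
    weightedHomogeneousComponent w h f = 0 :=
  weightedHomogeneousComponent_eq_zero' _ _ fun α hα => ((hB α hα).trans_le hh).ne

lemma weightedHomogeneousComponent_mem_of_scaleBy {w : σ → ℕ} (W : Submodule ℝ (MvPolynomial σ ℝ))
    (hW : ∀ f ∈ W, ∀ t, scaleBy w t f ∈ W) {f : MvPolynomial σ ℝ} (hf : f ∈ W) (h : ℕ) :
    weightedHomogeneousComponent w h f ∈ W := by
  obtain ⟨B, hB⟩ : ∃ B, ∀ α ∈ f.support, Finsupp.weight w α < B :=
    ⟨f.support.sup (Finsupp.weight w) + 1, fun α hα => Nat.lt_succ_of_le (Finset.le_sup hα)⟩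
  rcases lt_or_ge h B with hh | hh
  · exact coeff_mem_of_forall_sum_pow_smul_mem W B _
      (fun t => (scaleBy_eq_sum hB t) ▸ hW f hf t) hh
  · rw [weightedHomogeneousComponent_eq_zero_of_le hB hh]
    exact W.zero_mem

/-- A non-zero subspace of bounded degree, stable under a diagonal one-parameter group, contains
a weight vector of maximal weight. -/
lemma exists_maximal_weight {w : σ → ℕ} (W : Submodule ℝ (MvPolynomial σ ℝ))
    (hW : ∀ f ∈ W, ∀ t, scaleBy w t f ∈ W) (B : ℕ)
    (hB : ∀ f ∈ W, ∀ α ∈ f.support, Finsupp.weight w α < B) (hne : W ≠ ⊥) :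
    ∃ f ∈ W, f ≠ 0 ∧ ∃ h, IsWeightedHomogeneous w f h ∧
      ∀ g ∈ W, ∀ α ∈ g.support, Finsupp.weight w α ≤ h := by
  classical
  obtain ⟨f, hf, hf0⟩ := W.ne_bot_iff.1 hne
  let P : ℕ → Prop := fun h => ∃ g ∈ W, ∃ α ∈ g.support, Finsupp.weight w α = h
  obtain ⟨α, hα⟩ := Finset.nonempty_iff_ne_empty.2 (mt support_eq_empty.1 hf0)
  have hP : P (Finsupp.weight w α) := ⟨f, hf, α, hα, rfl⟩
  obtain ⟨g, hg, β, hβ, hβh⟩ := Nat.findGreatest_spec (hB f hf α hα).le hP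
  refine ⟨weightedHomogeneousComponent w (Nat.findGreatest P B) g,
    weightedHomogeneousComponent_mem_of_scaleBy W hW hg _, fun h0 => ?_, _,
    weightedHomogeneousComponent_isWeightedHomogeneous _ _, fun g' hg' γ hγ =>
      Nat.le_findGreatest (hB g' hg' γ hγ).le ⟨g', hg', γ, hγ, rfl⟩⟩
  have := congrArg (coeff β) h0
  rw [coeff_weightedHomogeneousComponent, if_pos hβh] at this
  exact mem_support_iff.1 hβ this

/-- Vectors of maximal weight are fixed by substitutions which raise weights. -/
lemma eq_of_raise {w : σ → ℕ} {f : MvPolynomial σ ℝ} {h : ℕ} (hf : IsWeightedHomogeneous w f h)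
    {c : σ → ℝ} {e : σ → σ} (hc : ∀ v, c v ≠ 0 → w v < w (e v))
    {E : MvPolynomial σ ℝ →ₐ[ℝ] MvPolynomial σ ℝ}
    (hE : ∀ x f, eval x (E f) = eval (fun v => x v + c v * x (e v)) f)
    (hle : ∀ α ∈ (E f).support, Finsupp.weight w α ≤ h) : E f = f := by
  refine MvPolynomial.funext fun x => ?_
  let q : Polynomial ℝ := aeval (fun v => Polynomial.C (x v) +
    Polynomial.C (c v * x (e v)) * Polynomial.X ^ (w (e v) - w v)) f
  have hq : ∀ t, q.eval t = eval (fun v => x v + c v * x (e v) * t ^ (w (e v) - w v)) f := by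
    intro t
    rw [← Polynomial.coe_aeval_eq_eval, ← coe_aeval_eq_eval]
    simp only [q, RingHom.coe_coe]
    rw [← AlgHom.comp_apply]
    congr 1
    ext v
    simp
  let p : Polynomial ℝ := ∑ k ∈ Finset.range (h + 1),
    Polynomial.C (eval x (weightedHomogeneousComponent w k (E f))) * Polynomial.X ^ k
  have hpq : Polynomial.X ^ h * q = p := Polynomial.funext fun t => by
    have h1 : eval x (scaleBy w t (E f)) = p.eval t := by
      rw [scaleBy_eq_sum (fun α hα => Nat.lt_succ_of_le (hle α hα))]
      simp only [p, Polynomial.eval_finsetSum, map_sum, smul_eval, Polynomial.eval_mul,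
        Polynomial.eval_C, Polynomial.eval_pow, Polynomial.eval_X, mul_comm]
    rw [← h1, Polynomial.eval_mul, Polynomial.eval_pow, Polynomial.eval_X, hq, ← smul_eval,
      ← scaleBy_of_isWeightedHomogeneous hf, eval_scaleBy, eval_scaleBy, hE]
    congr 2
    ext v
    by_cases hv : c v = 0
    · simp [hv]
    · rw [mul_add]
      congr 1
      have : t ^ w (e v) = t ^ w v * t ^ (w (e v) - w v) := by
        rw [← pow_add, Nat.add_sub_cancel' (hc v hv).le]
      rw [this]
      ring
  have hdeg : q.natDegree = 0 := by
    by_cases hq0 : q = 0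
    · simp [hq0]
    have h1 : p.natDegree ≤ h := Polynomial.natDegree_sum_le_of_forall_le _ _ fun k hk =>
      (Polynomial.natDegree_C_mul_X_pow_le _ _).trans (Nat.lt_succ_iff.1 (Finset.mem_range.1 hk))
    rw [← hpq, Polynomial.natDegree_mul (pow_ne_zero _ Polynomial.X_ne_zero) hq0,
      Polynomial.natDegree_X_pow] at h1
    omega
  rw [Polynomial.natDegree_eq_zero] at hdeg
  obtain ⟨a, ha⟩ := hdeg
  have h0 := hq 0
  have h1 := hq 1
  rw [← ha, Polynomial.eval_C] at h0 h1
  simp only [one_pow, mul_one] at h1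
  rw [hE, ← h1, h0]
  congr 1
  congr 1
  ext v
  by_cases hv : c v = 0
  · simp [hv]
  · simp [Nat.sub_ne_zero_of_lt (hc v hv)]

end Weights

/-! ### Gaussian elimination -/

/-- Evaluation of a polynomial in the entries of a matrix. -/
abbrev ev {n m : ℕ} (x : Matrix (Fin n) (Fin m) ℝ) : Reg n m →+* ℝ := eval fun p => x p.1 p.2

lemma ev_injective {n m : ℕ} {f g : Reg n m} (h : ∀ x, ev x f = ev x g) : f = g :=
  MvPolynomial.funext fun x => h (Matrix.of fun i j => x (i, j))

/-- A polynomial unchanged by adding multiples of rows to lower rows and of columns to later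
columns is determined by its values at rectangular diagonal matrices. -/
lemma eq_zero_of_triangular_invariant {n m : ℕ} {q : Reg n m}
    (hL : ∀ (r : Fin n) (c : Fin n → ℝ), (∀ i ≤ r, c i = 0) → ∀ x,
      ev (Matrix.of fun i j => x i j + c i * x r j) q = ev x q)
    (hU : ∀ (r : Fin m) (c : Fin m → ℝ), (∀ j ≤ r, c j = 0) → ∀ x,
      ev (Matrix.of fun i j => x i j + c j * x i r) q = ev x q)
    (hD : ∀ x, (∀ (i : Fin n) (j : Fin m), (i : ℕ) ≠ j → x i j = 0) → ev x q = 0) : q = 0 := by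
  have key : ∀ k r : ℕ, n + m = r + k → ∀ x : Matrix (Fin n) (Fin m) ℝ,
      (∀ (i : Fin n) (j : Fin m), (i : ℕ) ≠ j → min (i : ℕ) j < r → x i j = 0) → ev x q = 0 := by
    intro k
    induction k with
    | zero => exact fun r hr x hx => hD x fun i j hij => hx i j hij (by omega)
    | succ k ih =>
      intro r hr x hx
      by_cases hrn : r < n ∧ r < m
      swap
      · exact ih (r + 1) (by omega) x fun i j hij h => hx i j hij (by omega)
      have main : ∀ x : Matrix (Fin n) (Fin m) ℝ,
          (∀ (i : Fin n) (j : Fin m), (i : ℕ) ≠ j → min (i : ℕ) j < r → x i j = 0) →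
          x ⟨r, hrn.1⟩ ⟨r, hrn.2⟩ ≠ 0 → ev x q = 0 := by
        intro x hx hne
        set a : Fin n := ⟨r, hrn.1⟩ with ha
        set b : Fin m := ⟨r, hrn.2⟩ with hb
        let c : Fin n → ℝ := fun i => if i ≤ a then 0 else -(x i b / x a b)
        let y : Matrix (Fin n) (Fin m) ℝ := Matrix.of fun i j => x i j + c i * x a j
        let c' : Fin m → ℝ := fun j => if j ≤ b then 0 else -(y a j / x a b)
        rw [← hL a c (fun i hi => if_pos hi) x, ← hU b c' (fun i hi => if_pos hi) y]
        refine ih (r + 1) (by omega) _ fun i j hij h => ?_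
        have hy : ∀ (i : Fin n) (j : Fin m), (i : ℕ) ≠ j → min (i : ℕ) j < r → y i j = 0 := by
          intro i j hij h
          simp only [y, Matrix.of_apply, hx i j hij h, zero_add, mul_eq_zero]
          by_cases hi : i ≤ a
          · exact Or.inl (if_pos hi)
          · rw [Fin.le_def] at hi
            simp only [ha] at hi
            exact Or.inr (hx a j (by simp only [ha]; omega) (by simp only [ha]; omega))
        have hyab : y a b = x a b := by simp [y, c]
        simp only [Matrix.of_apply]
        by_cases hlt : min (i : ℕ) j < r
        · rw [hy i j hij hlt, zero_add, mul_eq_zero]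
          by_cases hj : j ≤ b
          · exact Or.inl (if_pos hj)
          · rw [Fin.le_def] at hj
            simp only [hb] at hj
            exact Or.inr (hy i b (by simp only [hb]; omega) (by simp only [hb]; omega))
        · by_cases hi : (i : ℕ) = r
          · have hia : i = a := Fin.ext hi
            have hj : ¬ j ≤ b := by rw [Fin.le_def]; simp only [hb]; omega
            rw [hia, hyab]
            simp only [c', if_neg hj]
            field_simp
            ring
          · have hjb : j = b := Fin.ext (by simp only [hb]; omega)
            have hi' : ¬ i ≤ a := by rw [Fin.le_def]; simp only [ha]; omega
            simp only [hjb, c', le_refl, if_true, zero_mul, add_zero]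
            simp only [y, Matrix.of_apply, c, if_neg hi']
            field_simp
            ring
      set a : Fin n := ⟨r, hrn.1⟩ with ha
      set b : Fin m := ⟨r, hrn.2⟩ with hb
      let z : ℝ → Matrix (Fin n) (Fin m) ℝ := fun s =>
        Matrix.of fun i j => if i = a ∧ j = b then s else x i j
      have hz : Continuous fun s => ev (z s) q := by
        have : Continuous fun s => fun p : Fin n × Fin m => z s p.1 p.2 := by
          refine continuous_pi fun p => ?_
          simp only [z, Matrix.of_apply]
          split_ifs <;> fun_prop
        exact (continuous_eval q).comp this
      have h0 := hz.ext_on (dense_compl_singleton (0 : ℝ)) continuous_const (g := fun _ => (0 : ℝ))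
        fun s hs => main (z s) (fun i j hij h => by
          have : ¬ (i = a ∧ j = b) := fun h' => hij (by rw [h'.1, h'.2])
          simp only [z, Matrix.of_apply, if_neg this]
          exact hx i j hij h) (by simpa [z, ha, hb] using hs)
      have := congrFun h0 (x a b)
      convert this using 3
      ext i j
      simp only [z, Matrix.of_apply]
      split_ifs with hp
      · rw [hp.1, hp.2]
      · rfl
  exact ev_injective fun x => by
    rw [map_zero]
    exact key (n + m) 0 (by simp) x fun i j _ h => absurd h (Nat.not_lt_zero _)

end Vexillar

namespace Vexillar

open Matrix MvPolynomial

/-! ### Linear substitutions -/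

section Substitutions

lemma ev_actLeft {p k : ℕ} (g : Matrix (Fin p) (Fin p) ℝ) (Z : Matrix (Fin p) (Fin k) ℝ)
    (f : Reg p k) : ev Z (actLeft g f) = ev (gᵀ * Z) f := by
  rw [ev, ev, actLeft, ← coe_aeval_eq_eval, ← coe_aeval_eq_eval]
  simp only [RingHom.coe_coe]
  rw [← AlgHom.comp_apply]
  congr 1
  ext v
  simp [Matrix.mul_apply]

lemma ev_rightSub {n m k : ℕ} (B : Matrix (Fin m) (Fin k) ℝ) (x : Matrix (Fin n) (Fin m) ℝ)
    (f : Reg n k) : ev x (rightSub B f) = ev (x * B) f := by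
  rw [ev, ev, rightSub, ← coe_aeval_eq_eval, ← coe_aeval_eq_eval]
  simp only [RingHom.coe_coe]
  rw [← AlgHom.comp_apply]
  congr 1
  ext v
  simp [Matrix.mul_apply]

lemma IsHomogeneous.aeval_linear {σ τ : Type} {f : MvPolynomial σ ℝ} {N : ℕ}
    (hf : f.IsHomogeneous N) {u : σ → MvPolynomial τ ℝ} (hu : ∀ i, (u i).IsHomogeneous 1) :
    (aeval u f).IsHomogeneous N := by
  simpa using hf.aeval u hu

lemma actLeft_isHomogeneous {p k N : ℕ} (g : Matrix (Fin p) (Fin p) ℝ) {f : Reg p k}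
    (hf : f.IsHomogeneous N) : (actLeft g f).IsHomogeneous N :=
  IsHomogeneous.aeval_linear hf fun _ => IsHomogeneous.sum _ _ _ fun _ _ => by
    simpa using (isHomogeneous_C _ _).mul (isHomogeneous_X ℝ _)

lemma rightSub_isHomogeneous {n m k N : ℕ} (B : Matrix (Fin m) (Fin k) ℝ) {f : Reg n k}
    (hf : f.IsHomogeneous N) : (rightSub B f : Reg n m).IsHomogeneous N :=
  IsHomogeneous.aeval_linear hf fun _ => IsHomogeneous.sum _ _ _ fun _ _ => by
    simpa using (isHomogeneous_X ℝ _).mul (isHomogeneous_C _ _)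

lemma eval_actLeft {p k : ℕ} (g : Matrix (Fin p) (Fin p) ℝ) (x : Fin p × Fin k → ℝ)
    (f : Reg p k) :
    eval x (actLeft g f) = eval (fun q => ∑ s, g s q.1 * x (s, q.2)) f := by
  have := ev_actLeft g (Matrix.of fun i j => x (i, j)) f
  simpa [ev, Matrix.mul_apply] using this

lemma eval_rightSub {n m k : ℕ} (B : Matrix (Fin m) (Fin k) ℝ) (x : Fin n × Fin m → ℝ)
    (f : Reg n k) :
    eval x (rightSub B f) = eval (fun q => ∑ s, x (q.1, s) * B s q.2) f := by
  have := ev_rightSub B (Matrix.of fun i j => x (i, j)) f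
  simpa [ev, Matrix.mul_apply] using this

lemma scalar_actLeft {p k N : ℕ} (g : Matrix (Fin p) (Fin p) ℝ) {f f' : Reg p k}
    (hf : f.IsHomogeneous N) (hf' : f'.IsHomogeneous N) :
    scalar (actLeft g f) f' = scalar f (actLeft gᵀ f') := by
  refine scalar_adjoint (eval_actLeft g) (eval_actLeft gᵀ) (fun x y => ?_) hf hf'
    (actLeft_isHomogeneous _ hf')
  simp only [dotProduct, Fintype.sum_prod_type_right, Finset.mul_sum, Finset.sum_mul,
    transpose_apply]
  refine Finset.sum_congr rfl fun j _ => ?_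
  rw [Finset.sum_comm]
  exact Finset.sum_congr rfl fun _ _ => Finset.sum_congr rfl fun _ _ => by ring

lemma scalar_rightSub {n m N : ℕ} (B : Matrix (Fin m) (Fin m) ℝ) {f f' : Reg n m}
    (hf : f.IsHomogeneous N) (hf' : f'.IsHomogeneous N) :
    scalar (rightSub B f) f' = scalar f (rightSub Bᵀ f') := by
  refine scalar_adjoint (eval_rightSub B) (eval_rightSub Bᵀ) (fun x y => ?_) hf hf'
    (rightSub_isHomogeneous _ hf')
  simp only [dotProduct, Fintype.sum_prod_type, Finset.mul_sum, Finset.sum_mul,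
    transpose_apply]
  refine Finset.sum_congr rfl fun j _ => ?_
  rw [Finset.sum_comm]
  exact Finset.sum_congr rfl fun _ _ => Finset.sum_congr rfl fun _ _ => by ring

end Substitutions

/-! ### Inscribed diagrams -/

section TabVec

variable {μ : YoungDiagram} {p : ℕ}

/-- The index of a row of column `j`, read as an index of a row of the first column. -/
abbrev colCast (μ : YoungDiagram) (j : ℕ) : Fin (μ.colLen j) → Fin (depth μ) :=
  Fin.castLE (μ.colLen_anti _ _ (Nat.zero_le j))

lemma ev_tabVec (v : μ.cells → Fin p → ℝ) (Z : Matrix (Fin p) (Fin (depth μ)) ℝ) :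
    ev Z (tabVec v) = ∏ j : Fin (μ.rowLen 0), Matrix.det (Matrix.of fun a b : Fin (μ.colLen j) =>
      ∑ r, v (cell j a) r * Z r (colCast μ j b)) := by
  rw [tabVec, map_prod]
  refine Finset.prod_congr rfl fun j _ => ?_
  rw [RingHom.map_det]
  congr 1
  ext a b
  simp

lemma cell_injective {j j' : ℕ} {a : Fin (μ.colLen j)} {a' : Fin (μ.colLen j')}
    (h : cell j a = cell j' a') : j = j' ∧ (a : ℕ) = a' := by
  have := congrArg Subtype.val h
  simp only [cell, Prod.mk.injEq] at this
  exact ⟨this.2, this.1⟩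

lemma col_lt_rowLen {j : ℕ} (a : Fin (μ.colLen j)) : j < μ.rowLen 0 :=
  (YoungDiagram.mem_iff_lt_rowLen.1 (μ.up_left_mem (Nat.zero_le _) le_rfl
    (YoungDiagram.mem_iff_lt_colLen.2 a.2)))

/-- Cells, column by column. -/
noncomputable def cellEquiv (μ : YoungDiagram) :
    (Σ j : Fin (μ.rowLen 0), Fin (μ.colLen j)) ≃ μ.cells :=
  Equiv.ofBijective (fun q => cell q.1 q.2) ⟨fun q q' h => by
    obtain ⟨⟨j, hj⟩, a⟩ := q
    obtain ⟨⟨j', hj'⟩, a'⟩ := q'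
    obtain ⟨rfl, h2⟩ := cell_injective h
    obtain rfl := Fin.ext h2
    rfl, fun c => by
    have hc := YoungDiagram.mem_iff_lt_colLen.1 ((YoungDiagram.mem_cells _).1 c.2)
    exact ⟨⟨⟨c.1.2, col_lt_rowLen ⟨_, hc⟩⟩, ⟨c.1.1, hc⟩⟩, rfl⟩⟩

@[simp]
lemma cellEquiv_apply (q : Σ j : Fin (μ.rowLen 0), Fin (μ.colLen j)) :
    cellEquiv μ q = cell q.1 q.2 := rfl

lemma exists_cell (c : μ.cells) : ∃ (j : ℕ) (a : Fin (μ.colLen j)), c = cell j a :=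
  ⟨_, ⟨_, YoungDiagram.mem_iff_lt_colLen.1 ((YoungDiagram.mem_cells _).1 c.2)⟩, rfl⟩

/-- The linear form `⟨u, z_b⟩` in the entries of `Z`. -/
noncomputable def rowForm (b : Fin (depth μ)) : (Fin p → ℝ) →ₗ[ℝ] Reg p (depth μ) :=
  ∑ r, (LinearMap.proj r).smulRight (X (r, b))

lemma rowForm_apply (b : Fin (depth μ)) (u : Fin p → ℝ) :
    rowForm b u = ∑ r, C (u r) * X (r, b) := by
  simp [rowForm, smul_eq_C_mul]

lemma ev_rowForm (b : Fin (depth μ)) (u : Fin p → ℝ) (Z : Matrix (Fin p) (Fin (depth μ)) ℝ) :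
    ev Z (rowForm b u) = ∑ r, u r * Z r b := by
  simp [rowForm_apply]

/-- The column of `Z` which a family of column permutations attaches to a cell. -/
noncomputable def colIndex (s : ∀ j : Fin (μ.rowLen 0), Equiv.Perm (Fin (μ.colLen j)))
    (c : μ.cells) : Fin (depth μ) :=
  colCast μ ((cellEquiv μ).symm c).1 (s _ ((cellEquiv μ).symm c).2)

/-- `tabVec` as a multilinear map. -/
noncomputable def tabMulti (μ : YoungDiagram) (p : ℕ) :
    MultilinearMap ℝ (fun _ : μ.cells => Fin p → ℝ) (Reg p (depth μ)) :=
  ∑ s : ∀ j : Fin (μ.rowLen 0), Equiv.Perm (Fin (μ.colLen j)),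
    (∏ j, ((Equiv.Perm.sign (s j) : ℤ) : ℝ)) •
      (MultilinearMap.mkPiAlgebra ℝ μ.cells (Reg p (depth μ))).compLinearMap
        fun c => rowForm (colIndex s c)

lemma tabMulti_apply (v : μ.cells → Fin p → ℝ) :
    tabMulti μ p v = ∑ s : ∀ j : Fin (μ.rowLen 0), Equiv.Perm (Fin (μ.colLen j)),
      (∏ j, ((Equiv.Perm.sign (s j) : ℤ) : ℝ)) • ∏ c, rowForm (colIndex s c) (v c) := by
  simp [tabMulti]

lemma tabVec_eq_tabMulti (v : μ.cells → Fin p → ℝ) : tabVec v = tabMulti μ p v := by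
  classical
  rw [tabMulti_apply, tabVec]
  simp_rw [← Matrix.det_transpose (Matrix.of _), Matrix.det_apply, Finset.prod_univ_sum]
  rw [Fintype.piFinset_univ]
  refine Finset.sum_congr rfl fun s _ => ?_
  rw [← (cellEquiv μ).prod_comp, Fintype.prod_sigma, smul_eq_C_mul, map_prod,
    ← Finset.prod_mul_distrib]
  refine Finset.prod_congr rfl fun j _ => ?_
  rw [Units.smul_def, zsmul_eq_mul, map_intCast]
  congr 1
  refine Finset.prod_congr rfl fun a _ => ?_
  rw [colIndex, Equiv.symm_apply_apply, rowForm_apply]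
  rfl

lemma rowForm_isHomogeneous (b : Fin (depth μ)) (u : Fin p → ℝ) :
    (rowForm b u).IsHomogeneous 1 := by
  rw [rowForm_apply]
  exact IsHomogeneous.sum _ _ _ fun _ _ => by
    simpa using (isHomogeneous_C _ _).mul (isHomogeneous_X ℝ _)

lemma tabVec_isHomogeneous (v : μ.cells → Fin p → ℝ) : (tabVec v).IsHomogeneous μ.card := by
  rw [tabVec_eq_tabMulti, tabMulti_apply]
  refine IsHomogeneous.sum _ _ _ fun s _ => ?_
  rw [smul_eq_C_mul, ← zero_add μ.card]
  refine (isHomogeneous_C _ _).mul ?_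
  have h := IsHomogeneous.prod Finset.univ (fun c => rowForm (colIndex s c) (v c)) (fun _ => 1)
    fun c _ => rowForm_isHomogeneous _ _
  rw [Finset.sum_const, Finset.card_univ, Fintype.card_coe, smul_eq_mul, mul_one] at h
  exact h

lemma actLeft_tabVec (g : Matrix (Fin p) (Fin p) ℝ) (v : μ.cells → Fin p → ℝ) :
    actLeft g (tabVec v) = tabVec fun c => g *ᵥ v c := by
  refine ev_injective fun Z => ?_
  rw [ev_actLeft, ev_tabVec, ev_tabVec]
  refine Finset.prod_congr rfl fun j _ => ?_
  congr 1
  ext a b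
  simp only [of_apply, mul_apply, mulVec, dotProduct, transpose_apply, Finset.mul_sum,
    Finset.sum_mul]
  rw [Finset.sum_comm]
  exact Finset.sum_congr rfl fun _ _ => Finset.sum_congr rfl fun _ _ => by ring

/-- The character by which upper triangular matrices act on Schur modules. -/
def chi (μ : YoungDiagram) (b : Matrix (Fin (depth μ)) (Fin (depth μ)) ℝ) : ℝ :=
  ∏ j : Fin (μ.rowLen 0), ∏ a, b (colCast μ j a) (colCast μ j a)

lemma ev_mul_tabVec (v : μ.cells → Fin p → ℝ) (Z : Matrix (Fin p) (Fin (depth μ)) ℝ)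
    {b : Matrix (Fin (depth μ)) (Fin (depth μ)) ℝ} (hb : b.BlockTriangular id) :
    ev (Z * b) (tabVec v) = chi μ b * ev Z (tabVec v) := by
  rw [ev_tabVec, ev_tabVec, chi, ← Finset.prod_mul_distrib]
  refine Finset.prod_congr rfl fun j _ => ?_
  have hdet : (b.submatrix (colCast μ j) (colCast μ j)).det =
      ∏ a, b (colCast μ j a) (colCast μ j a) := by
    rw [Matrix.det_of_isUpperTriangular]
    · rfl
    · intro x y hxy
      exact hb (show colCast μ j y < colCast μ j x from hxy)
  rw [← hdet, mul_comm, ← Matrix.det_mul]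
  congr 1
  ext a c
  simp only [of_apply, mul_apply, submatrix_apply, Finset.mul_sum, Finset.sum_mul]
  rw [Finset.sum_comm]
  refine (Fintype.sum_of_injective (colCast μ j) (Fin.castLE_injective _) _ _ ?_ ?_).symm
  · intro l hl
    refine Finset.sum_eq_zero fun r _ => ?_
    rw [hb, mul_zero, mul_zero]
    by_contra hlt
    exact hl ⟨⟨l, lt_of_le_of_lt (not_lt.1 hlt) c.2⟩, rfl⟩
  · exact fun l => Finset.sum_congr rfl fun r _ => by ring

lemma tabVec_of_perm {v w : μ.cells → Fin p → ℝ} (s : ∀ j : ℕ, Equiv.Perm (Fin (μ.colLen j)))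
    (h : ∀ j a, w (cell j a) = v (cell j (s j a))) :
    tabVec w = (∏ j : Fin (μ.rowLen 0), ((Equiv.Perm.sign (s j) : ℤ) : Reg p (depth μ))) *
      tabVec v := by
  rw [tabVec, tabVec, ← Finset.prod_mul_distrib]
  refine Finset.prod_congr rfl fun j _ => ?_
  rw [← Matrix.det_permute]
  congr 1
  ext1 a b
  simp [h]

lemma tabVec_eq_zero {v : μ.cells → Fin p → ℝ} {j : ℕ} {a b : Fin (μ.colLen j)} (hab : a ≠ b)
    (h : v (cell j a) = v (cell j b)) : tabVec v = 0 := by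
  rw [tabVec]
  refine Finset.prod_eq_zero (Finset.mem_univ ⟨j, col_lt_rowLen a⟩) ?_
  refine Matrix.det_zero_of_row_eq hab ?_
  ext1 c
  simp [h]

end TabVec

end Vexillar

namespace Vexillar

open Matrix MvPolynomial

/-! ### Schur modules as spaces of semi-invariants -/

section SemiInvariants

variable {μ : YoungDiagram} {p : ℕ}

lemma ev_leftSub {n m k : ℕ} (A : Matrix (Fin n) (Fin k) ℝ) (x : Matrix (Fin n) (Fin m) ℝ)
    (f : Reg m k) : ev x (leftSub A f) = ev (xᵀ * A) f := by
  rw [ev, ev, leftSub, ← coe_aeval_eq_eval, ← coe_aeval_eq_eval]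
  simp only [RingHom.coe_coe]
  rw [← AlgHom.comp_apply]
  congr 1
  ext v
  simp [Matrix.mul_apply]

lemma ev_smul {n m : ℕ} (x : Matrix (Fin n) (Fin m) ℝ) (c : ℝ) (f : Reg n m) :
    ev x (c • f) = c * ev x f := smul_eval _ _ _

/-- The matrix with ones on the diagonal. -/
def rectId (p k : ℕ) : Matrix (Fin p) (Fin k) ℝ := Matrix.of fun r a => if (r : ℕ) = a then 1 else 0

/-- The row operation adding multiples of row `r`. -/
def rowOp {n m : ℕ} (r : Fin n) (c : Fin n → ℝ) (x : Matrix (Fin n) (Fin m) ℝ) :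
    Matrix (Fin n) (Fin m) ℝ := Matrix.of fun i j => x i j + c i * x r j

lemma rowOp_eq_mul {n m : ℕ} (r : Fin n) (c : Fin n → ℝ) (x : Matrix (Fin n) (Fin m) ℝ) :
    rowOp r c x = (1 + vecMulVec (Pi.single r 1) c)ᵀ * x := by
  ext i j
  simp [rowOp, transpose_add, transpose_vecMulVec, Matrix.add_mul, vecMulVec_mul, vecMulVec_apply]

lemma colOp_eq_mul {n m : ℕ} (r : Fin m) (c : Fin m → ℝ) (x : Matrix (Fin n) (Fin m) ℝ) :
    (Matrix.of fun i j => x i j + c j * x i r) = x * (1 + vecMulVec (Pi.single r 1) c) := by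
  ext i j
  simp [Matrix.mul_add, mul_vecMulVec, vecMulVec_apply, mul_comm]

lemma rowOp_mul {n m k : ℕ} (r : Fin n) (c : Fin n → ℝ) (x : Matrix (Fin n) (Fin m) ℝ)
    (B : Matrix (Fin m) (Fin k) ℝ) : rowOp r c x * B = rowOp r c (x * B) := by
  rw [rowOp_eq_mul, rowOp_eq_mul, Matrix.mul_assoc]

lemma rectId_transpose_mul_apply {n k l : ℕ} (Z : Matrix (Fin n) (Fin l) ℝ) (a : Fin k)
    (b : Fin l) : ((rectId n k)ᵀ * Z) a b = if h : (a : ℕ) < n then Z ⟨a, h⟩ b else 0 := by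
  rw [mul_apply]
  split_ifs with h
  · rw [Finset.sum_eq_single ⟨a, h⟩]
    · simp [rectId]
    · intro r _ hr
      have : (r : ℕ) ≠ a := fun h' => hr (Fin.ext h')
      simp [rectId, this]
    · simp
  · refine Finset.sum_eq_zero fun r _ => ?_
    have : (r : ℕ) ≠ a := by omega
    simp [rectId, this]

lemma ev_flagVec (A Z : Matrix (Fin p) (Fin (depth μ)) ℝ) :
    ev Z (flagVec μ A) = ∏ j : Fin (μ.rowLen 0),
      ((Aᵀ * Z).submatrix (colCast μ j) (colCast μ j)).det := by
  rw [flagVec, ev_tabVec]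
  rfl

lemma ev_rowOp_flagVec_rectId (r : Fin p) (c : Fin p → ℝ) (hc : ∀ i ≤ r, c i = 0)
    (Z : Matrix (Fin p) (Fin (depth μ)) ℝ) :
    ev (rowOp r c Z) (flagVec μ (rectId p _)) = ev Z (flagVec μ (rectId p _)) := by
  rw [ev_flagVec, ev_flagVec]
  refine Finset.prod_congr rfl fun j _ => ?_
  by_cases hr : (r : ℕ) < μ.colLen j
  · refine Matrix.det_eq_of_forall_row_eq_smul_add_const
      (fun a => if h : (a : ℕ) < p then c ⟨a, h⟩ else 0) ⟨r, hr⟩ ?_ fun a b => ?_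
    · simp [hc r le_rfl]
    · simp only [submatrix_apply, rectId_transpose_mul_apply, Fin.val_castLE, Fin.is_lt, dif_pos]
      split_ifs with h
      · rfl
      · simp
  · congr 1
    ext a b
    simp only [submatrix_apply, rectId_transpose_mul_apply, Fin.val_castLE]
    split_ifs with h
    · rw [rowOp, of_apply, hc, zero_mul, add_zero]
      have := a.2
      rw [Fin.le_def]
      simp only
      omega
    · rfl

/-- Homogeneous polynomials of degree `|μ|` on which upper triangular matrices act from the right
by the character `chi μ`. -/
def semiInvariants (p : ℕ) (μ : YoungDiagram) : Submodule ℝ (Reg p (depth μ)) where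
  carrier := {f | f.IsHomogeneous μ.card ∧ ∀ b : Matrix (Fin (depth μ)) (Fin (depth μ)) ℝ,
    b.BlockTriangular id → ∀ Z, ev (Z * b) f = chi μ b * ev Z f}
  add_mem' hf hg := ⟨hf.1.add hg.1, fun b hb Z => by
    rw [map_add, map_add, hf.2 b hb, hg.2 b hb, mul_add]⟩
  zero_mem' := ⟨isHomogeneous_zero _ _ _, fun b _ Z => by simp⟩
  smul_mem' c f hf := ⟨(homogeneousSubmodule _ _ _).smul_mem c hf.1, fun b hb Z => by
    rw [ev_smul, ev_smul, hf.2 b hb, mul_left_comm]⟩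

lemma tabVec_mem_semiInvariants (v : μ.cells → Fin p → ℝ) : tabVec v ∈ semiInvariants p μ :=
  ⟨tabVec_isHomogeneous v, fun _ hb Z => ev_mul_tabVec v Z hb⟩

lemma schur_le_semiInvariants : schur p μ ≤ semiInvariants p μ := by
  rw [schur_eq_span, Submodule.span_le]
  rintro _ ⟨A, rfl⟩
  exact tabVec_mem_semiInvariants _

lemma flagVec_isHomogeneous (A : Matrix (Fin p) (Fin (depth μ)) ℝ) :
    (flagVec μ A).IsHomogeneous μ.card :=
  tabVec_isHomogeneous _

lemma actLeft_flagVec (g : Matrix (Fin p) (Fin p) ℝ) (A : Matrix (Fin p) (Fin (depth μ)) ℝ) :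
    actLeft g (flagVec μ A) = flagVec μ (g * A) :=
  actLeft_tabVec _ _

lemma actLeft_mem_semiInvariants (g : Matrix (Fin p) (Fin p) ℝ) {f : Reg p (depth μ)}
    (hf : f ∈ semiInvariants p μ) : actLeft g f ∈ semiInvariants p μ :=
  ⟨actLeft_isHomogeneous g hf.1, fun b hb Z => by
    rw [ev_actLeft, ev_actLeft, ← Matrix.mul_assoc, hf.2 b hb]⟩

lemma blockTriangular_colOp {k : ℕ} {r : Fin k} {c : Fin k → ℝ} (hc : ∀ j ≤ r, c j = 0) :
    (1 + vecMulVec (Pi.single r 1) c : Matrix (Fin k) (Fin k) ℝ).BlockTriangular id := by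
  intro i j (hij : j < i)
  rw [Matrix.add_apply, Matrix.one_apply_ne hij.ne', zero_add, vecMulVec_apply]
  by_cases hi : i = r
  · rw [hc j (hi ▸ hij.le), mul_zero]
  · rw [Pi.single_eq_of_ne hi, zero_mul]

lemma chi_colOp {r : Fin (depth μ)} {c : Fin (depth μ) → ℝ} (hc : ∀ j ≤ r, c j = 0) :
    chi μ (1 + vecMulVec (Pi.single r 1) c) = 1 := by
  refine Finset.prod_eq_one fun j _ => Finset.prod_eq_one fun a _ => ?_
  rw [Matrix.add_apply, Matrix.one_apply_eq, vecMulVec_apply]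
  by_cases h : colCast μ j a = r
  · rw [hc _ h.le, mul_zero, add_zero]
  · rw [Pi.single_eq_of_ne h, zero_mul, add_zero]

lemma chi_diagonal (δ : Fin (depth μ) → ℝ) :
    chi μ (diagonal δ) = ∏ j : Fin (μ.rowLen 0), ∏ a, δ (colCast μ j a) := by
  simp [chi]

lemma rectId_mul_diagonal_apply {k : ℕ} (δ : Fin k → ℝ) (i : Fin p) (a : Fin k) :
    (rectId p k * diagonal δ) i a = if (i : ℕ) = a then δ a else 0 := by
  rw [mul_diagonal, rectId, of_apply, ite_mul, one_mul, zero_mul]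

/-- A rectangular diagonal matrix as a multiple of `rectId`. -/
lemma eq_rectId_mul_diagonal {k : ℕ} {x : Matrix (Fin p) (Fin k) ℝ}
    (hx : ∀ (i : Fin p) (j : Fin k), (i : ℕ) ≠ j → x i j = 0) :
    x = rectId p k * diagonal fun a : Fin k => if h : (a : ℕ) < p then x ⟨a, h⟩ a else (0 : ℝ) := by
  ext i a
  rw [rectId_mul_diagonal_apply]
  split_ifs with h1 h2
  · congr 1
    exact Fin.ext h1
  · exact absurd (h1 ▸ i.2) h2
  · exact hx i a h1

/-- If `μ` has more than `p` parts, semi-invariants vanish at `rectId`. -/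
lemma ev_rectId_eq_zero {f : Reg p (depth μ)} (hf : f ∈ semiInvariants p μ) (hp : p < depth μ) :
    ev (rectId p _) f = 0 := by
  let δ : Fin (depth μ) → ℝ := fun a => if (a : ℕ) < p then 1 else 0
  have h := hf.2 (diagonal δ) (blockTriangular_diagonal _) (rectId p _)
  have h1 : rectId p (depth μ) * diagonal δ = rectId p _ := by
    ext r a
    rw [rectId_mul_diagonal_apply, rectId, of_apply]
    split_ifs with h1
    · exact if_pos (h1 ▸ r.2)
    · rfl
  have h2 : chi μ (diagonal δ) = 0 := by
    have h0 : 0 < μ.rowLen 0 := col_lt_rowLen (⟨p, hp⟩ : Fin (μ.colLen 0))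
    rw [chi_diagonal]
    refine Finset.prod_eq_zero (Finset.mem_univ ⟨0, h0⟩) ?_
    exact Finset.prod_eq_zero (Finset.mem_univ (⟨p, hp⟩ : Fin (μ.colLen 0))) (by simp [δ])
  rw [h1, h2, zero_mul] at h
  exact h

lemma ev_rectId_flagVec_rectId (hp : depth μ ≤ p) :
    ev (rectId p _) (flagVec μ (rectId p _)) = 1 := by
  rw [ev_flagVec]
  refine Finset.prod_eq_one fun j _ => ?_
  rw [← Matrix.det_one (n := Fin (μ.colLen j))]
  congr 1
  ext a b
  have := (colCast μ j a).2
  rw [submatrix_apply, rectId_transpose_mul_apply, dif_pos (by omega), rectId, of_apply,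
    Matrix.one_apply]
  simp [Fin.ext_iff]

/-- The heights of the rows. -/
abbrev rowHeight (p k : ℕ) : Fin p × Fin k → ℕ := fun q => p - q.1

lemma scaleBy_rowHeight {k : ℕ} (t : ℝ) (f : Reg p k) :
    scaleBy (rowHeight p k) t f = actLeft (diagonal fun i => t ^ (p - (i : ℕ))) f := by
  refine MvPolynomial.funext fun x => ?_
  rw [eval_scaleBy, eval_actLeft]
  congr 2
  ext q
  simp [diagonal_apply]

lemma weight_lt_of_isHomogeneous {σ : Type} {f : MvPolynomial σ ℝ} {N M : ℕ}
    (hf : f.IsHomogeneous N) {w : σ → ℕ} (hw : ∀ i, w i ≤ M) :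
    ∀ α ∈ f.support, Finsupp.weight w α < N * M + 1 := by
  intro α hα
  have h := hf (mem_support_iff.1 hα)
  rw [Nat.lt_succ_iff, ← h, Finsupp.weight_apply, Finsupp.weight_apply, Finsupp.sum, Finsupp.sum,
    Finset.sum_mul]
  refine Finset.sum_le_sum fun i _ => ?_
  simpa using Nat.mul_le_mul_left _ (hw i)

theorem semiInvariants_le_schur : semiInvariants p μ ≤ schur p μ := by
  refine le_of_scalar_orthogonal schur_le_semiInvariants ?_
  intro f₀ hf₀ hf₀o
  let W : Submodule ℝ (Reg p (depth μ)) := semiInvariants p μ ⊓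
    ⨅ A, LinearMap.ker ((scalarForm _).flip (flagVec μ A))
  have hWmem : ∀ f, f ∈ W ↔ f ∈ semiInvariants p μ ∧ ∀ A, scalar f (flagVec μ A) = 0 := by
    intro f
    simp [W]
  have hact : ∀ f ∈ W, ∀ g, actLeft g f ∈ W := by
    intro f hf g
    rw [hWmem] at hf ⊢
    refine ⟨actLeft_mem_semiInvariants g hf.1, fun A => ?_⟩
    rw [scalar_actLeft g hf.1.1 (flagVec_isHomogeneous A), actLeft_flagVec]
    exact hf.2 _
  by_contra hne
  have hWne : W ≠ ⊥ := fun h => hne <| by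
    rw [← Submodule.mem_bot ℝ, ← h, hWmem]
    exact ⟨hf₀, fun A => hf₀o _ (flagVec_mem _ _ _)⟩
  obtain ⟨f, hf, hf0, h, hfh, hmax⟩ := exists_maximal_weight (w := rowHeight p (depth μ)) W
    (fun f hf t => by rw [scaleBy_rowHeight]; exact hact f hf _) _
    (fun f hf => weight_lt_of_isHomogeneous ((hWmem f).1 hf).1.1 (M := p) fun _ => Nat.sub_le _ _)
    hWne
  have hfW := (hWmem f).1 hf
  have hinv : ∀ (r : Fin p) (c : Fin p → ℝ), (∀ i ≤ r, c i = 0) → ∀ x,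
      ev (rowOp r c x) f = ev x f := by
    intro r c hc x
    rw [rowOp_eq_mul, ← ev_actLeft]
    congr 1
    refine eq_of_raise hfh (c := fun q => c q.1) (e := fun q => (r, q.2)) ?_ ?_
      (hmax _ (hact f hf _))
    · intro q hq
      have : ¬ q.1 ≤ r := fun h => hq (hc _ h)
      rw [Fin.le_def] at this
      have := q.1.2
      simp only [rowHeight]
      omega
    · intro x f
      have h1 := ev_actLeft (1 + vecMulVec (Pi.single r 1) c) (Matrix.of fun i j => x (i, j)) f
      rw [← rowOp_eq_mul] at h1
      exact h1
  have hfeq : f - ev (rectId p _) f • flagVec μ (rectId p _) = 0 := by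
    have hS : f - ev (rectId p _) f • flagVec μ (rectId p _) ∈ semiInvariants p μ :=
      Submodule.sub_mem _ hfW.1 (Submodule.smul_mem _ _ (tabVec_mem_semiInvariants _))
    refine eq_zero_of_triangular_invariant ?_ ?_ ?_
    · intro r c hc x
      have h1 := hinv r c hc x
      have h2 := ev_rowOp_flagVec_rectId (μ := μ) r c hc x
      rw [rowOp] at h1 h2
      rw [map_sub, map_sub, ev_smul, ev_smul, h1, h2]
    · intro r c hc x
      rw [colOp_eq_mul, hS.2 _ (blockTriangular_colOp hc), chi_colOp hc, one_mul]
    · intro x hx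
      rw [eq_rectId_mul_diagonal hx, hS.2 _ (blockTriangular_diagonal _), map_sub, ev_smul]
      rcases le_or_gt (depth μ) p with hp | hp
      · rw [ev_rectId_flagVec_rectId hp]
        ring
      · rw [ev_rectId_eq_zero hfW.1 hp]
        ring
  refine hf0 (eq_zero_of_scalar_self f ?_)
  conv_lhs => rw [sub_eq_zero.1 hfeq, scalar_smul_right, ← sub_eq_zero.1 hfeq]
  rw [hfW.2, mul_zero]

lemma tabVec_mem_schur (v : μ.cells → Fin p → ℝ) : tabVec v ∈ schur p μ :=
  semiInvariants_le_schur (tabVec_mem_semiInvariants v)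

lemma actLeft_mem_schur (g : Matrix (Fin p) (Fin p) ℝ) {f : Reg p (depth μ)}
    (hf : f ∈ schur p μ) : actLeft g f ∈ schur p μ :=
  semiInvariants_le_schur (actLeft_mem_semiInvariants g (schur_le_semiInvariants hf))

end SemiInvariants

end Vexillar

namespace Vexillar

open Matrix MvPolynomial

/-! ### Every polynomial is a combination of products of flags of minors -/

section Cauchy

variable {n m : ℕ}

/-- The image under `phi` of a tensor product of two flag vectors. -/
noncomputable def biVec (μ : YoungDiagram) (A : Matrix (Fin n) (Fin (depth μ)) ℝ)
    (B : Matrix (Fin m) (Fin (depth μ)) ℝ) : Reg n m :=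
  rightSub B (flagVec μ A)

lemma biVec_isHomogeneous (μ : YoungDiagram) (A : Matrix (Fin n) (Fin (depth μ)) ℝ)
    (B : Matrix (Fin m) (Fin (depth μ)) ℝ) : (biVec μ A B).IsHomogeneous μ.card :=
  rightSub_isHomogeneous B (flagVec_isHomogeneous A)

lemma actLeft_rightSub {k : ℕ} (g : Matrix (Fin n) (Fin n) ℝ) (B : Matrix (Fin m) (Fin k) ℝ)
    (f : Reg n k) : actLeft g (rightSub B f) = rightSub B (actLeft g f) :=
  ev_injective fun x => by
    rw [ev_actLeft, ev_rightSub, ev_rightSub, ev_actLeft, Matrix.mul_assoc]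

lemma rightSub_rightSub {k l : ℕ} (B : Matrix (Fin m) (Fin k) ℝ) (B' : Matrix (Fin k) (Fin l) ℝ)
    (f : Reg n l) : rightSub B (rightSub B' f) = rightSub (B * B') f :=
  ev_injective fun x => by
    rw [ev_rightSub, ev_rightSub, ev_rightSub, Matrix.mul_assoc]

lemma actLeft_biVec (g : Matrix (Fin n) (Fin n) ℝ) (μ : YoungDiagram)
    (A : Matrix (Fin n) (Fin (depth μ)) ℝ) (B : Matrix (Fin m) (Fin (depth μ)) ℝ) :
    actLeft g (biVec μ A B) = biVec μ (g * A) B := by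
  rw [biVec, actLeft_rightSub, actLeft_flagVec, biVec]

lemma rightSub_biVec (h : Matrix (Fin m) (Fin m) ℝ) (μ : YoungDiagram)
    (A : Matrix (Fin n) (Fin (depth μ)) ℝ) (B : Matrix (Fin m) (Fin (depth μ)) ℝ) :
    rightSub h (biVec μ A B) = biVec μ A (h * B) :=
  rightSub_rightSub _ _ _

lemma ev_rowOp_biVec (μ : YoungDiagram) (r : Fin n) (c : Fin n → ℝ) (hc : ∀ i ≤ r, c i = 0)
    (x : Matrix (Fin n) (Fin m) ℝ) :
    ev (rowOp r c x) (biVec μ (rectId n _) (rectId m _)) =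
      ev x (biVec μ (rectId n _) (rectId m _)) := by
  rw [biVec, ev_rightSub, ev_rightSub, rowOp_mul, ev_rowOp_flagVec_rectId r c hc]

lemma ev_colOp_biVec (μ : YoungDiagram) (r : Fin m) (c : Fin m → ℝ) (hc : ∀ i ≤ r, c i = 0)
    (x : Matrix (Fin n) (Fin m) ℝ) :
    ev (rowOp r c xᵀ)ᵀ (biVec μ (rectId n _) (rectId m _)) =
      ev x (biVec μ (rectId n _) (rectId m _)) := by
  rw [biVec, rightSub_flagVec, ev_leftSub, ev_leftSub, transpose_transpose, rowOp_mul,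
    ev_rowOp_flagVec_rectId r c hc]

lemma ev_diag_biVec {μ : YoungDiagram} (hn : depth μ ≤ n) (x : Matrix (Fin n) (Fin m) ℝ)
    (hx : ∀ (i : Fin n) (j : Fin m), (i : ℕ) ≠ j → x i j = 0) :
    ev x (biVec μ (rectId n _) (rectId m _)) =
      ∏ c ∈ μ.cells, if h : c.1 < n ∧ c.1 < m then x ⟨c.1, h.1⟩ ⟨c.1, h.2⟩ else 0 := by
  have hx' : ∀ (i : Fin n) (j : Fin (depth μ)), (x * rectId m (depth μ)) i j =
      if h : (j : ℕ) < m then x i ⟨j, h⟩ else 0 := by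
    intro i j
    rw [mul_apply]
    split_ifs with h
    · rw [Finset.sum_eq_single ⟨j, h⟩]
      · simp [rectId]
      · intro r _ hr
        have : (r : ℕ) ≠ j := fun h' => hr (Fin.ext h')
        simp [rectId, this]
      · simp
    · refine Finset.sum_eq_zero fun r _ => ?_
      have : (r : ℕ) ≠ j := by omega
      simp [rectId, this]
  have hD : ∀ (i : Fin n) (j : Fin (depth μ)), (i : ℕ) ≠ j →
      (x * rectId m (depth μ)) i j = 0 := by
    intro i j hij
    rw [hx']
    split_ifs with h
    · exact hx i ⟨j, h⟩ hij
    · rfl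
  have key : ∀ b (hb : b < n), (if h : b < m then x ⟨b, hb⟩ ⟨b, h⟩ else 0) =
      if h : b < n ∧ b < m then x ⟨b, h.1⟩ ⟨b, h.2⟩ else 0 := by
    intro b hb
    by_cases hm : b < m <;> simp [hb, hm]
  rw [biVec, ev_rightSub, eq_rectId_mul_diagonal hD, flagVec,
    ev_mul_tabVec _ _ (blockTriangular_diagonal _), ← flagVec, ev_rectId_flagVec_rectId hn, mul_one,
    chi_diagonal]
  refine Eq.trans ?_ (Finset.prod_coe_sort μ.cells
    fun c => if h : c.1 < n ∧ c.1 < m then x ⟨c.1, h.1⟩ ⟨c.1, h.2⟩ else 0)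
  rw [← (cellEquiv μ).prod_comp, Fintype.prod_sigma]
  refine Finset.prod_congr rfl fun j _ => Finset.prod_congr rfl fun a _ => ?_
  have ha : (a : ℕ) < n := (colCast μ j a).2.trans_le hn
  simp only [Fin.val_castLE, ha, dif_pos, hx', cellEquiv_apply, cell]
  exact key _ ha

lemma exists_youngDiagram {p : ℕ} (l : ℕ → ℕ) (hl : Antitone l) (hp : ∀ a, p ≤ a → l a = 0) :
    ∃ μ : YoungDiagram, depth μ ≤ p ∧ μ.card = ∑ a ∈ Finset.range p, l a ∧
      ∀ g : ℕ → ℝ, ∏ c ∈ μ.cells, g c.1 = ∏ a ∈ Finset.range p, g a ^ l a := by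
  let S : Finset (ℕ × ℕ) := ((Finset.range p).sigma fun a => Finset.range (l a)).map
    (Equiv.sigmaEquivProd ℕ ℕ).toEmbedding
  have hS : ∀ c, c ∈ S ↔ c.2 < l c.1 := by
    intro c
    have : c.2 < l c.1 → c.1 < p := fun h => by
      by_contra hc
      rw [hp _ (not_lt.1 hc)] at h
      exact Nat.not_lt_zero _ h
    simp only [S, Finset.mem_map_equiv, Finset.mem_sigma, Finset.mem_range]
    exact ⟨fun h => h.2, fun h => ⟨this h, h⟩⟩
  let μ : YoungDiagram := ⟨S, fun a b hab ha => by
    rw [Finset.mem_coe, hS] at ha ⊢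
    exact (hab.2.trans_lt ha).trans_le (hl hab.1)⟩
  refine ⟨μ, ?_, ?_, fun g => ?_⟩
  · by_contra hc
    have h1 := (YoungDiagram.mem_cells _).2 (YoungDiagram.mem_iff_lt_colLen.2 (not_le.1 hc))
    have h2 := (hS _).1 h1
    rw [hp p le_rfl] at h2
    exact Nat.not_lt_zero _ h2
  · change S.card = _
    rw [Finset.card_map, Finset.card_sigma]
    simp
  · change ∏ c ∈ S, _ = _
    rw [Finset.prod_map, Finset.prod_sigma]
    simp

/-- An exponent supported on the diagonal. -/
def IsDiagonalExponent (α : Fin n × Fin m →₀ ℕ) : Prop := ∀ q, α q ≠ 0 → (q.1 : ℕ) = q.2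

lemma exists_youngDiagram_of_exponent (α : Fin n × Fin m →₀ ℕ) (hα : IsDiagonalExponent α)
    (hanti : ∀ q q' : Fin n × Fin m, (q.1 : ℕ) = q.2 → (q'.1 : ℕ) = q'.2 → q.1 < q'.1 →
      α q' ≤ α q) :
    ∃ μ : YoungDiagram, μ.card = ∑ q, α q ∧ ∀ x : Matrix (Fin n) (Fin m) ℝ,
      (∀ (i : Fin n) (j : Fin m), (i : ℕ) ≠ j → x i j = 0) →
      ev x (biVec μ (rectId n _) (rectId m _)) = ∏ q, x q.1 q.2 ^ α q := by
  let p := min n m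
  let e : Fin p → Fin n × Fin m := fun a => (Fin.castLE (min_le_left _ _) a,
    Fin.castLE (min_le_right _ _) a)
  have he : Function.Injective e := fun a b h =>
    Fin.castLE_injective (min_le_left _ _) (congrArg Prod.fst h)
  have hr : ∀ q : Fin n × Fin m, q ∉ Set.range e → α q = 0 := by
    intro q hq
    by_contra h0
    have h1 := hα q h0
    refine hq ⟨⟨q.1, lt_min q.1.2 (h1 ▸ q.2.2)⟩, Prod.ext rfl (Fin.ext h1)⟩
  let l : ℕ → ℕ := fun a => if h : a < p then α (e ⟨a, h⟩) else 0
  have hl : ∀ a : Fin p, l a = α (e a) := fun a => dif_pos a.2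
  have hla : Antitone l := by
    intro a b hab
    by_cases hb : b < p
    · rcases hab.eq_or_lt with rfl | hab
      · rfl
      have ha : a < p := hab.trans hb
      simp only [l, ha, hb, dif_pos]
      exact hanti _ _ rfl rfl hab
    · simp [l, hb]
  obtain ⟨μ, hd, hcard, hprod⟩ := exists_youngDiagram (p := p) l hla
    fun a ha => dif_neg (not_lt.2 ha)
  refine ⟨μ, ?_, fun x hx => ?_⟩
  · rw [hcard, Finset.sum_range]
    exact Fintype.sum_of_injective e he _ _ hr hl
  · rw [ev_diag_biVec (hd.trans (min_le_left _ _)) x hx,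
      hprod (fun a => if h : a < n ∧ a < m then x ⟨a, h.1⟩ ⟨a, h.2⟩ else 0), Finset.prod_range]
    refine Fintype.prod_of_injective e he _ _ (fun q hq => by rw [hr q hq, pow_zero]) fun a => ?_
    have ha := lt_min_iff.1 a.2
    rw [dif_pos ha, hl]
    rfl

/-- The heights of the entries. -/
abbrev height (n m : ℕ) : Fin n × Fin m → ℕ := fun q => (n - q.1) + (m - q.2)

lemma scaleBy_height (t : ℝ) (f : Reg n m) :
    scaleBy (height n m) t f = actLeft (diagonal fun i => t ^ (n - (i : ℕ)))
      (rightSub (diagonal fun j => t ^ (m - (j : ℕ))) f) := by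
  refine MvPolynomial.funext fun x => ?_
  rw [eval_scaleBy, eval_actLeft, eval_rightSub]
  congr 2
  ext q
  simp [diagonal_apply, pow_add]
  ring

lemma rename_swap_eq (s : Equiv.Perm (Fin n)) (s' : Equiv.Perm (Fin m)) (f : Reg n m) :
    rename (s.prodCongr s') f =
      actLeft (Matrix.of fun i j => if i = s j then 1 else 0)
        (rightSub (Matrix.of fun i j => if i = s' j then 1 else 0) f) := by
  refine MvPolynomial.funext fun x => ?_
  rw [eval_rename, eval_actLeft, eval_rightSub]
  congr 2
  ext q
  simp [Prod.map]

/-- The span of the products of flags of minors of degree `N`. -/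
noncomputable def biSpan (n m N : ℕ) : Submodule ℝ (Reg n m) :=
  Submodule.span ℝ {f | ∃ (μ : YoungDiagram) (A : Matrix (Fin n) (Fin (depth μ)) ℝ)
    (B : Matrix (Fin m) (Fin (depth μ)) ℝ), μ.card = N ∧ f = biVec μ A B}

theorem homogeneousSubmodule_le_biSpan (N : ℕ) :
    homogeneousSubmodule (Fin n × Fin m) ℝ N ≤ biSpan n m N := by
  have hle : biSpan n m N ≤ homogeneousSubmodule (Fin n × Fin m) ℝ N := by
    rw [biSpan, Submodule.span_le]
    rintro _ ⟨μ, A, B, rfl, rfl⟩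
    exact biVec_isHomogeneous μ A B
  have : FiniteDimensional ℝ (biSpan n m N) := Submodule.finiteDimensional_of_le hle
  refine le_of_scalar_orthogonal hle ?_
  intro f₀ hf₀ hf₀o
  let W : Submodule ℝ (Reg n m) := homogeneousSubmodule (Fin n × Fin m) ℝ N ⊓
    ⨅ u : biSpan n m N, LinearMap.ker ((scalarForm _).flip u.1)
  have hWmem : ∀ f, f ∈ W ↔ f.IsHomogeneous N ∧ ∀ u ∈ biSpan n m N, scalar f u = 0 := by
    intro f
    simp [W]
  have hWspan : ∀ f, f.IsHomogeneous N → (∀ (μ : YoungDiagram)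
      (A : Matrix (Fin n) (Fin (depth μ)) ℝ) (B : Matrix (Fin m) (Fin (depth μ)) ℝ), μ.card = N →
      scalar f (biVec μ A B) = 0) → f ∈ W := by
    intro f hf h
    refine (hWmem f).2 ⟨hf, ?_⟩
    have : biSpan n m N ≤ LinearMap.ker (scalarForm _ f) := by
      rw [biSpan, Submodule.span_le]
      rintro _ ⟨μ, A, B, hμ, rfl⟩
      exact h μ A B hμ
    exact fun u hu => this hu
  have hW' : ∀ f ∈ W, ∀ (μ : YoungDiagram)
      (A : Matrix (Fin n) (Fin (depth μ)) ℝ) (B : Matrix (Fin m) (Fin (depth μ)) ℝ), μ.card = N →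
      scalar f (biVec μ A B) = 0 := fun f hf μ A B hμ =>
    ((hWmem f).1 hf).2 _ (Submodule.subset_span ⟨μ, A, B, hμ, rfl⟩)
  have hact : ∀ f ∈ W, ∀ g, actLeft g f ∈ W := by
    intro f hf g
    have hfh := ((hWmem f).1 hf).1
    refine hWspan _ (actLeft_isHomogeneous g hfh) ?_
    rintro μ A B rfl
    rw [scalar_actLeft g hfh (biVec_isHomogeneous μ A B), actLeft_biVec]
    exact hW' f hf _ _ _ rfl
  have hact' : ∀ f ∈ W, ∀ g, rightSub g f ∈ W := by
    intro f hf g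
    have hfh := ((hWmem f).1 hf).1
    refine hWspan _ (rightSub_isHomogeneous g hfh) ?_
    rintro μ A B rfl
    rw [scalar_rightSub g hfh (biVec_isHomogeneous μ A B), rightSub_biVec]
    exact hW' f hf _ _ _ rfl
  by_contra hne
  have hWne : W ≠ ⊥ := fun h => hne <| by
    rw [← Submodule.mem_bot ℝ, ← h, hWmem]
    exact ⟨hf₀, hf₀o⟩
  obtain ⟨f, hf, hf0, h, hfh, hmax⟩ := exists_maximal_weight (w := height n m) W
    (fun f hf t => by rw [scaleBy_height]; exact hact _ (hact' f hf _) _) _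
    (fun f hf => weight_lt_of_isHomogeneous ((hWmem f).1 hf).1 (M := n + m)
      fun _ => add_le_add (Nat.sub_le _ _) (Nat.sub_le _ _)) hWne
  have hfW := (hWmem f).1 hf
  have hL : ∀ (r : Fin n) (c : Fin n → ℝ), (∀ i ≤ r, c i = 0) → ∀ x,
      ev (rowOp r c x) f = ev x f := by
    intro r c hc x
    rw [rowOp_eq_mul, ← ev_actLeft]
    congr 1
    refine eq_of_raise hfh (c := fun q => c q.1) (e := fun q => (r, q.2)) ?_ ?_
      (hmax _ (hact f hf _))
    · intro q hq
      have : ¬ q.1 ≤ r := fun h => hq (hc _ h)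
      rw [Fin.le_def] at this
      have := q.1.2
      simp only [height]
      omega
    · intro x f
      have h1 := ev_actLeft (1 + vecMulVec (Pi.single r 1) c) (Matrix.of fun i j => x (i, j)) f
      rw [← rowOp_eq_mul] at h1
      exact h1
  have hU : ∀ (r : Fin m) (c : Fin m → ℝ), (∀ i ≤ r, c i = 0) → ∀ x : Matrix (Fin n) (Fin m) ℝ,
      ev (Matrix.of fun i j => x i j + c j * x i r) f = ev x f := by
    intro r c hc x
    rw [colOp_eq_mul, ← ev_rightSub]
    congr 1
    refine eq_of_raise hfh (c := fun q => c q.2) (e := fun q => (q.1, r)) ?_ ?_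
      (hmax _ (hact' f hf _))
    · intro q hq
      have : ¬ q.2 ≤ r := fun h => hq (hc _ h)
      rw [Fin.le_def] at this
      have := q.2.2
      simp only [height]
      omega
    · intro x f
      have h1 := ev_rightSub (1 + vecMulVec (Pi.single r 1) c) (Matrix.of fun i j => x (i, j)) f
      rw [← colOp_eq_mul] at h1
      exact h1
  have hdom : ∀ α ∈ f.support, IsDiagonalExponent α → ∀ q q' : Fin n × Fin m,
      (q.1 : ℕ) = q.2 → (q'.1 : ℕ) = q'.2 → q.1 < q'.1 → α q' ≤ α q := by
    intro α hα hdiag q q' hq hq' hlt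
    by_contra hcon
    let e := (Equiv.swap q.1 q'.1).prodCongr (Equiv.swap q.2 q'.2)
    have hmem : rename e f ∈ W := by
      rw [rename_swap_eq]
      exact hact _ (hact' f hf _) _
    have h1 := hmax _ hmem (α.mapDomain e) (by
      rw [mem_support_iff, coeff_rename_mapDomain _ e.injective]
      exact mem_support_iff.1 hα)
    rw [← hfh (mem_support_iff.1 hα), Finsupp.weight_apply, Finsupp.weight_apply,
      Finsupp.sum_mapDomain_index (by simp) (by intros; exact add_mul _ _ _),
      Finsupp.sum_fintype _ _ (by simp), Finsupp.sum_fintype _ _ (by simp)] at h1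
    have hqq : q ≠ q' := fun h => hlt.ne (congrArg Prod.fst h)
    have h2 : ∑ z, (α z : ℤ) * ((height n m (e z) : ℤ) - height n m z) =
        α q * ((height n m (e q) : ℤ) - height n m q) +
          α q' * ((height n m (e q') : ℤ) - height n m q') := by
      refine Fintype.sum_eq_add q q' hqq fun z hz => ?_
      by_cases hαz : α z = 0
      · simp [hαz]
      · have hzd := hdiag z hαz
        have hz1 : z.1 ≠ q.1 := fun h => hz.1 (Prod.ext h (Fin.ext (by rw [← hzd, h, hq])))
        have hz1' : z.1 ≠ q'.1 := fun h => hz.2 (Prod.ext h (Fin.ext (by rw [← hzd, h, hq'])))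
        have hz2 : z.2 ≠ q.2 := fun h => hz.1 (Prod.ext (Fin.ext (by rw [hzd, h, hq])) h)
        have hz2' : z.2 ≠ q'.2 := fun h => hz.2 (Prod.ext (Fin.ext (by rw [hzd, h, hq'])) h)
        have : e z = z := Prod.ext (Equiv.swap_apply_of_ne_of_ne hz1 hz1')
          (Equiv.swap_apply_of_ne_of_ne hz2 hz2')
        rw [this, sub_self, mul_zero]
    have h3 : e q = q' := Prod.ext (Equiv.swap_apply_left _ _) (Equiv.swap_apply_left _ _)
    have h4 : e q' = q := Prod.ext (Equiv.swap_apply_right _ _) (Equiv.swap_apply_right _ _)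
    have h5 : height n m q' < height n m q := by
      have := q'.1.2
      have := q'.2.2
      rw [Fin.lt_def] at hlt
      simp only [height]
      omega
    rw [h3, h4] at h2
    simp only [mul_sub, Finset.sum_sub_distrib, smul_eq_mul] at h1 h2
    have h6 : ∑ z, (α z : ℤ) * (height n m (e z) : ℤ) ≤ ∑ z, (α z : ℤ) * (height n m z : ℤ) := by
      exact_mod_cast h1
    have h7 : ((α q : ℤ) - α q') * ((height n m q : ℤ) - height n m q') < 0 :=
      mul_neg_of_neg_of_pos (by omega) (by omega)
    linarith
  choose! M hMcard hMev using fun α (hα : α ∈ f.support ∧ IsDiagonalExponent α) =>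
    exists_youngDiagram_of_exponent α hα.2 (hdom α hα.1 hα.2)
  classical
  let g : Reg n m := ∑ α ∈ f.support with IsDiagonalExponent α,
    coeff α f • biVec (M α) (rectId n _) (rectId m _)
  have hg : g ∈ biSpan n m N := by
    refine Submodule.sum_mem _ fun α hα => Submodule.smul_mem _ _ (Submodule.subset_span
      ⟨M α, _, _, ?_, rfl⟩)
    have hα := Finset.mem_filter.1 hα
    rw [hMcard α hα, ← hfW.1 (mem_support_iff.1 hα.1)]
    simp [Finsupp.weight_apply, Finsupp.sum_fintype]
  have hfg : f - g = 0 := by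
    refine eq_zero_of_triangular_invariant ?_ ?_ ?_
    · intro r c hc x
      have h1 := hL r c hc x
      have h2 := fun μ => ev_rowOp_biVec μ r c hc x
      simp only [rowOp] at h1 h2
      rw [map_sub, map_sub, h1, map_sum, map_sum]
      simp only [ev_smul, h2]
    · intro r c hc x
      have h1 := hU r c hc x
      have h2 := fun μ => ev_colOp_biVec μ r c hc x
      have h3 : (rowOp r c xᵀ)ᵀ = Matrix.of fun i j => x i j + c j * x i r := rfl
      rw [h3] at h2
      rw [map_sub, map_sub, h1, map_sum, map_sum]
      simp only [ev_smul, h2]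
    · intro x hx
      rw [map_sub, map_sum, sub_eq_zero, ev, eval_eq', Finset.sum_filter]
      refine Finset.sum_congr rfl fun α hα => ?_
      split_ifs with hd
      · rw [← ev, ev_smul, hMev α ⟨hα, hd⟩ x hx]
      · rw [IsDiagonalExponent] at hd
        push Not at hd
        obtain ⟨q, hq0, hq⟩ := hd
        rw [Finset.prod_eq_zero (Finset.mem_univ q), mul_zero]
        rw [hx _ _ hq, zero_pow hq0]
  refine hf0 (eq_zero_of_scalar_self f ?_)
  conv_lhs => rw [sub_eq_zero.1 hfg, ← sub_eq_zero.1 hfg]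
  exact (congrArg (scalar f) (sub_eq_zero.1 hfg)).trans (hfW.2 g hg)

end Cauchy

end Vexillar

namespace Vexillar

open Matrix MvPolynomial

/-! ### Traces -/

section Traces

lemma sum_eq_factorial_smul {r n : ℕ} {V : Type*} [AddCommMonoid V] (F : (Fin r → Fin n) → V)
    (hF : ∀ I (π : Equiv.Perm (Fin r)), F (I ∘ π) = F I)
    (h0 : ∀ I, ¬ Function.Injective I → F I = 0) :
    ∑ I, F I = r.factorial • ∑ I : Fin r ↪o Fin n, F I := by
  have h : ∑ q : (Fin r ↪o Fin n) × Equiv.Perm (Fin r), F q.1 = ∑ I, F I := by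
    refine Fintype.sum_of_injective (fun q => q.1 ∘ q.2) ?_ _ _ ?_ fun q => (hF _ _).symm
    · rintro ⟨I, π⟩ ⟨I', π'⟩ h
      have hr : Set.range I = Set.range I' := by
        have := congrArg Set.range h
        simpa only [Set.range_comp, Equiv.range_eq_univ, Set.image_univ] using this
      obtain rfl : I = I' := OrderEmbedding.range_inj.1 hr
      refine Prod.ext rfl (Equiv.ext fun a => I.injective (congrFun h a))
    · intro I hI
      refine h0 I fun hinj => hI ?_
      have hm : StrictMono (I ∘ Tuple.sort I) :=
        (Tuple.monotone_sort I).strictMono_of_injective (hinj.comp (Equiv.injective _))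
      refine ⟨⟨OrderEmbedding.ofStrictMono _ hm, (Tuple.sort I).symm⟩, ?_⟩
      ext a
      simp
  rw [← h, Fintype.sum_prod_type]
  simp [Finset.smul_sum, Fintype.card_perm]

variable {μ : YoungDiagram} {n : ℕ}

/-- The contraction of an inscribed diagram in two cells. -/
noncomputable def contraction (v : μ.cells → Fin n → ℝ) (c c' : μ.cells) : Reg n (depth μ) :=
  ∑ i, tabVec (Function.update (Function.update v c (Pi.single i 1)) c' (Pi.single i 1))

/-- The inscribed diagram as a bilinear function of the vectors in two cells. -/
noncomputable def tabBilin (v : μ.cells → Fin n → ℝ) {c c' : μ.cells} (h : c ≠ c') :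
    (Fin n → ℝ) →ₗ[ℝ] (Fin n → ℝ) →ₗ[ℝ] Reg n (depth μ) :=
  LinearMap.mk₂ ℝ (fun u u' => tabVec (Function.update (Function.update v c u) c' u'))
    (fun u w u' => by
      simp only [tabVec_eq_tabMulti, Function.update_comm (β := fun _ => Fin n → ℝ) h _ u', MultilinearMap.map_update_add])
    (fun a u u' => by
      simp only [tabVec_eq_tabMulti, Function.update_comm (β := fun _ => Fin n → ℝ) h _ u', MultilinearMap.map_update_smul])
    (fun u u' w => by simp only [tabVec_eq_tabMulti, MultilinearMap.map_update_add])
    (fun a u u' => by simp only [tabVec_eq_tabMulti, MultilinearMap.map_update_smul])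

lemma sum_bilin_orthogonal {V : Type*} [AddCommGroup V] [Module ℝ V]
    (B : (Fin n → ℝ) →ₗ[ℝ] (Fin n → ℝ) →ₗ[ℝ] V) {g : Matrix (Fin n) (Fin n) ℝ}
    (hg : g * gᵀ = 1) :
    ∑ i, B (g *ᵥ Pi.single i 1) (g *ᵥ Pi.single i 1) =
      ∑ i, B (Pi.single i 1) (Pi.single i 1) := by
  have hcol : ∀ i, g *ᵥ Pi.single i 1 = ∑ x, g x i • (Pi.single x 1 : Fin n → ℝ) := by
    intro i
    ext y
    simp [Pi.single_apply]
  have h1 : ∀ i, B (g *ᵥ Pi.single i 1) (g *ᵥ Pi.single i 1) =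
      ∑ x, ∑ y, (g x i * g y i) • B (Pi.single x 1) (Pi.single y 1) := by
    intro i
    rw [hcol]
    simp only [map_sum, map_smul, LinearMap.sum_apply, LinearMap.smul_apply, Finset.smul_sum,
      smul_smul]
    rw [Finset.sum_comm]
    exact Finset.sum_congr rfl fun _ _ => Finset.sum_congr rfl fun _ _ => by rw [mul_comm]
  simp only [h1]
  rw [Finset.sum_comm]
  refine Finset.sum_congr rfl fun x _ => ?_
  rw [Finset.sum_comm]
  have h2 : ∀ y, ∑ i, (g x i * g y i) • B (Pi.single x 1) (Pi.single y 1) =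
      (if x = y then (1 : ℝ) else 0) • B (Pi.single x 1) (Pi.single y 1) := by
    intro y
    rw [← Finset.sum_smul]
    congr 1
    have := congrFun (congrFun hg x) y
    simpa [mul_apply, Matrix.one_apply] using this
  simp only [h2]
  simp

lemma actLeft_contraction {g : Matrix (Fin n) (Fin n) ℝ} (hg : g * gᵀ = 1)
    (v : μ.cells → Fin n → ℝ) {c c' : μ.cells} (h : c ≠ c') :
    actLeft g (contraction v c c') = contraction (fun c => g *ᵥ v c) c c' := by
  rw [contraction, map_sum]
  refine Eq.trans ?_ (sum_bilin_orthogonal (tabBilin (fun c => g *ᵥ v c) h) hg)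
  refine Finset.sum_congr rfl fun i _ => ?_
  rw [actLeft_tabVec]
  change _ = tabVec _
  congr 1
  ext1 d
  by_cases h1 : d = c'
  · subst h1; simp
  · by_cases h2 : d = c
    · subst h2; simp [h1]
    · simp [h1, h2]

/-- The diagram obtained from `v` by writing the vectors `u` in selected rows of two columns. -/
noncomputable def place {r : ℕ} (v : μ.cells → Fin n → ℝ) {j j' : ℕ}
    (s : Fin r ↪o Fin (μ.colLen j)) (s' : Fin r ↪o Fin (μ.colLen j')) (u : Fin r → Fin n → ℝ) :
    μ.cells → Fin n → ℝ :=
  Function.extend (fun a => cell j (s a)) u (Function.extend (fun a => cell j' (s' a)) u v)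

section Place

variable {r : ℕ} {v : μ.cells → Fin n → ℝ} {j j' : ℕ} {s : Fin r ↪o Fin (μ.colLen j)}
  {s' : Fin r ↪o Fin (μ.colLen j')} {u : Fin r → Fin n → ℝ}

lemma cell_comp_injective (s : Fin r ↪o Fin (μ.colLen j)) :
    Function.Injective fun a => cell j (s a) := fun _ _ h =>
  s.injective (Fin.ext (cell_injective h).2)

lemma place_fst (a : Fin r) : place v s s' u (cell j (s a)) = u a :=
  (cell_comp_injective s).extend_apply _ _ _

lemma place_snd (hj : j ≠ j') (a : Fin r) : place v s s' u (cell j' (s' a)) = u a := by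
  rw [place, Function.extend_apply' _ _ _ fun ⟨b, hb⟩ => hj (cell_injective hb).1]
  exact (cell_comp_injective s').extend_apply _ _ _

lemma place_of_ne {c : μ.cells} (h : ∀ a, cell j (s a) ≠ c) (h' : ∀ a, cell j' (s' a) ≠ c) :
    place v s s' u c = v c := by
  rw [place, Function.extend_apply' _ _ _ fun ⟨b, hb⟩ => h b hb,
    Function.extend_apply' _ _ _ fun ⟨b, hb⟩ => h' b hb]

lemma tabVec_place_comp (hj : j ≠ j') (hr : 0 < r) (π : Equiv.Perm (Fin r)) :
    tabVec (place v s s' (u ∘ π)) = tabVec (place v s s' u) := by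
  let ρ : ∀ k : ℕ, Equiv.Perm (Fin (μ.colLen k)) := Function.update (Function.update (fun _ => 1) j
    (π.viaFintypeEmbedding s.toEmbedding)) j' (π.viaFintypeEmbedding s'.toEmbedding)
  have hρj : ρ j = π.viaFintypeEmbedding s.toEmbedding := by
    simp [ρ, Function.update_of_ne hj]
  have hρj' : ρ j' = π.viaFintypeEmbedding s'.toEmbedding := by simp [ρ]
  have hρ : ∀ k, k ≠ j → k ≠ j' → ρ k = 1 := fun k h h' => by
    simp [ρ, Function.update_of_ne h, Function.update_of_ne h']
  rw [tabVec_of_perm ρ (v := place v s s' u)]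
  · have hsign : ∏ k : Fin (μ.rowLen 0), Equiv.Perm.sign (ρ k) = 1 := by
      rw [Fintype.prod_eq_mul (⟨j, col_lt_rowLen (s ⟨0, hr⟩)⟩ : Fin (μ.rowLen 0))
        ⟨j', col_lt_rowLen (s' ⟨0, hr⟩)⟩ (fun h => hj (congrArg Fin.val h))]
      · rw [hρj, hρj', Equiv.Perm.viaFintypeEmbedding_sign, Equiv.Perm.viaFintypeEmbedding_sign,
          Int.units_mul_self]
      · intro k hk
        rw [hρ k (fun h => hk.1 (Fin.ext h)) (fun h => hk.2 (Fin.ext h)), map_one]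
    rw [← Int.cast_prod, ← Units.coe_prod, hsign]
    simp
  · intro k a
    by_cases hk : k = j
    · subst hk
      rw [hρj]
      by_cases ha : a ∈ Set.range s
      · obtain ⟨b, rfl⟩ := ha
        have := π.viaFintypeEmbedding_apply_image s.toEmbedding b
        simp only [RelEmbedding.coe_toEmbedding] at this
        rw [this, place_fst, place_fst, Function.comp_apply]
      · rw [π.viaFintypeEmbedding_apply_notMem_range s.toEmbedding ha, place_of_ne, place_of_ne]
        all_goals first
          | exact fun b hb => ha ⟨b, Fin.ext (cell_injective hb).2⟩
          | exact fun b hb => hj (cell_injective hb).1.symm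
    · by_cases hk' : k = j'
      · subst hk'
        rw [hρj']
        by_cases ha : a ∈ Set.range s'
        · obtain ⟨b, rfl⟩ := ha
          have := π.viaFintypeEmbedding_apply_image s'.toEmbedding b
          simp only [RelEmbedding.coe_toEmbedding] at this
          rw [this, place_snd hj, place_snd hj, Function.comp_apply]
        · rw [π.viaFintypeEmbedding_apply_notMem_range s'.toEmbedding ha, place_of_ne, place_of_ne]
          all_goals first
            | exact fun b hb => ha ⟨b, Fin.ext (cell_injective hb).2⟩
            | exact fun b hb => hj (cell_injective hb).1
      · rw [hρ k hk hk', Equiv.Perm.one_apply, place_of_ne, place_of_ne]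
        all_goals first
          | exact fun b hb => hk (cell_injective hb).1.symm
          | exact fun b hb => hk' (cell_injective hb).1.symm

lemma tabVec_place_eq_zero {I : Fin r → Fin n} (hI : ¬ Function.Injective I) :
    tabVec (place v s s' fun a => Pi.single (I a) 1) = 0 := by
  rw [Function.Injective] at hI
  push Not at hI
  obtain ⟨a, b, hab, hne⟩ := hI
  exact tabVec_eq_zero (fun h => hne (s.injective h)) (by rw [place_fst, place_fst, hab])

end Place

/-- The trace space is spanned by single contractions. -/
theorem traceSpan_eq_span_contraction : traceSpan n μ = Submodule.span ℝ
    {f | ∃ (v : μ.cells → Fin n → ℝ) (c c' : μ.cells), c.1.2 ≠ c'.1.2 ∧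
      f = contraction v c c'} := by
  refine le_antisymm (Submodule.span_le.2 ?_) (Submodule.span_mono ?_)
  · rintro _ ⟨v, j, j', r, s, s', hj, hr, rfl⟩
    have h := sum_eq_factorial_smul (fun I : Fin r → Fin n =>
      tabVec (place v s s' fun a => Pi.single (I a) 1))
      (fun I π => tabVec_place_comp (u := fun a => Pi.single (I a) 1) hj hr π)
      (fun I hI => tabVec_place_eq_zero hI)
    have hfac : (r.factorial : ℝ) ≠ 0 := Nat.cast_ne_zero.2 (Nat.factorial_ne_zero _)
    rw [SetLike.mem_coe, ← Submodule.smul_mem_iff _ hfac, Nat.cast_smul_eq_nsmul]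
    refine (congrArg (· ∈ _) h).mp ?_
    obtain ⟨r, rfl⟩ := Nat.exists_eq_succ_of_ne_zero hr.ne'
    rw [← (Fin.consEquiv fun _ => Fin n).sum_comp, Fintype.sum_prod_type_right]
    refine Submodule.sum_mem _ fun I _ => Submodule.subset_span
      ⟨place v s s' (Fin.cons 0 fun a => Pi.single (I a) 1), cell j (s 0), cell j' (s' 0),
        hj, ?_⟩
    refine Finset.sum_congr rfl fun x _ => ?_
    congr 1
    ext1 c
    by_cases h1 : c = cell j' (s' 0)
    · subst h1
      rw [place_snd hj, Function.update_self]
      simp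
    rw [Function.update_of_ne h1]
    by_cases h2 : c = cell j (s 0)
    · subst h2
      rw [place_fst, Function.update_self]
      simp
    rw [Function.update_of_ne h2]
    by_cases h3 : ∃ a, cell j (s a) = c
    · obtain ⟨a, rfl⟩ := h3
      rw [place_fst, place_fst]
      cases a using Fin.cases with
      | zero => exact absurd rfl h2
      | succ a => simp
    by_cases h4 : ∃ a, cell j' (s' a) = c
    · obtain ⟨a, rfl⟩ := h4
      rw [place_snd hj, place_snd hj]
      cases a using Fin.cases with
      | zero => exact absurd rfl h1
      | succ a => simp
    push Not at h3 h4
    rw [place_of_ne h3 h4, place_of_ne h3 h4]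
  · rintro _ ⟨v, c, c', hcc, rfl⟩
    obtain ⟨j, a, rfl⟩ := exists_cell c
    obtain ⟨j', a', rfl⟩ := exists_cell c'
    let e : ∀ {N : ℕ}, Fin N → (Fin 1 ↪o Fin N) := fun x =>
      OrderEmbedding.ofStrictMono (fun _ => x) (Subsingleton.strictMono _)
    refine ⟨v, j, j', 1, e a, e a', hcc, one_pos, ?_⟩
    refine Fintype.sum_bijective (fun i => e i) ⟨fun x y h => ?_, fun I => ⟨I 0, ?_⟩⟩ _ _
      fun i => ?_
    · exact congrArg (fun I : Fin 1 ↪o Fin n => I 0) h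
    · ext b
      rw [Subsingleton.elim b 0]
      rfl
    · congr 1
      ext1 c
      change _ = place v (e a) (e a') (fun _ => Pi.single i 1) c
      by_cases h1 : c = cell j' a'
      · subst h1
        rw [Function.update_self]
        exact (place_snd (v := v) (s := e a) (s' := e a') (u := fun _ => Pi.single i 1) hcc 0).symm
      rw [Function.update_of_ne h1]
      by_cases h2 : c = cell j a
      · subst h2
        rw [Function.update_self]
        exact (place_fst (v := v) (s := e a) (s' := e a') (u := fun _ => Pi.single i 1) 0).symm
      rw [Function.update_of_ne h2, place_of_ne (fun _ h => h2 h.symm) fun _ h => h1 h.symm]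

lemma traceSpan_le_schur : traceSpan n μ ≤ schur n μ := by
  rw [traceSpan_eq_span_contraction, Submodule.span_le]
  rintro _ ⟨v, c, c', -, rfl⟩
  exact Submodule.sum_mem _ fun i _ => tabVec_mem_schur _

lemma actLeft_mem_traceSpan {g : Matrix (Fin n) (Fin n) ℝ} (hg : g * gᵀ = 1)
    {f : Reg n (depth μ)} (hf : f ∈ traceSpan n μ) : actLeft g f ∈ traceSpan n μ := by
  rw [traceSpan_eq_span_contraction] at hf ⊢
  induction hf using Submodule.span_induction with
  | mem f hf =>
    obtain ⟨v, c, c', hcc, rfl⟩ := hf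
    rw [actLeft_contraction hg v fun h => hcc (by rw [h])]
    exact Submodule.subset_span ⟨_, c, c', hcc, rfl⟩
  | zero => rw [map_zero]; exact Submodule.zero_mem _
  | add f g _ _ hf hg => rw [map_add]; exact Submodule.add_mem _ hf hg
  | smul a f _ hf => rw [map_smul]; exact Submodule.smul_mem _ _ hf

lemma isHomogeneous_of_mem_schur {f : Reg n (depth μ)} (hf : f ∈ schur n μ) :
    f.IsHomogeneous μ.card :=
  (schur_le_semiInvariants hf).1

/-- The action of a matrix on a Schur module. -/
noncomputable def schurAct (g : Matrix (Fin n) (Fin n) ℝ) : schur n μ →ₗ[ℝ] schur n μ :=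
  (actLeft g).toLinearMap.restrict fun _ hf => actLeft_mem_schur g hf

@[simp]
lemma coe_schurAct (g : Matrix (Fin n) (Fin n) ℝ) (V : schur n μ) :
    (schurAct g V).1 = actLeft g V.1 := rfl

lemma schurAct_mem_harmonic {g : Matrix (Fin n) (Fin n) ℝ} (hg : gᵀ * g = 1) {V : schur n μ}
    (hV : V ∈ harmonic n μ) : schurAct g V ∈ harmonic n μ := by
  intro f hf
  rw [coe_schurAct, scalar_actLeft g (isHomogeneous_of_mem_schur V.2)
    (isHomogeneous_of_mem_schur (traceSpan_le_schur hf))]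
  exact hV _ (actLeft_mem_traceSpan (by rwa [transpose_transpose]) hf)

/-- The Schur module is the sum of its harmonic part and the trace space. -/
lemma exists_harmonic_add_trace (V : schur n μ) :
    ∃ H ∈ harmonic n μ, ∃ T ∈ traceSpan n μ, V.1 = H.1 + T := by
  have : FiniteDimensional ℝ (traceSpan n μ) :=
    Submodule.finiteDimensional_of_le traceSpan_le_schur
  obtain ⟨T, hT, ho⟩ := exists_scalar_orthogonal (traceSpan n μ) V.1
  exact ⟨⟨V.1 - T, Submodule.sub_mem _ V.2 (traceSpan_le_schur hT)⟩, ho, T, hT,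
    (sub_add_cancel _ _).symm⟩

end Traces

end Vexillar

namespace Vexillar

open Matrix MvPolynomial

/-! ### Harmonic vectors fixed by the orthogonal group -/

section FixedVectors

/-- Existence of a `QR` decomposition. -/
lemma exists_qr {n k : ℕ} (Z : Matrix (Fin n) (Fin k) ℝ) :
    ∃ (Q : Matrix (Fin n) (Fin n) ℝ) (b : Matrix (Fin k) (Fin k) ℝ),
      Q ∈ orthogonalGroup (Fin n) ℝ ∧ b.BlockTriangular id ∧ Z = Q * (rectId n k * b) := by
  let f : Fin n → EuclideanSpace ℝ (Fin n) := fun j =>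
    if h : (j : ℕ) < k then WithLp.toLp 2 (Z.col ⟨j, h⟩) else 0
  let B := InnerProductSpace.gramSchmidtOrthonormalBasis (𝕜 := ℝ) (by simp) f
  let Q : Matrix (Fin n) (Fin n) ℝ := Matrix.of fun i j => B j i
  have hQ : Qᵀ * Q = 1 := by
    ext a b
    have := orthonormal_iff_ite.1 B.orthonormal a b
    rw [Matrix.one_apply, ← this]
    simp [Matrix.mul_apply, PiLp.inner_apply, mul_comm, Q]
  let R := Qᵀ * Z
  let b : Matrix (Fin k) (Fin k) ℝ := Matrix.of fun a j =>
    if h : (a : ℕ) < n then R ⟨a, h⟩ j else 0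
  refine ⟨Q, b, (mem_orthogonalGroup_iff' _ _).2 hQ, ?_, ?_⟩
  · intro i j (hij : j < i)
    simp only [b, of_apply]
    split_ifs with h
    · have hj : (j : ℕ) < n := (Fin.lt_def.1 hij).trans h
      have := InnerProductSpace.gramSchmidtOrthonormalBasis_inv_triangular (𝕜 := ℝ)
        (by simp) f (i := ⟨j, hj⟩) (j := ⟨i, h⟩) hij
      rw [← this]
      simp [R, Q, B, mul_apply, PiLp.inner_apply, f, mul_comm]
    · rfl
  · have hR : rectId n k * b = R := by
      ext i j
      rw [mul_apply]
      by_cases hik : (i : ℕ) < k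
      · rw [Finset.sum_eq_single ⟨i, hik⟩]
        · simp [rectId, b]
        · intro a _ ha
          have : (i : ℕ) ≠ a := fun h => ha (Fin.ext h.symm)
          simp [rectId, this]
        · simp
      · have hj : (j : ℕ) < n := j.2.trans_le ((not_lt.1 hik).trans i.2.le)
        rw [Finset.sum_eq_zero]
        · have := InnerProductSpace.gramSchmidtOrthonormalBasis_inv_triangular (𝕜 := ℝ)
            (by simp) f (i := ⟨j, hj⟩) (j := i) (j.2.trans_le (not_lt.1 hik))
          rw [← this]
          simp [R, Q, B, mul_apply, PiLp.inner_apply, f, mul_comm]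
        · intro a _
          have : (i : ℕ) ≠ a := fun h => hik (h ▸ a.2)
          simp [rectId, this]
    rw [hR, ← Matrix.mul_assoc, mul_eq_one_comm.1 hQ, Matrix.one_mul]

lemma sum_comp_eq {A B C : Type*} [Fintype A] [Fintype B] [Fintype C] [DecidableEq A]
    [DecidableEq B] {e : A → B} (he : Function.Injective e) :
    ∃ K : ℕ, ∀ F : (A → C) → ℝ, ∑ J : B → C, F (J ∘ e) = K * ∑ I, F I := by
  classical
  refine ⟨Fintype.card ({b // ¬ b ∈ Set.range e} → C), fun F => ?_⟩
  let E := (Equiv.piEquivPiSubtypeProd (fun b => b ∈ Set.range e) fun _ => C).trans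
    ((Equiv.arrowCongr (Equiv.ofInjective e he).symm (Equiv.refl C)).prodCongr (Equiv.refl _))
  have hE : ∀ J, J ∘ e = (E J).1 := fun J => by
    ext a
    simp [E, Equiv.piEquivPiSubtypeProd]
  simp only [hE]
  rw [E.sum_comp (fun q => F q.1), Fintype.sum_prod_type]
  simp [Finset.mul_sum]

lemma sum_det_sq {n r : ℕ} (M : Matrix (Fin n) (Fin r) ℝ) :
    ∑ I : Fin r → Fin n, (M.submatrix I id).det ^ 2 = r.factorial * (Mᵀ * M).det := by
  have h1 : (Mᵀ * M).det = ∑ I : Fin r → Fin n, (∏ a, M (I a) a) * (M.submatrix I id).det := by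
    rw [det_apply]
    simp only [mul_apply, transpose_apply, Finset.prod_univ_sum, Fintype.piFinset_univ,
      Finset.smul_sum]
    rw [Finset.sum_comm]
    refine Finset.sum_congr rfl fun I _ => ?_
    rw [← det_transpose, det_apply, Finset.mul_sum]
    refine Finset.sum_congr rfl fun s _ => ?_
    rw [mul_smul_comm, Finset.prod_mul_distrib, mul_comm]
    rfl
  have h2 : ∀ s : Equiv.Perm (Fin r), ∑ I : Fin r → Fin n,
      ((Equiv.Perm.sign s : ℤ) : ℝ) * (∏ a, M (I a) (s a)) * (M.submatrix I id).det =
        (Mᵀ * M).det := by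
    intro s
    rw [h1, ← (Equiv.arrowCongr s.symm (Equiv.refl (Fin n))).sum_comp]
    refine Finset.sum_congr rfl fun I _ => ?_
    have h3 : M.submatrix (Equiv.arrowCongr s.symm (Equiv.refl (Fin n)) I) id =
        (M.submatrix I id).submatrix s id := rfl
    have h4 : ∏ a, M (Equiv.arrowCongr s.symm (Equiv.refl (Fin n)) I a) (s a) =
        ∏ a, M (I a) a := Equiv.prod_comp s fun a => M (I a) a
    have h5 : ((Equiv.Perm.sign s : ℤ) : ℝ) * ((Equiv.Perm.sign s : ℤ) : ℝ) = 1 := by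
      rw [← Int.cast_mul, ← Units.val_mul, Int.units_mul_self]
      simp
    rw [h3, h4, det_permute]
    linear_combination (∏ a, M (I a) a) * (M.submatrix I id).det * h5
  have h6 : ∑ s : Equiv.Perm (Fin r), (Mᵀ * M).det = r.factorial * (Mᵀ * M).det := by
    simp [Fintype.card_perm]
  rw [← h6, ← Finset.sum_congr rfl fun s _ => h2 s, Finset.sum_comm]
  refine Finset.sum_congr rfl fun I _ => ?_
  rw [← Finset.sum_mul, sq]
  congr 1
  rw [← det_transpose, det_apply]
  refine Finset.sum_congr rfl fun s _ => ?_
  rw [Units.smul_def, zsmul_eq_mul]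
  rfl

/-- The minor of `Z` formed by the first `r` columns and the rows `J 0, …, J (r - 1)`. -/
noncomputable def minorAt {n k r : ℕ} (hr : r ≤ k) (Z : Matrix (Fin n) (Fin k) ℝ)
    (J : Fin k → Fin n) : ℝ :=
  (Z.submatrix (J ∘ Fin.castLE hr) (Fin.castLE hr)).det

lemma sum_minorAt_sq_orthogonal {n k r : ℕ} (hr : r ≤ k) {Q : Matrix (Fin n) (Fin n) ℝ}
    (hQ : Qᵀ * Q = 1) (Z : Matrix (Fin n) (Fin k) ℝ) :
    ∑ J, minorAt hr (Q * Z) J ^ 2 = ∑ J, minorAt hr Z J ^ 2 := by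
  obtain ⟨K, hK⟩ := sum_comp_eq (C := Fin n) (Fin.castLE_injective hr)
  have h : ∀ Z : Matrix (Fin n) (Fin k) ℝ, ∑ J, minorAt hr Z J ^ 2 =
      K * (r.factorial * ((Zᵀ * Z).submatrix (Fin.castLE hr) (Fin.castLE hr)).det) := by
    intro Z
    have := hK fun I => (Z.submatrix I (Fin.castLE hr)).det ^ 2
    rw [show ∑ J, minorAt hr Z J ^ 2 = _ from this]
    congr 1
    exact sum_det_sq (Z.submatrix id (Fin.castLE hr))
  have h' : (Q * Z)ᵀ * (Q * Z) = Zᵀ * Z := by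
    rw [transpose_mul, Matrix.mul_assoc, ← Matrix.mul_assoc Qᵀ, hQ, Matrix.one_mul]
  rw [h, h, h']

lemma sum_minorAt_sq_rectId_pos {n k r : ℕ} (hr : r ≤ k) (hk : k ≤ n) :
    0 < ∑ J, minorAt hr (rectId n k) J ^ 2 := by
  refine Finset.sum_pos' (fun _ _ => sq_nonneg _) ⟨Fin.castLE hk, Finset.mem_univ _, ?_⟩
  have : (rectId n k).submatrix (Fin.castLE hk ∘ Fin.castLE hr) (Fin.castLE hr) = 1 := by
    ext a b
    simp [rectId, Matrix.one_apply, Fin.ext_iff]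
  rw [minorAt, this, det_one]
  norm_num

lemma minorAt_congr {n k r r' : ℕ} (hr : r ≤ k) (hr' : r' ≤ k) (h : r = r')
    (Z : Matrix (Fin n) (Fin k) ℝ) (J : Fin k → Fin n) : minorAt hr Z J = minorAt hr' Z J := by
  subst h
  rfl

variable {μ : YoungDiagram} {n : ℕ}

lemma chi_diagonal_eq_prod_cells (δ : ℕ → ℝ) :
    chi μ (diagonal fun a : Fin (depth μ) => δ a) = ∏ c ∈ μ.cells, δ c.1 := by
  rw [chi_diagonal]
  refine Eq.trans ?_ (Finset.prod_coe_sort μ.cells fun c => δ c.1)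
  rw [← (cellEquiv μ).prod_comp, Fintype.prod_sigma]
  rfl

/-- Semi-invariants fixed by the orthogonal group are determined by their value at `rectId`. -/
lemma eq_zero_of_fixed {f : Reg n (depth μ)} (hf : f ∈ semiInvariants n μ)
    (hfix : ∀ Q ∈ orthogonalGroup (Fin n) ℝ, ∀ Z, ev (Q * Z) f = ev Z f)
    (h0 : ev (rectId n _) f = 0) : f = 0 := by
  refine ev_injective fun Z => ?_
  obtain ⟨Q, b, hQ, hb, rfl⟩ := exists_qr Z
  rw [hfix Q hQ, hf.2 b hb, h0, mul_zero, map_zero]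

lemma even_rowLen_of_fixed {f : Reg n (depth μ)} (hf : f ∈ semiInvariants n μ)
    (hfix : ∀ Q ∈ orthogonalGroup (Fin n) ℝ, ∀ Z, ev (Q * Z) f = ev Z f)
    (h0 : ev (rectId n _) f ≠ 0) (a : ℕ) : Even (μ.rowLen a) := by
  let δ : ℕ → ℝ := fun i => if i = a then -1 else 1
  let S : Matrix (Fin n) (Fin n) ℝ := diagonal fun i => δ i
  have hS : S ∈ orthogonalGroup (Fin n) ℝ := by
    rw [mem_orthogonalGroup_iff]
    rw [diagonal_transpose, diagonal_mul_diagonal, ← diagonal_one]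
    congr 1
    ext i
    simp only [δ]
    split_ifs <;> norm_num
  have hSE : S * rectId n (depth μ) = rectId n (depth μ) * diagonal fun a : Fin (depth μ) => δ a := by
    ext i j
    rw [rectId_mul_diagonal_apply, diagonal_mul, rectId, of_apply]
    split_ifs with h
    · rw [h, mul_one]
    · rw [mul_zero]
  have h1 := hfix S hS (rectId n _)
  rw [hSE, hf.2 _ (blockTriangular_diagonal _), chi_diagonal_eq_prod_cells] at h1
  have h2 := mul_right_cancel₀ h0 (h1.trans (one_mul _).symm)
  simp only [δ] at h2
  rw [Finset.prod_ite, Finset.prod_const_one, mul_one, Finset.prod_const] at h2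
  rw [YoungDiagram.rowLen_eq_card]
  exact (neg_one_pow_eq_one_iff_even (by norm_num)).1 h2

/-- The index shared by the two cells in the same row of columns `2i` and `2i + 1`. -/
def pairIndex {q : ℕ} (hq : μ.rowLen 0 = 2 * q) (c : μ.cells) : Fin q × Fin (depth μ) :=
  (⟨c.1.2 / 2, by
    have h : c.1.2 < μ.rowLen 0 :=
      col_lt_rowLen ⟨_, YoungDiagram.mem_iff_lt_colLen.1 ((YoungDiagram.mem_cells _).1 c.2)⟩
    omega⟩, ⟨c.1.1, cell_row_lt c⟩)

/-- The total contraction of all pairs of columns `2i`, `2i + 1`. -/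
noncomputable def totalContraction (n : ℕ) {q : ℕ} (hq : μ.rowLen 0 = 2 * q) : Reg n (depth μ) :=
  ∑ I : Fin q × Fin (depth μ) → Fin n, tabVec fun c : μ.cells => Pi.single (I (pairIndex hq c)) 1

lemma prod_fin_two_mul {N q : ℕ} (hN : N = 2 * q) (g : ℕ → ℝ) :
    ∏ j : Fin N, g j = ∏ i : Fin q, g (2 * i) * g (2 * i + 1) := by
  subst hN
  rw [← Finset.prod_range, ← Finset.prod_range fun i => g (2 * i) * g (2 * i + 1)]
  induction q with
  | zero => simp
  | succ q ih =>
    rw [Finset.prod_range_succ, ← ih, show 2 * (q + 1) = 2 * q + 1 + 1 by ring,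
      Finset.prod_range_succ, Finset.prod_range_succ, mul_assoc]

lemma colLen_succ_of_even (h : ∀ a, Even (μ.rowLen a)) (i : ℕ) :
    μ.colLen (2 * i + 1) = μ.colLen (2 * i) := by
  have key : ∀ a, a < μ.colLen (2 * i + 1) ↔ a < μ.colLen (2 * i) := by
    intro a
    rw [← YoungDiagram.mem_iff_lt_colLen, ← YoungDiagram.mem_iff_lt_colLen,
      YoungDiagram.mem_iff_lt_rowLen, YoungDiagram.mem_iff_lt_rowLen]
    obtain ⟨x, hx⟩ := h a
    omega
  exact le_antisymm (le_of_forall_lt fun a ha => (key a).1 ha)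
    (le_of_forall_lt fun a ha => (key a).2 ha)

lemma ev_totalContraction {q : ℕ} (hq : μ.rowLen 0 = 2 * q) (h : ∀ a, Even (μ.rowLen a))
    (Z : Matrix (Fin n) (Fin (depth μ)) ℝ) :
    ev Z (totalContraction n hq) = ∏ i : Fin q,
      ∑ J, minorAt (μ.colLen_anti _ _ (Nat.zero_le (2 * (i : ℕ)))) Z J ^ 2 := by
  rw [Finset.prod_univ_sum, Fintype.piFinset_univ, totalContraction, map_sum,
    ← (Equiv.curry (Fin q) (Fin (depth μ)) (Fin n)).sum_comp]
  refine Finset.sum_congr rfl fun I _ => ?_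
  let g : ℕ → ℝ := fun j => if hj : j / 2 < q then
    minorAt (μ.colLen_anti _ _ (Nat.zero_le j)) Z (Function.curry I ⟨j / 2, hj⟩) else 1
  have hg : ev Z (tabVec fun c : μ.cells => Pi.single (I (pairIndex hq c)) 1) =
      ∏ j : Fin (μ.rowLen 0), g j := by
    rw [ev_tabVec]
    refine Finset.prod_congr rfl fun j _ => ?_
    have hj : (j : ℕ) / 2 < q := by omega
    simp only [g, dif_pos hj, minorAt]
    congr 1
    ext a b
    simp [Pi.single_apply, pairIndex, cell, Function.curry]
    rfl
  rw [hg, prod_fin_two_mul hq]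
  refine Finset.prod_congr rfl fun i _ => ?_
  have h1 : 2 * (i : ℕ) / 2 = i := by omega
  have h2 : (2 * (i : ℕ) + 1) / 2 = i := by omega
  simp only [g, h1, h2, i.2, dif_pos, sq, Equiv.curry_apply]
  congr 1
  exact minorAt_congr _ _ (colLen_succ_of_even h i) _ _

lemma totalContraction_mem_traceSpan {q : ℕ} (hq : μ.rowLen 0 = 2 * q) (h0 : 0 < q) :
    totalContraction n hq ∈ traceSpan n μ := by
  have hmem : ((0, 1) : ℕ × ℕ) ∈ μ := by
    rw [YoungDiagram.mem_iff_lt_rowLen]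
    omega
  have hmem' : ((0, 0) : ℕ × ℕ) ∈ μ := μ.up_left_mem le_rfl (Nat.zero_le _) hmem
  let c : μ.cells := ⟨(0, 0), hmem'⟩
  let c' : μ.cells := ⟨(0, 1), hmem⟩
  let i₀ := pairIndex hq c
  have hi₀ : ∀ d : μ.cells, pairIndex hq d = i₀ ↔ d = c ∨ d = c' := by
    rintro ⟨⟨a, j⟩, hd⟩
    simp only [pairIndex, i₀, c, c', Prod.mk.injEq, Fin.mk.injEq, Subtype.mk.injEq]
    omega
  have hc := (hi₀ c).2 (Or.inl rfl)
  have hc' := (hi₀ c').2 (Or.inr rfl)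
  rw [traceSpan_eq_span_contraction, totalContraction,
    ← (Equiv.funSplitAt i₀ (Fin n)).symm.sum_comp, Fintype.sum_prod_type_right]
  refine Submodule.sum_mem _ fun I _ => Submodule.subset_span
    ⟨fun d => if hd : pairIndex hq d = i₀ then 0 else Pi.single (I ⟨pairIndex hq d, hd⟩) 1,
      c, c', Nat.zero_ne_one, ?_⟩
  refine Finset.sum_congr rfl fun x _ => ?_
  congr 1
  ext1 d
  by_cases h1 : d = c'
  · subst h1
    rw [Function.update_self]
    simp [hc']
  rw [Function.update_of_ne h1]
  by_cases h2 : d = c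
  · subst h2
    rw [Function.update_self]
    simp [hc]
  rw [Function.update_of_ne h2]
  have h3 : pairIndex hq d ≠ i₀ := fun h => ((hi₀ d).1 h).elim h2 h1
  simp [h3]

/-- A non-trivial harmonic Schur module has no vectors fixed by the orthogonal group. -/
theorem eq_zero_of_mem_harmonic_of_fixed (hμ : 0 < μ.card) {V : schur n μ}
    (hV : V ∈ harmonic n μ) (hfix : ∀ Q ∈ orthogonalGroup (Fin n) ℝ, schurAct Q V = V) :
    V = 0 := by
  have hS := schur_le_semiInvariants V.2
  have hfix' : ∀ Q ∈ orthogonalGroup (Fin n) ℝ, ∀ Z, ev (Q * Z) V.1 = ev Z V.1 := by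
    intro Q hQ Z
    have hQt : Qᵀ ∈ orthogonalGroup (Fin n) ℝ := by
      rw [mem_orthogonalGroup_iff] at *
      rw [transpose_transpose]
      exact mul_eq_one_comm.1 hQ
    conv_rhs => rw [← hfix _ hQt]
    rw [coe_schurAct, ev_actLeft, transpose_transpose]
  by_cases h0 : ev (rectId n _) V.1 = 0
  · exact Subtype.ext (eq_zero_of_fixed hS hfix' h0)
  have heven := even_rowLen_of_fixed hS hfix' h0
  have hdepth : depth μ ≤ n := not_lt.1 fun h => h0 (ev_rectId_eq_zero hS h)
  obtain ⟨q, hq⟩ := heven 0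
  rw [← two_mul] at hq
  have hq0 : 0 < q := by
    obtain ⟨c, hc⟩ := Finset.card_pos.1 hμ
    have : c.2 < μ.rowLen 0 :=
      col_lt_rowLen ⟨_, YoungDiagram.mem_iff_lt_colLen.1 ((YoungDiagram.mem_cells _).1 hc)⟩
    omega
  have hT := totalContraction_mem_traceSpan (n := n) hq hq0
  set T := totalContraction n hq with hTdef
  have hT0 : ev (rectId n _) T ≠ 0 := by
    rw [hTdef, ev_totalContraction hq heven]
    exact Finset.prod_ne_zero_iff.2 fun i _ => (sum_minorAt_sq_rectId_pos _ hdepth).ne'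
  have hTfix : ∀ Q ∈ orthogonalGroup (Fin n) ℝ, ∀ Z, ev (Q * Z) T = ev Z T := by
    intro Q hQ Z
    rw [hTdef, ev_totalContraction hq heven, ev_totalContraction hq heven]
    exact Finset.prod_congr rfl fun i _ =>
      sum_minorAt_sq_orthogonal _ ((mem_orthogonalGroup_iff' _ _).1 hQ) Z
  have hVT : V.1 - (ev (rectId n _) V.1 / ev (rectId n _) T) • T = 0 := by
    refine eq_zero_of_fixed (Submodule.sub_mem _ hS (Submodule.smul_mem _ _
      (schur_le_semiInvariants (traceSpan_le_schur hT)))) (fun Q hQ Z => ?_) ?_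
    · rw [map_sub, map_sub, ev_smul, ev_smul, hfix' Q hQ, hTfix Q hQ]
    · rw [map_sub, ev_smul, div_mul_cancel₀ _ hT0, sub_self]
  have hmem : V.1 ∈ traceSpan n μ := by
    rw [sub_eq_zero.1 hVT]
    exact Submodule.smul_mem _ _ hT
  exact Subtype.ext (eq_zero_of_scalar_self _ (hV _ hmem))

end FixedVectors

end Vexillar

namespace Vexillar

open Matrix MvPolynomial

/-! ### Equivariance of `phi` -/

section Phi

variable {μ : YoungDiagram} {n m : ℕ}

lemma schur_ext {p : ℕ} {V : Type*} [AddCommGroup V] [Module ℝ V] {F G : schur p μ →ₗ[ℝ] V}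
    (h : ∀ A, F ⟨flagVec μ A, flagVec_mem p μ A⟩ = G ⟨flagVec μ A, flagVec_mem p μ A⟩) : F = G := by
  have key : ∀ f (hf : f ∈ schur p μ), F ⟨f, hf⟩ = G ⟨f, hf⟩ := by
    intro f hf
    have hf' := hf
    rw [schur_eq_span] at hf'
    induction hf' using Submodule.span_induction with
    | mem f hA => obtain ⟨A, rfl⟩ := hA; exact h A
    | zero => exact (map_zero F).trans (map_zero G).symm
    | add f g hf' hg' ihf ihg =>
      rw [← schur_eq_span] at hf' hg'
      have h1 := map_add F ⟨f, hf'⟩ ⟨g, hg'⟩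
      have h2 := map_add G ⟨f, hf'⟩ ⟨g, hg'⟩
      rw [ihf hf', ihg hg', ← h2] at h1
      exact h1
    | smul a f hf' ihf =>
      rw [← schur_eq_span] at hf'
      have h1 := map_smul F a ⟨f, hf'⟩
      have h2 := map_smul G a ⟨f, hf'⟩
      rw [ihf hf', ← h2] at h1
      exact h1
  exact LinearMap.ext fun f => key f.1 f.2

lemma rightSub_phi (h : Matrix (Fin m) (Fin m) ℝ) (V : schur n μ) (Ξ : schur m μ) :
    rightSub h (phi n m μ V Ξ) = phi n m μ V (schurAct h Ξ) := by
  have : (rightSub h).toLinearMap ∘ₗ phi n m μ V = phi n m μ V ∘ₗ schurAct h := by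
    refine schur_ext fun B => ?_
    have h1 : schurAct h ⟨flagVec μ B, flagVec_mem m μ B⟩ =
        ⟨flagVec μ (h * B), flagVec_mem m μ _⟩ := Subtype.ext (actLeft_flagVec h B)
    simp only [LinearMap.comp_apply, h1, phi_flagVec, AlgHom.toLinearMap_apply, rightSub_rightSub]
  exact LinearMap.congr_fun this Ξ

lemma actLeft_phi (g : Matrix (Fin n) (Fin n) ℝ) (V : schur n μ) (Ξ : schur m μ) :
    actLeft g (phi n m μ V Ξ) = phi n m μ (schurAct g V) Ξ := by
  have : (actLeft g).toLinearMap ∘ₗ phi n m μ V = phi n m μ (schurAct g V) := by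
    refine schur_ext fun B => ?_
    simp only [LinearMap.comp_apply, phi_flagVec, AlgHom.toLinearMap_apply, actLeft_rightSub,
      coe_schurAct]
  exact LinearMap.congr_fun this Ξ

lemma phi_isHomogeneous (V : schur n μ) (Ξ : schur m μ) :
    (phi n m μ V Ξ).IsHomogeneous μ.card := by
  let Q := homogeneousSubmodule (Fin n × Fin m) ℝ μ.card
  have : Q.mkQ ∘ₗ phi n m μ V = 0 := by
    refine schur_ext fun B => ?_
    rw [LinearMap.comp_apply, phi_flagVec, Submodule.mkQ_apply, LinearMap.zero_apply,
      Submodule.Quotient.mk_eq_zero]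
    exact rightSub_isHomogeneous B (isHomogeneous_of_mem_schur V.2)
  have h := LinearMap.congr_fun this Ξ
  rw [LinearMap.comp_apply, Submodule.mkQ_apply, LinearMap.zero_apply,
    Submodule.Quotient.mk_eq_zero] at h
  exact h

end Phi

/-! ### Polynomial functions on the Stiefel manifold -/

section Stiefel

/-- Polynomials vanishing at all matrices with orthonormal columns. -/
def stiefelIdeal (n m : ℕ) : Submodule ℝ (Reg n m) where
  carrier := {f | ∀ x : Matrix (Fin n) (Fin m) ℝ, xᵀ * x = 1 → ev x f = 0}
  add_mem' hf hg x hx := by rw [map_add, hf x hx, hg x hx, add_zero]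
  zero_mem' x _ := map_zero _
  smul_mem' c f hf x hx := by rw [ev_smul, hf x hx, mul_zero]

/-- The span of the images of the harmonic Schur modules of degree at most `t`. -/
noncomputable def harmonicSpan (n m t : ℕ) : Submodule ℝ (Reg n m) :=
  Submodule.span ℝ {f | ∃ (μ : YoungDiagram) (H : schur n μ) (Ξ : schur m μ),
    μ.card ≤ t ∧ H ∈ harmonic n μ ∧ f = phi n m μ H Ξ}

lemma harmonicSpan_mono (n m : ℕ) : Monotone (harmonicSpan n m) := fun _ _ hst =>
  Submodule.span_mono fun _ ⟨μ, H, Ξ, hμ, hH, hf⟩ => ⟨μ, H, Ξ, hμ.trans hst, hH, hf⟩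

variable {μ : YoungDiagram} {n m : ℕ}

lemma ev_contraction (v : μ.cells → Fin n → ℝ) {c c' : μ.cells} (h : c ≠ c')
    (Z : Matrix (Fin n) (Fin (depth μ)) ℝ) :
    ev Z (contraction v c c') = ∑ s : ∀ j : Fin (μ.rowLen 0), Equiv.Perm (Fin (μ.colLen j)),
      (∏ j, ((Equiv.Perm.sign (s j) : ℤ) : ℝ)) * ((Zᵀ * Z) (colIndex s c) (colIndex s c') *
        ∏ d ∈ (Finset.univ.erase c).erase c', ev Z (rowForm (colIndex s d) (v d))) := by
  simp only [contraction, map_sum, tabVec_eq_tabMulti, tabMulti_apply, ev_smul]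
  rw [Finset.sum_comm]
  refine Finset.sum_congr rfl fun s _ => ?_
  rw [← Finset.mul_sum, mul_apply, Finset.sum_mul]
  congr 1
  refine Finset.sum_congr rfl fun i _ => ?_
  rw [map_prod, ← Finset.mul_prod_erase _ _ (Finset.mem_univ c),
    ← Finset.mul_prod_erase _ _ (Finset.mem_erase.2 ⟨h.symm, Finset.mem_univ c'⟩),
    Function.update_of_ne h, Function.update_self, Function.update_self, ← mul_assoc]
  congr 1
  · simp [ev_rowForm, Pi.single_apply]
  · refine Finset.prod_congr rfl fun d hd => ?_
    rw [Finset.mem_erase, Finset.mem_erase] at hd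
    rw [Function.update_of_ne hd.1, Function.update_of_ne hd.2.1]

/-- On matrices with orthonormal columns, traces lower the degree. -/
lemma rightSub_traceSpan {T : Reg n (depth μ)} (hT : T ∈ traceSpan n μ)
    (B : Matrix (Fin m) (Fin (depth μ)) ℝ) :
    rightSub B T ∈ restrictTotalDegree (Fin n × Fin m) ℝ (μ.card - 1) ⊔ stiefelIdeal n m := by
  suffices h : traceSpan n μ ≤ (restrictTotalDegree (Fin n × Fin m) ℝ (μ.card - 1) ⊔
      stiefelIdeal n m).comap (rightSub (n := n) B).toLinearMap from h hT
  rw [traceSpan_eq_span_contraction, Submodule.span_le]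
  rintro _ ⟨v, c, c', hcc, rfl⟩
  have hne : c ≠ c' := fun h => hcc (by rw [h])
  let g : Reg n m := ∑ s : ∀ j : Fin (μ.rowLen 0), Equiv.Perm (Fin (μ.colLen j)),
    ((∏ j, ((Equiv.Perm.sign (s j) : ℤ) : ℝ)) * (Bᵀ * B) (colIndex s c) (colIndex s c')) •
      ∏ d ∈ (Finset.univ.erase c).erase c', rightSub B (rowForm (colIndex s d) (v d))
  refine Submodule.mem_sup.2 ⟨g, ?_, rightSub B (contraction v c c') - g, ?_, by simp⟩
  · refine Submodule.sum_mem _ fun s _ => Submodule.smul_mem _ _ ?_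
    rw [mem_restrictTotalDegree]
    refine (totalDegree_finsetProd _ _).trans ((Finset.sum_le_card_nsmul _ _ 1 fun d _ =>
      (rightSub_isHomogeneous B (rowForm_isHomogeneous _ _)).totalDegree_le).trans ?_)
    rw [Finset.card_erase_of_mem (Finset.mem_erase.2 ⟨hne.symm, Finset.mem_univ _⟩),
      Finset.card_erase_of_mem (Finset.mem_univ _), Finset.card_univ, Fintype.card_coe,
      smul_eq_mul, mul_one]
    exact Nat.sub_le _ _
  · intro x hx
    have hxB : (x * B)ᵀ * (x * B) = Bᵀ * B := by
      rw [transpose_mul, Matrix.mul_assoc, ← Matrix.mul_assoc xᵀ, hx, Matrix.one_mul]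
    rw [map_sub, ev_rightSub, ev_contraction v hne, hxB, map_sum, sub_eq_zero]
    refine Finset.sum_congr rfl fun s _ => ?_
    rw [ev_smul, map_prod, mul_assoc]
    simp only [ev_rightSub]

lemma traceSpan_eq_bot (h : μ.card = 0) : traceSpan n μ = ⊥ := by
  rw [traceSpan_eq_span_contraction, Submodule.span_eq_bot]
  rintro _ ⟨v, c, -⟩
  exact absurd (Finset.card_pos.2 ⟨c.1, c.2⟩) (Nat.not_lt.2 h.le)

/-- On matrices with orthonormal columns, every polynomial is a combination of images of harmonic
Schur modules. -/
theorem restrictTotalDegree_le_harmonicSpan (n m t : ℕ) :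
    restrictTotalDegree (Fin n × Fin m) ℝ t ≤ harmonicSpan n m t ⊔ stiefelIdeal n m := by
  induction t using Nat.strong_induction_on with
  | _ t ih =>
    intro f hf
    rw [mem_restrictTotalDegree] at hf
    rw [← sum_homogeneousComponent f]
    refine Submodule.sum_mem _ fun k hk => ?_
    have hkt : k ≤ t := (Nat.lt_succ_iff.1 (Finset.mem_range.1 hk)).trans hf
    have h1 := homogeneousSubmodule_le_biSpan (n := n) (m := m) k
      (homogeneousComponent_isHomogeneous k f)
    refine (?_ : biSpan n m k ≤ _) h1
    rw [biSpan, Submodule.span_le]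
    rintro _ ⟨μ, A, B, rfl, rfl⟩
    obtain ⟨H, hH, T, hT, hV⟩ := exists_harmonic_add_trace ⟨flagVec μ A, flagVec_mem n μ A⟩
    have h2 : biVec μ A B = phi n m μ H ⟨flagVec μ B, flagVec_mem m μ B⟩ + rightSub B T := by
      rw [phi_flagVec, ← map_add, ← hV, biVec]
    rw [h2]
    refine Submodule.add_mem _ (Submodule.mem_sup_left (Submodule.subset_span
      ⟨μ, H, _, hkt, hH, rfl⟩)) ?_
    rcases Nat.eq_zero_or_pos μ.card with h0 | h0
    · rw [traceSpan_eq_bot h0, Submodule.mem_bot] at hT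
      rw [hT, map_zero]
      exact Submodule.zero_mem _
    · have h3 := ih (μ.card - 1) (by omega)
      exact (sup_le (h3.trans (sup_le_sup_right (harmonicSpan_mono n m (by omega)) _))
        le_sup_right) (rightSub_traceSpan hT B)

end Stiefel

end Vexillar

namespace Vexillar

open Matrix MvPolynomial

/-! ### Matrices representing a flag -/

section Flags

variable {n : ℕ} {d : FlagShape n}

lemma Flag.represents_matrix (Δ : Flag d) : Represents Δ.matrix Δ := (exists_represents Δ).choose_spec

lemma Represents.exists_mulVec {X : Matrix (Fin n) (Fin d.m) ℝ} {Δ : Flag d} (hX : Represents X Δ)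
    {i : Fin (d.len + 1)} {v : Fin n → ℝ} (hv : v ∈ Δ.V i) :
    ∃ c : Fin d.m → ℝ, (∀ k : Fin d.m, ¬ (k : ℕ) < d.dim i → c k = 0) ∧ v = X *ᵥ c := by
  rw [← hX.2 i] at hv
  induction hv using Submodule.span_induction with
  | mem v hv =>
    obtain ⟨j, hj, rfl⟩ := hv
    refine ⟨Pi.single j 1, fun k hk => Pi.single_eq_of_ne (by rintro rfl; exact hk hj) _, ?_⟩
    simp
  | zero => exact ⟨0, fun _ _ => rfl, by simp⟩
  | add v w _ _ hv hw =>
    obtain ⟨c, hc, rfl⟩ := hv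
    obtain ⟨c', hc', rfl⟩ := hw
    exact ⟨c + c', fun k hk => by simp [hc k hk, hc' k hk], by rw [mulVec_add]⟩
  | smul a v _ hv =>
    obtain ⟨c, hc, rfl⟩ := hv
    exact ⟨a • c, fun k hk => by simp [hc k hk], by rw [mulVec_smul]⟩

lemma Represents.col_mem {X : Matrix (Fin n) (Fin d.m) ℝ} {Δ : Flag d} (hX : Represents X Δ)
    {i : Fin (d.len + 1)} {j : Fin d.m} (hj : (j : ℕ) < d.dim i) : X.col j ∈ Δ.V i := by
  rw [← hX.2 i]
  exact Submodule.subset_span ⟨j, hj, rfl⟩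

lemma Represents.transpose_mul_apply_eq_zero {X X' : Matrix (Fin n) (Fin d.m) ℝ} {Δ : Flag d}
    (hX : Represents X Δ) (hX' : Represents X' Δ) {i : Fin (d.len + 1)} {k j : Fin d.m}
    (hj : (j : ℕ) < d.dim i) (hk : ¬ (k : ℕ) < d.dim i) : (Xᵀ * X') k j = 0 := by
  obtain ⟨c, hc, hcX⟩ := hX.exists_mulVec (hX'.col_mem hj)
  have h : (Xᵀ * X').col j = c := by
    rw [← one_mulVec c, ← hX.1, ← mulVec_mulVec, ← hcX]
    rfl
  rw [← hc k hk, ← h]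
  rfl

lemma Represents.exists_blockOrthogonal {X X' : Matrix (Fin n) (Fin d.m) ℝ} {Δ : Flag d}
    (hX : Represents X Δ) (hX' : Represents X' Δ) :
    ∃ h, IsBlockOrthogonal d h ∧ X' = X * h := by
  have hmul : X' = X * (Xᵀ * X') := by
    ext a j
    obtain ⟨c, -, hcX⟩ := hX.exists_mulVec (hX'.col_mem (i := 0) (j := j) j.2)
    have h : (Xᵀ * X').col j = c := by
      rw [← one_mulVec c, ← hX.1, ← mulVec_mulVec, ← hcX]
      rfl
    calc X' a j = (X *ᵥ (Xᵀ * X').col j) a := by rw [h, ← hcX]; rfl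
      _ = _ := rfl
  refine ⟨Xᵀ * X', ⟨?_, fun a b hab i => ⟨fun ha => ?_, fun hb => ?_⟩⟩, hmul⟩
  · rw [mem_orthogonalGroup_iff']
    conv_lhs => rw [transpose_mul, transpose_transpose, Matrix.mul_assoc, ← hmul]
    exact hX'.1
  · by_contra hb
    refine hab ?_
    have := hX'.transpose_mul_apply_eq_zero hX ha hb
    rwa [← transpose_apply (X'ᵀ * X), transpose_mul, transpose_transpose] at this
  · by_contra ha
    exact hab (hX.transpose_mul_apply_eq_zero hX' hb ha)

lemma evalFlag_eq_ev {f : Reg n d.m} (hf : RightInvariant d f) {X : Matrix (Fin n) (Fin d.m) ℝ}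
    {Δ : Flag d} (hX : Represents X Δ) : evalFlag f Δ = ev X f := by
  obtain ⟨h, hh, hXh⟩ := hX.exists_blockOrthogonal Δ.represents_matrix
  change ev Δ.matrix f = _
  rw [hXh, ← ev_rightSub, hf h hh]

lemma represents_flagOf (g : orthogonalGroup (Fin n) ℝ) :
    Represents (g.1 * rectId n d.m) (flagOf d g) := by
  have hcol : ∀ j : Fin d.m, (g.1 * rectId n d.m).col j = g.1.col (Fin.castLE (d.lt 0).le j) := by
    intro j
    ext a
    rw [col_apply, mul_apply, Finset.sum_eq_single (Fin.castLE (d.lt 0).le j)]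
    · simp [rectId]
    · intro b _ hb
      have : (b : ℕ) ≠ j := fun h => hb (Fin.ext h)
      simp [rectId, this]
    · simp
  constructor
  · ext a b
    rw [mul_apply]
    have h := congrFun₂ ((mem_orthogonalGroup_iff' _ _).1 g.2) (Fin.castLE (d.lt 0).le a)
      (Fin.castLE (d.lt 0).le b)
    rw [mul_apply] at h
    have h1 : ∀ x j, (g.1 * rectId n d.m) x j = g.1 x (Fin.castLE (d.lt 0).le j) :=
      fun x j => congrFun (hcol j) x
    simp only [transpose_apply, h1] at h ⊢
    rw [h, one_apply, one_apply]
    simp [Fin.ext_iff]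
  · intro i
    refine congrArg (Submodule.span ℝ) (Set.ext fun v => ⟨?_, ?_⟩)
    · rintro ⟨j, hj, rfl⟩
      exact ⟨_, hj, hcol j⟩
    · rintro ⟨j, hj, rfl⟩
      exact ⟨⟨j, hj.trans_le (d.dim_le i)⟩, hj, (hcol ⟨j, hj.trans_le (d.dim_le i)⟩).symm⟩

lemma Represents.act {X : Matrix (Fin n) (Fin d.m) ℝ} {Δ : Flag d} (hX : Represents X Δ)
    (τ : orthogonalGroup (Fin n) ℝ) : Represents (τ.1 * X) (Δ.act τ) := by
  constructor
  · rw [transpose_mul, Matrix.mul_assoc, ← Matrix.mul_assoc τ.1ᵀ,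
      (mem_orthogonalGroup_iff' _ _).1 τ.2, Matrix.one_mul, hX.1]
  · intro i
    change _ = (Δ.V i).map _
    rw [← hX.2 i, Submodule.map_span]
    refine congrArg (Submodule.span ℝ) (Set.ext fun v => ⟨?_, ?_⟩)
    · rintro ⟨j, hj, rfl⟩
      exact ⟨_, ⟨j, hj, rfl⟩, rfl⟩
    · rintro ⟨_, ⟨j, hj, rfl⟩, rfl⟩
      exact ⟨j, hj, rfl⟩

lemma exists_eq_mul_rectId {m : ℕ} {X : Matrix (Fin n) (Fin m) ℝ} (hm : m ≤ n) (hX : Xᵀ * X = 1) :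
    ∃ g : orthogonalGroup (Fin n) ℝ, X = g.1 * rectId n m := by
  let v : Fin n → EuclideanSpace ℝ (Fin n) := fun i =>
    WithLp.toLp 2 fun a => if h : (i : ℕ) < m then X a ⟨i, h⟩ else 0
  have hv : Orthonormal ℝ (Set.domRestrict {i : Fin n | (i : ℕ) < m} v) := by
    rw [orthonormal_iff_ite]
    rintro ⟨i, hi⟩ ⟨j, hj⟩
    have h := congrFun₂ hX ⟨i, hi⟩ ⟨j, hj⟩
    rw [mul_apply, one_apply] at h
    simp only [Set.mem_ofPred_eq] at hi hj
    simp only [Set.domRestrict_apply, v, PiLp.inner_apply, hi, hj, dif_pos, Subtype.mk.injEq, Fin.ext_iff]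
    simp only [transpose_apply, Fin.mk.injEq] at h
    rw [← h]
    simp [mul_comm]
  obtain ⟨b, hb⟩ := hv.exists_orthonormalBasis_extension_of_card_eq (by simp)
  refine ⟨⟨_, (EuclideanSpace.basisFun (Fin n) ℝ).toMatrix_orthonormalBasis_mem_orthogonal b⟩, ?_⟩
  ext a j
  rw [mul_apply, Finset.sum_eq_single (Fin.castLE hm j)]
  · have := hb (Fin.castLE hm j) j.2
    simp [rectId, this, v, Module.Basis.toMatrix_apply]
  · intro c _ hc
    have : (c : ℕ) ≠ j := fun h => hc (Fin.ext h)
    simp [rectId, this]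
  · simp

end Flags

end Vexillar

namespace Vexillar

open Matrix MvPolynomial MeasureTheory Module

/-! ### Averaging over compact groups -/

section Haar

variable (G : Type*) [Group G] [TopologicalSpace G] [IsTopologicalGroup G] [CompactSpace G]
  [MeasurableSpace G] [BorelSpace G]

/-- The normalised Haar measure of a compact group. -/
noncomputable abbrev haarProb : Measure G :=
  Measure.haarMeasure (⊤ : TopologicalSpace.PositiveCompacts G)

instance : IsProbabilityMeasure (haarProb G) :=
  ⟨Measure.haarMeasure_self (K₀ := (⊤ : TopologicalSpace.PositiveCompacts G))⟩

variable {G}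

lemma integral_haarProb_mul_right (F : G → ℝ) (h : G) :
    ∫ g, F (g * h) ∂(haarProb G) = ∫ g, F g ∂(haarProb G) := by
  have hcont : Continuous (MulAut.conj h⁻¹).toMonoidHom := by
    change Continuous fun g => h⁻¹ * g * h⁻¹⁻¹
    fun_prop
  have hinv : Continuous (MulAut.conj h⁻¹).symm := by
    change Continuous fun g => h⁻¹⁻¹ * g * h⁻¹
    fun_prop
  have hmp : MeasurePreserving (MulAut.conj h⁻¹).toMonoidHom (haarProb G) (haarProb G) :=
    MonoidHom.measurePreserving hcont (MulAut.conj h⁻¹).surjective rfl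
  let e : G ≃ₜ G := ⟨(MulAut.conj h⁻¹).toEquiv, hcont, hinv⟩
  have h1 := hmp.integral_comp e.measurableEmbedding fun g => F (h * g)
  rw [integral_mul_left_eq_self F h] at h1
  rw [← h1]
  refine integral_congr_ae (Filter.Eventually.of_forall fun g => ?_)
  simp [mul_assoc]

end Haar

lemma continuous_ev {G : Type*} [TopologicalSpace G] {n m : ℕ} {x : G → Matrix (Fin n) (Fin m) ℝ} (hx : Continuous x) (f : Reg n m) :
    Continuous fun g => ev (x g) f := by
  have h : Continuous fun g => fun p : Fin n × Fin m => x g p.1 p.2 := by fun_prop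
  exact (MvPolynomial.continuous_eval f).comp h

section Average

variable {G : Type*} [TopologicalSpace G]

variable {p : ℕ} {μ : YoungDiagram}

lemma continuous_dual_schur {w : G → schur p μ} (hw : ∀ Z, Continuous fun g => ev Z (w g).1)
    (l : Dual ℝ (schur p μ)) : Continuous fun g => l (w g) := by
  let S : Submodule ℝ (Dual ℝ (schur p μ)) :=
    { carrier := {l | Continuous fun g => l (w g)}
      add_mem' := fun ha hb => Continuous.add ha hb
      zero_mem' := continuous_const
      smul_mem' := fun c l hl => Continuous.mul continuous_const hl }
  have hS : S = ⊤ := by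
    rw [← Subspace.dualCoannihilator_dualAnnihilator_eq (W := S)]
    have : S.dualCoannihilator = ⊥ := by
      rw [eq_bot_iff]
      intro V hV
      rw [Submodule.mem_dualCoannihilator] at hV
      refine Subtype.ext (ev_injective fun Z => ?_)
      let E : Dual ℝ (schur p μ) :=
        { toFun := fun V => ev Z V.1
          map_add' := fun V W => by simp
          map_smul' := fun c V => by simp }
      have := hV E (hw Z)
      change ev Z V.1 = 0 at this
      rw [this]
      simp
    rw [this, Submodule.dualAnnihilator_bot]
  exact (hS ▸ Submodule.mem_top : l ∈ S)

/-- The mean of a continuous family of vectors of a Schur module. -/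
lemma exists_average [CompactSpace G] [MeasurableSpace G] [BorelSpace G] (ν : Measure G) [IsFiniteMeasure ν] {w : G → schur p μ}
    (hw : ∀ Z, Continuous fun g => ev Z (w g).1) :
    ∃ W : schur p μ, ∀ l : Dual ℝ (schur p μ), ∫ g, l (w g) ∂ν = l W := by
  have hint : ∀ l : Dual ℝ (schur p μ), Integrable (fun g => l (w g)) ν := fun l =>
    (continuous_dual_schur hw l).integrable_of_hasCompactSupport (HasCompactSupport.of_compactSpace _)
  let I : Dual ℝ (Dual ℝ (schur p μ)) :=
    { toFun := fun l => ∫ g, l (w g) ∂ν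
      map_add' := fun l l' => integral_add (hint l) (hint l')
      map_smul' := fun c l => integral_const_mul c _ }
  refine ⟨(evalEquiv ℝ (schur p μ)).symm I, fun l => ?_⟩
  rw [apply_evalEquiv_symm_apply]
  rfl

lemma eq_of_dual_eq {V W : schur p μ} (h : ∀ l : Dual ℝ (schur p μ), l V = l W) : V = W := by
  rw [← sub_eq_zero]
  exact (forall_dual_apply_eq_zero_iff ℝ _).1 fun l => by rw [map_sub, h, sub_self]

end Average

/-! ### Integrals over the flag manifold -/

section Flags

variable {n : ℕ} {d : FlagShape n}

lemma integral_evalFlag {f : Reg n d.m} (hf : RightInvariant d f) :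
    ∫ Δ, evalFlag f Δ ∂(flagMeasure d) =
      ∫ g : orthogonalGroup (Fin n) ℝ, ev (g.1 * rectId n d.m) f ∂(haarProb _) := by
  have h : ∀ g, evalFlag f (flagOf d g) = ev (g.1 * rectId n d.m) f := fun g =>
    evalFlag_eq_ev hf (represents_flagOf g)
  have hc : Continuous fun g : orthogonalGroup (Fin n) ℝ => ev (g.1 * rectId n d.m) f :=
    continuous_ev (by fun_prop) f
  have hm : Measurable (evalFlag f : Flag d → ℝ) := fun s hs => by
    change MeasurableSet ((fun g => evalFlag f (flagOf d g)) ⁻¹' s)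
    simp only [h]
    exact hc.measurable hs
  have hF : Measurable (flagOf d) := fun s hs => hs
  rw [flagMeasure, integral_map hF.aemeasurable hm.aestronglyMeasurable]
  simp only [h]

lemma integral_orbit {m : ℕ} (hm : m ≤ n) {X : Matrix (Fin n) (Fin m) ℝ} (hX : Xᵀ * X = 1)
    (f : Reg n m) :
    ∫ g : orthogonalGroup (Fin n) ℝ, ev (g.1 * X) f ∂(haarProb _) =
      ∫ g : orthogonalGroup (Fin n) ℝ, ev (g.1 * rectId n m) f ∂(haarProb _) := by
  obtain ⟨h, rfl⟩ := exists_eq_mul_rectId hm hX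
  rw [← integral_haarProb_mul_right (fun g : orthogonalGroup (Fin n) ℝ => ev (g.1 * rectId n m) f) h]
  simp only [Matrix.mul_assoc, UnitaryGroup.mul_val]

lemma schurAct_mul {p : ℕ} {μ : YoungDiagram} (g h : Matrix (Fin p) (Fin p) ℝ) (V : schur p μ) :
    schurAct (g * h) V = schurAct g (schurAct h V) := by
  refine Subtype.ext (ev_injective fun Z => ?_)
  simp only [coe_schurAct, ev_actLeft, transpose_mul, Matrix.mul_assoc]

/-- The functions coming from a nontrivial harmonic module have mean zero. -/
lemma integral_phi_harmonic {m : ℕ} {μ : YoungDiagram} (hμ : 0 < μ.card) {H : schur n μ}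
    (hH : H ∈ harmonic n μ) (Ξ : schur m μ) (X : Matrix (Fin n) (Fin m) ℝ) :
    ∫ g : orthogonalGroup (Fin n) ℝ, ev (g.1 * X) (phi n m μ H Ξ) ∂(haarProb _) = 0 := by
  have hw : ∀ Z, Continuous fun g : orthogonalGroup (Fin n) ℝ => ev Z (schurAct g.1ᵀ H).1 := by
    intro Z
    simp only [coe_schurAct, ev_actLeft, transpose_transpose]
    exact continuous_ev (by fun_prop) _
  obtain ⟨W, hW⟩ := exists_average (haarProb (orthogonalGroup (Fin n) ℝ)) hw
  have hfix : ∀ Q ∈ orthogonalGroup (Fin n) ℝ, schurAct Q W = W := by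
    intro Q hQ
    refine eq_of_dual_eq fun l => ?_
    have hQ' : Qᵀ ∈ orthogonalGroup (Fin n) ℝ := by
      rw [mem_orthogonalGroup_iff]
      rw [mem_orthogonalGroup_iff'] at hQ
      rwa [transpose_transpose]
    have h1 := hW (l ∘ₗ schurAct Q)
    rw [LinearMap.comp_apply] at h1
    rw [← h1, ← hW l, ← integral_haarProb_mul_right
      (fun g : orthogonalGroup (Fin n) ℝ => l (schurAct g.1ᵀ H)) ⟨Qᵀ, hQ'⟩]
    simp only [LinearMap.comp_apply, ← schurAct_mul, UnitaryGroup.mul_val, transpose_mul,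
      transpose_transpose]
  have hWH : W ∈ harmonic n μ := by
    rw [← Subspace.dualAnnihilator_dualCoannihilator_eq (W := harmonic n μ),
      Submodule.mem_dualCoannihilator]
    intro l hl
    rw [Submodule.mem_dualAnnihilator] at hl
    rw [← hW l]
    refine integral_eq_zero_of_ae (Filter.Eventually.of_forall fun g => hl _ ?_)
    refine schurAct_mem_harmonic ?_ hH
    rw [transpose_transpose]
    exact (mem_orthogonalGroup_iff _ _).1 g.2
  have hW0 := eq_zero_of_mem_harmonic_of_fixed hμ hWH hfix
  let E : Dual ℝ (schur n μ) :=
    { toFun := fun V => ev X (phi n m μ V Ξ)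
      map_add' := fun V V' => by simp
      map_smul' := fun c V => by simp }
  have h1 := hW E
  rw [hW0, map_zero] at h1
  rw [← h1]
  refine integral_congr_ae (Filter.Eventually.of_forall fun g => ?_)
  change _ = ev X (phi n m μ (schurAct g.1ᵀ H) Ξ)
  rw [← actLeft_phi, ev_actLeft, transpose_transpose]

/-- The group `O(m₁) × ⋯ × O(m_ℓ)`. -/
def blockGroup (d : FlagShape n) : Subgroup (orthogonalGroup (Fin d.m) ℝ) where
  carrier := {h | IsBlockOrthogonal d h.1}
  mul_mem' := by
    rintro g h ⟨hg, hg'⟩ ⟨hh, hh'⟩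
    refine ⟨mul_mem hg hh, fun a b hab i => ?_⟩
    rw [UnitaryGroup.mul_val, mul_apply] at hab
    obtain ⟨c, -, hc⟩ := Finset.exists_ne_zero_of_sum_ne_zero hab
    exact (hg' a c (left_ne_zero_of_mul hc) i).trans (hh' c b (right_ne_zero_of_mul hc) i)
  one_mem' := ⟨one_mem _, fun a b hab i => by
    have : a = b := by
      by_contra h
      exact hab (one_apply_ne h)
    rw [this]⟩
  inv_mem' := by
    rintro g ⟨-, hg'⟩
    exact ⟨g⁻¹.2, fun a b hab i => (hg' b a hab i).symm⟩

instance (d : FlagShape n) : CompactSpace (blockGroup d) := by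
  refine isCompact_iff_compactSpace.1 (IsClosed.isCompact ?_)
  have : (blockGroup d : Set (orthogonalGroup (Fin d.m) ℝ)) =
      ⋂ (a : Fin d.m) (b : Fin d.m) (_ : ¬ ∀ i, (a : ℕ) < d.dim i ↔ (b : ℕ) < d.dim i),
        {h | h.1 a b = 0} := by
    ext h
    simp only [Set.mem_iInter]
    refine ⟨fun hh a b hab => ?_, fun hh => ⟨h.2, fun a b hab => ?_⟩⟩
    · by_contra hne
      exact hab (hh.2 a b hne)
    · by_contra hne
      exact hab (hh a b hne)
  rw [this]
  exact isClosed_iInter fun a => isClosed_iInter fun b => isClosed_iInter fun _ =>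
    isClosed_eq (continuous_subtype_val.matrix_elem a b) continuous_const

/-- The invariant polynomials among images of harmonic Schur modules. -/
noncomputable def invariantSpan (d : FlagShape n) (t : ℕ) : Submodule ℝ (Reg n d.m) :=
  Submodule.span ℝ {f | ∃ (μ : YoungDiagram) (H : schur n μ) (Ξ : schur d.m μ), μ.card ≤ t ∧
    H ∈ harmonic n μ ∧ Ξ ∈ invariants d μ ∧ f = phi n d.m μ H Ξ}

lemma integral_block_mem {t : ℕ} {f : Reg n d.m} (hf : f ∈ harmonicSpan n d.m t) :
    ∃ f' ∈ invariantSpan d t, ∀ x, ∫ h : blockGroup d, ev (x * h.1.1) f ∂(haarProb _) = ev x f' := by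
  have hint : ∀ (f : Reg n d.m) (x : Matrix (Fin n) (Fin d.m) ℝ),
      Integrable (fun h : blockGroup d => ev (x * h.1.1) f) (haarProb _) := fun f x =>
    (continuous_ev (by fun_prop) f).integrable_of_hasCompactSupport
      (HasCompactSupport.of_compactSpace _)
  rw [harmonicSpan] at hf
  induction hf using Submodule.span_induction with
  | mem f hf =>
    obtain ⟨μ, H, Ξ, ht, hH, rfl⟩ := hf
    have hw : ∀ Z, Continuous fun h : blockGroup d => ev Z (schurAct h.1.1 Ξ).1 := by
      intro Z
      simp only [coe_schurAct, ev_actLeft]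
      exact continuous_ev (by fun_prop) _
    obtain ⟨W, hW⟩ := exists_average (haarProb (blockGroup d)) hw
    refine ⟨_, Submodule.subset_span ⟨μ, H, W, ht, hH, ?_, rfl⟩, fun x => ?_⟩
    · intro h hh
      rw [← coe_schurAct]
      refine congrArg Subtype.val (eq_of_dual_eq fun l => ?_)
      have h1 := hW (l ∘ₗ schurAct h)
      rw [LinearMap.comp_apply] at h1
      rw [← h1, ← hW l, ← integral_mul_left_eq_self
        (fun g : blockGroup d => l (schurAct g.1.1 Ξ)) ⟨⟨h, hh.1⟩, hh⟩]
      simp only [LinearMap.comp_apply, ← schurAct_mul, Subgroup.coe_mul, UnitaryGroup.mul_val]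
    · let E : Dual ℝ (schur d.m μ) :=
        { toFun := fun V => ev x (phi n d.m μ H V)
          map_add' := fun V V' => by simp
          map_smul' := fun c V => by simp }
      refine Eq.trans (integral_congr_ae (Filter.Eventually.of_forall fun h => ?_)) (hW E)
      change _ = ev x (phi n d.m μ H (schurAct h.1.1 Ξ))
      rw [← rightSub_phi, ev_rightSub]
  | zero => exact ⟨0, Submodule.zero_mem _, fun x => by simp⟩
  | add f g _ _ hf hg =>
    obtain ⟨f', hf', hfx⟩ := hf
    obtain ⟨g', hg', hgx⟩ := hg
    refine ⟨f' + g', Submodule.add_mem _ hf' hg', fun x => ?_⟩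
    simp only [map_add]
    rw [integral_add (hint f x) (hint g x), hfx, hgx]
  | smul c f _ hf =>
    obtain ⟨f', hf', hfx⟩ := hf
    refine ⟨c • f', Submodule.smul_mem _ _ hf', fun x => ?_⟩
    simp only [ev_smul]
    rw [integral_const_mul, hfx]

/-- On matrices with orthonormal columns, an invariant polynomial is a combination of invariant
images of harmonic Schur modules. -/
lemma exists_invariantSpan {t : ℕ} {f : Reg n d.m} (hf : RightInvariant d f)
    (ht : f.totalDegree ≤ t) :
    ∃ f' ∈ invariantSpan d t, ∀ x : Matrix (Fin n) (Fin d.m) ℝ, xᵀ * x = 1 → ev x f = ev x f' := by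
  obtain ⟨g, hg, v, hv, rfl⟩ := Submodule.mem_sup.1
    (restrictTotalDegree_le_harmonicSpan n d.m t ((mem_restrictTotalDegree _ _ _).2 ht))
  obtain ⟨f', hf', hfx⟩ := integral_block_mem hg
  refine ⟨f', hf', fun x hx => ?_⟩
  rw [← hfx x]
  have : ∀ h : blockGroup d, ev (x * h.1.1) g = ev x (g + v) := by
    intro h
    have h1 : (x * h.1.1)ᵀ * (x * h.1.1) = 1 := by
      rw [transpose_mul, Matrix.mul_assoc, ← Matrix.mul_assoc xᵀ, hx, Matrix.one_mul]
      exact (mem_orthogonalGroup_iff' _ _).1 h.1.2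
    rw [← hf h.1.1 h.2, ev_rightSub, map_add, hv _ h1, add_zero]
  simp only [this, integral_const, probReal_univ, one_smul]

lemma rightInvariant_phi {μ : YoungDiagram} (H : schur n μ) {Ξ : schur d.m μ}
    (hΞ : Ξ ∈ invariants d μ) : RightInvariant d (phi n d.m μ H Ξ) := by
  intro h hh
  rw [rightSub_phi]
  congr 1
  exact Subtype.ext ((coe_schurAct _ _).trans (hΞ h hh))

end Flags

end Vexillar

namespace Vexillar

open Matrix MvPolynomial MeasureTheory

/-! ### Characterisations of vexillar designs -/

section Designs

variable {n : ℕ} {d : FlagShape n} {t : ℕ} {D : Finset (Flag d)}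

lemma rightInvariant_actLeft {f : Reg n d.m} (hf : RightInvariant d f)
    (g : Matrix (Fin n) (Fin n) ℝ) : RightInvariant d (actLeft g f) := by
  intro h hh
  refine ev_injective fun x => ?_
  rw [ev_rightSub, ev_actLeft, ev_actLeft, ← Matrix.mul_assoc, ← ev_rightSub, hf h hh]

lemma rightInvariant_homogeneousComponent {f : Reg n d.m} (hf : RightInvariant d f) (k : ℕ) :
    RightInvariant d (homogeneousComponent k f) := by
  intro h hh
  conv_rhs => rw [← hf h hh, ← sum_homogeneousComponent f, map_sum, map_sum]
  have hc : ∀ i, homogeneousComponent k (rightSub (n := n) h (homogeneousComponent i f)) =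
      if i = k then rightSub h (homogeneousComponent k f) else 0 := by
    intro i
    rw [homogeneousComponent_of_mem
      (rightSub_isHomogeneous h (homogeneousComponent_isHomogeneous i f))]
    by_cases h1 : i = k
    · rw [if_pos h1.symm, if_pos h1, h1]
    · rw [if_neg (Ne.symm h1), if_neg h1]
  simp only [hc, Finset.sum_ite_eq']
  split_ifs with h1
  · rfl
  · rw [homogeneousComponent_eq_zero _ _ (by simpa using h1), map_zero]

lemma evalFlag_act {f : Reg n d.m} (hf : RightInvariant d f) (τ : orthogonalGroup (Fin n) ℝ)
    (Δ : Flag d) : evalFlag f (Δ.act τ) = ev (τ.1 * Δ.matrix) f :=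
  evalFlag_eq_ev hf (Δ.represents_matrix.act τ)

lemma IsVexillarDesign.sum_act (hD : D.Nonempty) (h : IsVexillarDesign t D) {f : Reg n d.m} {k : ℕ}
    (hk : k ≤ t) (hfk : f.IsHomogeneous k) (hf : RightInvariant d f) (τ : orthogonalGroup (Fin n) ℝ) :
    ∑ Δ ∈ D, evalFlag f Δ = ∑ Δ ∈ D, evalFlag f (Δ.act τ) := by
  have h1 := h f (hfk.totalDegree_le.trans hk) hf
  have h2 := h (actLeft τ.1ᵀ f) ((actLeft_isHomogeneous _ hfk).totalDegree_le.trans hk)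
    (rightInvariant_actLeft hf _)
  rw [integral_evalFlag hf] at h1
  rw [integral_evalFlag (rightInvariant_actLeft hf _)] at h2
  have h3 : ∫ g : orthogonalGroup (Fin n) ℝ, ev (g.1 * rectId n d.m) (actLeft τ.1ᵀ f)
      ∂(haarProb _) = ∫ g : orthogonalGroup (Fin n) ℝ, ev (g.1 * rectId n d.m) f ∂(haarProb _) := by
    rw [← integral_mul_left_eq_self
      (fun g : orthogonalGroup (Fin n) ℝ => ev (g.1 * rectId n d.m) f) τ]
    simp only [ev_actLeft, transpose_transpose, UnitaryGroup.mul_val, Matrix.mul_assoc]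
  rw [h1.symm.trans (h3.symm.trans h2) |> mul_left_cancel₀
    (inv_ne_zero (Nat.cast_ne_zero.2 (Finset.card_pos.2 hD).ne'))]
  refine Finset.sum_congr rfl fun Δ _ => ?_
  rw [evalFlag_act hf]
  change ev Δ.matrix (actLeft τ.1ᵀ f) = _
  rw [ev_actLeft, transpose_transpose]

lemma isVexillarDesign_of_sum_act (hD : D.Nonempty)
    (h : ∀ (k : ℕ) (f : Reg n d.m), k ≤ t → f.IsHomogeneous k → RightInvariant d f →
      ∀ τ : orthogonalGroup (Fin n) ℝ, ∑ Δ ∈ D, evalFlag f Δ = ∑ Δ ∈ D, evalFlag f (Δ.act τ)) :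
    IsVexillarDesign t D := by
  intro f ht hf
  have h1 : ∀ τ : orthogonalGroup (Fin n) ℝ,
      ∑ Δ ∈ D, evalFlag f Δ = ∑ Δ ∈ D, ev (τ.1 * Δ.matrix) f := by
    intro τ
    have hsum : ∀ x : Matrix (Fin n) (Fin d.m) ℝ, ev x f =
        ∑ k ∈ Finset.range (f.totalDegree + 1), ev x (homogeneousComponent k f) := by
      intro x
      rw [← map_sum, sum_homogeneousComponent]
    change ∑ Δ ∈ D, ev Δ.matrix f = _
    simp only [hsum]
    rw [Finset.sum_comm, Finset.sum_comm (s := D)]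
    refine Finset.sum_congr rfl fun k hk => ?_
    have h2 := h k _ ((Nat.lt_succ_iff.1 (Finset.mem_range.1 hk)).trans ht)
      (homogeneousComponent_isHomogeneous k f) (rightInvariant_homogeneousComponent hf k) τ
    simp only [evalFlag_act (rightInvariant_homogeneousComponent hf k)] at h2
    exact h2
  have h2 : ∑ Δ ∈ D, evalFlag f Δ =
      ∫ τ : orthogonalGroup (Fin n) ℝ, ∑ Δ ∈ D, ev (τ.1 * Δ.matrix) f ∂(haarProb _) := by
    simp only [← h1, integral_const, probReal_univ, one_smul]
  rw [integral_finsetSum _ fun Δ _ => (continuous_ev (by fun_prop) f).integrable_of_hasCompactSupport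
      (HasCompactSupport.of_compactSpace _)] at h2
  simp only [integral_orbit (d.lt 0).le (Flag.represents_matrix _).1] at h2
  rw [integral_evalFlag hf, h2, Finset.sum_const, nsmul_eq_mul, inv_mul_cancel_left₀]
  exact Nat.cast_ne_zero.2 (Finset.card_pos.2 hD).ne'

lemma IsVexillarDesign.sum_phi (hD : D.Nonempty) (h : IsVexillarDesign t D) {μ : YoungDiagram}
    (hμ : 0 < μ.card) (ht : μ.card ≤ t) {Ξ : schur d.m μ} (hΞ : Ξ ∈ invariants d μ)
    {H : schur n μ} (hH : H ∈ harmonic n μ) :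
    ∑ Δ ∈ D, evalFlag (phi n d.m μ H Ξ) Δ = 0 := by
  have h1 := h _ ((phi_isHomogeneous H Ξ).totalDegree_le.trans ht) (rightInvariant_phi H hΞ)
  rw [integral_evalFlag (rightInvariant_phi H hΞ), integral_phi_harmonic hμ hH, eq_comm,
    mul_eq_zero] at h1
  exact h1.resolve_left (inv_ne_zero (Nat.cast_ne_zero.2 (Finset.card_pos.2 hD).ne'))

lemma isVexillarDesign_of_sum_phi (hD : D.Nonempty)
    (h : ∀ μ : YoungDiagram, 0 < μ.card → μ.card ≤ t → ∀ Ξ ∈ invariants d μ,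
      ∀ H ∈ harmonic n μ, ∑ Δ ∈ D, evalFlag (phi n d.m μ H Ξ) Δ = 0) :
    IsVexillarDesign t D := by
  have key : ∀ f ∈ invariantSpan d t,
      ∫ g : orthogonalGroup (Fin n) ℝ, ev (g.1 * rectId n d.m) f ∂(haarProb _) =
        (D.card : ℝ)⁻¹ * ∑ Δ ∈ D, evalFlag f Δ := by
    have hint : ∀ f : Reg n d.m, Integrable
        (fun g : orthogonalGroup (Fin n) ℝ => ev (g.1 * rectId n d.m) f) (haarProb _) := fun f =>
      (continuous_ev (by fun_prop) f).integrable_of_hasCompactSupport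
        (HasCompactSupport.of_compactSpace _)
    intro f hf
    rw [invariantSpan] at hf
    induction hf using Submodule.span_induction with
    | mem f hf =>
      obtain ⟨μ, H, Ξ, ht, hH, hΞ, rfl⟩ := hf
      rcases Nat.eq_zero_or_pos μ.card with h0 | h0
      · have h1 := (phi_isHomogeneous H Ξ).totalDegree_le
        rw [h0, Nat.le_zero, totalDegree_eq_zero_iff_eq_C] at h1
        rw [h1]
        simp only [evalFlag, eval_C, integral_const, probReal_univ, one_smul, Finset.sum_const,
          nsmul_eq_mul]
        rw [inv_mul_cancel_left₀]
        exact Nat.cast_ne_zero.2 (Finset.card_pos.2 hD).ne'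
      · rw [integral_phi_harmonic h0 hH, h μ h0 ht Ξ hΞ H hH, mul_zero]
    | zero => simp [evalFlag]
    | add f g _ _ hf hg =>
      simp only [evalFlag, map_add, Finset.sum_add_distrib, mul_add] at hf hg ⊢
      rw [integral_add (hint f) (hint g), hf, hg]
    | smul c f _ hf =>
      have h1 : ∀ Δ : Flag d, evalFlag (c • f) Δ = c * evalFlag f Δ := fun Δ =>
        ev_smul Δ.matrix c f
      simp only [ev_smul, h1, ← Finset.mul_sum]
      rw [integral_const_mul, hf]
      ring
  intro f ht hf
  obtain ⟨f', hf', hff⟩ := exists_invariantSpan hf ht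
  have h1 : ∀ g : orthogonalGroup (Fin n) ℝ,
      ev (g.1 * rectId n d.m) f = ev (g.1 * rectId n d.m) f' := fun g =>
    hff _ (represents_flagOf (d := d) g).1
  have h2 : ∀ Δ : Flag d, evalFlag f Δ = evalFlag f' Δ := fun Δ => hff _ Δ.represents_matrix.1
  rw [integral_evalFlag hf]
  simp only [h1, h2]
  exact key f' hf'

lemma harmonicBasis_mem (n : ℕ) (μ : YoungDiagram) (i : Fin (Module.finrank ℝ (harmonic n μ))) :
    harmonicBasis n μ i ∈ harmonic n μ := by
  have h : Submodule.span ℝ (Set.range (harmonicBasis n μ)) = harmonic n μ :=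
    (exists_orthonormalBasis n μ).choose_spec.2
  exact h.le (Submodule.subset_span ⟨i, rfl⟩)

lemma sum_zonal {μ : YoungDiagram} (D : Finset (Flag d)) (Ξ Ξ' : schur d.m μ) (Δ' : Flag d) :
    ∑ Δ ∈ D, zonal Ξ Ξ' Δ Δ' = (Module.finrank ℝ (harmonic n μ) : ℝ)⁻¹ *
      ∑ i, (∑ Δ ∈ D, evalFlag (phi n d.m μ (harmonicBasis n μ i) Ξ) Δ) *
        evalFlag (phi n d.m μ (harmonicBasis n μ i) Ξ') Δ' := by
  simp only [zonal]
  rw [← Finset.mul_sum, Finset.sum_comm]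
  simp only [Finset.sum_mul]

lemma sum_phi_of_sum_zonal {μ : YoungDiagram} {Ξ : schur d.m μ}
    (h : ∀ Δ' : Flag d, ∑ Δ ∈ D, zonal Ξ Ξ Δ Δ' = 0) {H : schur n μ} (hH : H ∈ harmonic n μ) :
    ∑ Δ ∈ D, evalFlag (phi n d.m μ H Ξ) Δ = 0 := by
  have hbasis : ∀ i, ∑ Δ ∈ D, evalFlag (phi n d.m μ (harmonicBasis n μ i) Ξ) Δ = 0 := by
    intro i
    have hN : (Module.finrank ℝ (harmonic n μ) : ℝ)⁻¹ ≠ 0 :=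
      inv_ne_zero (Nat.cast_ne_zero.2 (Nat.ne_of_gt ((Nat.zero_le _).trans_lt i.2)))
    have h1 : ∑ Δ' ∈ D, ∑ i, (∑ Δ ∈ D, evalFlag (phi n d.m μ (harmonicBasis n μ i) Ξ) Δ) *
        evalFlag (phi n d.m μ (harmonicBasis n μ i) Ξ) Δ' = 0 := by
      refine Finset.sum_eq_zero fun Δ' _ => ?_
      have h2 := h Δ'
      rw [sum_zonal] at h2
      exact (mul_eq_zero.1 h2).resolve_left hN
    rw [Finset.sum_comm] at h1
    simp only [← Finset.mul_sum] at h1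
    exact mul_self_eq_zero.1
      ((Finset.sum_eq_zero_iff_of_nonneg fun _ _ => mul_self_nonneg _).1 h1 i (Finset.mem_univ i))
  have hspan : Submodule.span ℝ (Set.range (harmonicBasis n μ)) = harmonic n μ :=
    (exists_orthonormalBasis n μ).choose_spec.2
  rw [← hspan] at hH
  induction hH using Submodule.span_induction with
  | mem V hV =>
    obtain ⟨i, rfl⟩ := hV
    exact hbasis i
  | zero => simp [evalFlag]
  | add V W _ _ hV hW =>
    simp only [evalFlag, map_add, LinearMap.add_apply, Finset.sum_add_distrib] at hV hW ⊢
    rw [hV, hW, add_zero]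
  | smul c V _ hV =>
    have h1 : ∀ Δ : Flag d, evalFlag (phi n d.m μ (c • V) Ξ) Δ = c * evalFlag (phi n d.m μ V Ξ) Δ := by
      intro Δ
      rw [map_smul, LinearMap.smul_apply]
      exact ev_smul Δ.matrix c _
    simp only [h1, ← Finset.mul_sum, hV, mul_zero]

end Designs

end Vexillar

theorem mainTheorem1 (n : ℕ) (d : Vexillar.FlagShape n) (t : ℕ)
    (D : Finset (Vexillar.Flag d)) (hD : D.Nonempty) :
    List.TFAE [
      Vexillar.IsVexillarDesign t D,
      ∀ (k : ℕ) (f : Vexillar.Reg n d.m), k ≤ t → f.IsHomogeneous k →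
        Vexillar.RightInvariant d f → ∀ τ : Matrix.orthogonalGroup (Fin n) ℝ,
          ∑ Δ ∈ D, Vexillar.evalFlag f Δ = ∑ Δ ∈ D, Vexillar.evalFlag f (Δ.act τ),
      ∀ μ : YoungDiagram, 0 < μ.card → μ.card ≤ t → ∀ Ξ ∈ Vexillar.invariants d μ,
        ∀ f ∈ (Vexillar.harmonic n μ).map ((Vexillar.phi n d.m μ).flip Ξ),
          ∑ Δ ∈ D, Vexillar.evalFlag f Δ = 0,
      ∀ μ : YoungDiagram, 0 < μ.card → μ.card ≤ t → ∀ Ξ ∈ Vexillar.invariants d μ,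
        ∀ Ξ' ∈ Vexillar.invariants d μ, ∀ Δ' : Vexillar.Flag d,
          ∑ Δ ∈ D, Vexillar.zonal Ξ Ξ' Δ Δ' = 0] := by
  tfae_have 1 → 2 := fun h k f hk hfk hf τ => h.sum_act hD hk hfk hf τ
  tfae_have 2 → 1 := Vexillar.isVexillarDesign_of_sum_act hD
  tfae_have 1 → 3 := by
    rintro h μ hμ ht Ξ hΞ _ ⟨H, hH, rfl⟩
    exact h.sum_phi hD hμ ht hΞ hH
  tfae_have 3 → 1 := fun h => Vexillar.isVexillarDesign_of_sum_phi hD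
    fun μ hμ ht Ξ hΞ H hH => h μ hμ ht Ξ hΞ _ ⟨H, hH, rfl⟩
  tfae_have 3 → 4 := by
    intro h μ hμ ht Ξ hΞ Ξ' _ Δ'
    rw [Vexillar.sum_zonal, Finset.sum_eq_zero fun i _ => ?_, mul_zero]
    exact mul_eq_zero_of_left (h μ hμ ht Ξ hΞ _ ⟨_, Vexillar.harmonicBasis_mem n μ i, rfl⟩) _
  tfae_have 4 → 3 := by
    rintro h μ hμ ht Ξ hΞ _ ⟨H, hH, rfl⟩
    exact Vexillar.sum_phi_of_sum_zonal (h μ hμ ht Ξ hΞ Ξ hΞ) hH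
  tfae_finish
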